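/- Let $K_{1,s}$ denote the $s$-star (one center joined to $s$ leaves; $K_{1,0}$ is a single vertex). In the decision problem Star Partition, the input is a simple undirected graph $G=(V,E)$ with $n$ vertices and an integer $s\ge 0$, and the question is whether $V$ can be partitioned into $k:=\lceil n/(s+1)\rceil$ pairwise disjoint sets $V_1,\dots,V_k$ such that each induced subgraph $G[V_i]$ contains $K_{1,s}$ as a (not necessarily induced) subgraph. A cograph is a graph that has no induced path on four vertices. Theorem. Star Partition can be solved in $O(kn^2)$ time on cographs. That is, there are a single program for a deterministic unit-cost random access machine (with addition, truncated subtraction, multiplication, integer division, indirect loads and stores, and conditional jumps) and a constant $C$ such that, for every cograph $G$ with vertex set $\{0,\dots,n-1\}$, given by its adjacency matrix, and every integer $s\ge 0$, the program halts on $(G,s)$ after at most $C\,(kn^2+1)$ steps with the correct yes/no answer, and all numbers that it ever stores are at most $C\,(n+s+1)^C$ (that is, words of $O(\log(n+s+2))$ bits suffice). The summand $1$ matters only for $n=0$. -/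

import Mathlib

open scoped SimpleGraph

/-! ## Cographs and star partitions -/

/-- A graph is a cograph if it has no induced path on four vertices. -/
def IsCograph {V : Type*} (G : SimpleGraph V) : Prop :=
  ¬ (SimpleGraph.pathGraph 4).IsIndContained G

/-- The `s`-star `K_{1,s}`: one center, joined to each of `s` leaves. -/
abbrev starK (s : ℕ) : SimpleGraph (Fin 1 ⊕ Fin s) :=
  completeBipartiteGraph (Fin 1) (Fin s)

/-- The number of stars, `k = ⌈n / (s + 1)⌉`. -/
def numStars (n s : ℕ) : ℕ := n ⌈/⌉ (s + 1)

/-- `(G, s)` is a yes-instance of Star Partition: the vertex set is the union of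
`k = ⌈n / (s + 1)⌉` pairwise disjoint sets, each of which induces a subgraph that contains an
`s`-star as a (not necessarily induced) subgraph. -/
def HasStarPartition {V : Type*} [Fintype V] (G : SimpleGraph V) (s : ℕ) : Prop :=
  ∃ P : Fin (numStars (Fintype.card V) s) → Set V,
    (∀ i j, i ≠ j → Disjoint (P i) (P j)) ∧
    (⋃ i, P i) = Set.univ ∧
    ∀ i, (starK s).IsContained (G.induce (P i))

/-! ## Random access machines with unit-cost instructions -/

namespace WordRAM

/-- Instructions. `d`, `a`, `b` are names of registers, `v` is a constant and `l` is the position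
of an instruction in the program. -/
inductive Instr where
  /-- `R_d := v` -/
  | const (d v : ℕ)
  /-- `R_d := R_a + R_b` -/
  | add (d a b : ℕ)
  /-- `R_d := max (R_a - R_b, 0)` -/
  | sub (d a b : ℕ)
  /-- `R_d := R_a * R_b` -/
  | mul (d a b : ℕ)
  /-- `R_d := ⌊R_a / R_b⌋`, and `0` if `R_b = 0` -/
  | div (d a b : ℕ)
  /-- `R_d := M[R_a]` -/
  | load (d a : ℕ)
  /-- `M[R_a] := R_b` -/
  | store (a b : ℕ)
  /-- if `R_a ≤ R_b`, go to the instruction at position `l` -/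
  | jle (a b l : ℕ)
  /-- halt with the answer "yes" -/
  | accept
  /-- halt with the answer "no" -/
  | reject

/-- A program is a finite list of instructions. -/
abbrev Program := List Instr

/-- A configuration: the program counter, the registers and the memory cells. -/
structure Config where
  pc : ℕ
  reg : ℕ → ℕ
  mem : ℕ → ℕ

/-- The effect of one instruction. -/
def Instr.exec : Instr → Config → Config
  | .const d v, c => { c with pc := c.pc + 1, reg := Function.update c.reg d v }
  | .add d a b, c =>
      { c with pc := c.pc + 1, reg := Function.update c.reg d (c.reg a + c.reg b) }
  | .sub d a b, c =>
      { c with pc := c.pc + 1, reg := Function.update c.reg d (c.reg a - c.reg b) }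
  | .mul d a b, c =>
      { c with pc := c.pc + 1, reg := Function.update c.reg d (c.reg a * c.reg b) }
  | .div d a b, c =>
      { c with pc := c.pc + 1, reg := Function.update c.reg d (c.reg a / c.reg b) }
  | .load d a, c =>
      { c with pc := c.pc + 1, reg := Function.update c.reg d (c.mem (c.reg a)) }
  | .store a b, c =>
      { c with pc := c.pc + 1, mem := Function.update c.mem (c.reg a) (c.reg b) }
  | .jle a b l, c => { c with pc := if c.reg a ≤ c.reg b then l else c.pc + 1 }
  | .accept, c => c
  | .reject, c => c

/-- One step of the machine. A program counter outside the program makes the machine stay where it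
is, without an answer. -/
def step (P : Program) (c : Config) : Config :=
  match P[c.pc]? with
  | some i => i.exec c
  | none => c

/-- The configuration after `t` steps. -/
def run (P : Program) (c : Config) (t : ℕ) : Config := (step P)^[t] c

/-- All registers and memory cells hold numbers that are at most `B`. -/
def Config.BoundedBy (c : Config) (B : ℕ) : Prop :=
  (∀ r, c.reg r ≤ B) ∧ ∀ a, c.mem a ≤ B

/-- Started in `c`, the program `P` halts after at most `T` steps with the correct answer to the
question whether `yes` holds, and until then it never holds a number greater than `B` in a register
or memory cell. -/
def DecidesWithin (P : Program) (c : Config) (T B : ℕ) (yes : Prop) : Prop :=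
  ∃ t ≤ T,
    (∀ u ≤ t, (run P c u).BoundedBy B) ∧
    ((P[(run P c t).pc]? = some .accept ∧ yes) ∨
      (P[(run P c t).pc]? = some .reject ∧ ¬ yes))

end WordRAM

open Classical in
/-- The input configuration for the instance `(G, s)`: register `0` holds `n`, register `1` holds
`s`, the first `n²` memory cells hold the adjacency matrix of `G` row by row, and all other registers
and memory cells hold `0`. -/
noncomputable def starInput {n : ℕ} (G : SimpleGraph (Fin n)) (s : ℕ) : WordRAM.Config where
  pc := 0
  reg r := if r = 0 then n else if r = 1 then s else 0
  mem a := if ∃ i j : Fin n, G.Adj i j ∧ a = (i : ℕ) * n + (j : ℕ) then 1 else 0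

/-! A cograph is built from single vertices by disjoint unions and joins, so it has a binary cotree,
on which a dynamic program finds how many vertices can be covered.

Reduction. As `k * (s + 1)` is at least `n` and each class needs `s + 1` vertices, a star partition
forces `n = k * (s + 1)`. It then amounts to a choice of `k` centers together with an assignment of
`s * k` leaves to adjacent centers, at most `s` to each (`hasStarPartition_iff`).

Recursion. For the vertex set of a node of the cotree and a number `c` of centers, let the table
hold the maximum number of leaves (`IsBest`). At a union the values of the children add up. At a
join with `c₁` and `c₂` centers on the two sides, every vertex of one side may be given to every
center of the other side, so only numbers matter and the optimum is a maximum flow; `nodeVal` is the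
minimum of its four cuts. `Covers.node`, with the explicit flow of `exists_flow`, attains this
value, and `Covers.exists_of_node` shows that nothing exceeds it. Hence the best values of the
children determine those of the parent.

Cotree. Vertices are inserted one by one. Going up the old cotree, each subtree is either split into
the neighbors and the non-neighbors of the new vertex `x`, all cross pairs being of the type of the
root label, or it has already absorbed `x`. The second case starts when both parts are nonempty and
the label differs from that of the parent. Then the subtree contains a neighbor and a non-neighbor
of `x` whose relation is opposite to the parent label, and since `P₄` is self-complementary and
excluded, `x` is related to everything in the sibling as the parent label says (`adj_eq_of_mixed`).
So `x` is absorbed in only one place, and the rest is merged around it (`ins_spec`).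

Machine. Programs are written in a small language whose loops are bounded by parameters that are
never assigned. `Cmd.code_reach` shows that the compiled code simulates the semantics in exactly
`Cmd.cost` steps; `Cmd.cost_le` bounds this cost by the nesting of the loops. Every assigned value
exceeds the largest stored number by at most one, so stored numbers are bounded by the running time
(`Cmd.ev_bd`) and temporaries by a fixed power of that bound.

Time. Each insertion visits only the `O(n)` nodes of the current cotree, and building takes `O(n²)`
steps. The table has `O(n)` rows, each filled by a loop over `(k + 1)²` pairs `(c₁, c₂)`. As `k ≤
n`, the total `O(n² + n k²)` is `O(k n² + 1)`. -/

set_option linter.constructorNameAsVariable false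
set_option linter.unusedSectionVars false

namespace WordRAM

/-! ## Execution of code fragments -/

/-- The list `l` of instructions occurs in the program `P` at position `pos`. -/
def CodeAt (P : Program) (pos : ℕ) (l : List Instr) : Prop :=
  ∀ i, i < l.length → P[pos + i]? = l[i]?

theorem codeAt_append {P : Program} {pos : ℕ} {l₁ l₂ : List Instr} :
    CodeAt P pos (l₁ ++ l₂) ↔ CodeAt P pos l₁ ∧ CodeAt P (pos + l₁.length) l₂ := by
  constructor
  · intro h
    refine ⟨fun i hi => ?_, fun i hi => ?_⟩
    · rw [h i (by simp; omega), List.getElem?_append_left hi]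
    · rw [add_assoc, h (l₁.length + i) (by simp; omega), List.getElem?_append_right (by omega)]
      congr 1; omega
  · rintro ⟨h₁, h₂⟩ i hi
    by_cases h : i < l₁.length
    · rw [h₁ i h, List.getElem?_append_left h]
    · rw [List.getElem?_append_right (by omega), ← h₂ (i - l₁.length) (by simp at hi; omega)]
      congr 1; omega

theorem codeAt_cons {P : Program} {pos : ℕ} {i : Instr} {l : List Instr} :
    CodeAt P pos (i :: l) ↔ P[pos]? = some i ∧ CodeAt P (pos + 1) l := by
  rw [show i :: l = [i] ++ l from rfl, codeAt_append]
  refine and_congr ⟨fun h => by simpa using h 0 (by simp), fun h j hj => ?_⟩ Iff.rfl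
  have : j = 0 := by simpa using hj
  subst this
  simpa using h

/-- The machine gets from `c` to `c'` in `t` steps and keeps all numbers at most `B`. -/
def Reach (P : Program) (B : ℕ) (c : Config) (t : ℕ) (c' : Config) : Prop :=
  run P c t = c' ∧ ∀ u ≤ t, (run P c u).BoundedBy B

theorem run_add (P : Program) (c : Config) (t u : ℕ) : run P c (t + u) = run P (run P c t) u := by
  unfold run
  rw [add_comm, Function.iterate_add_apply]

theorem Reach.refl {P : Program} {B : ℕ} {c : Config} (h : c.BoundedBy B) : Reach P B c 0 c :=
  ⟨rfl, fun u hu => by obtain rfl : u = 0 := by omega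
                       exact h⟩

theorem Reach.trans {P : Program} {B : ℕ} {c c' c'' : Config} {t u : ℕ}
    (h : Reach P B c t c') (h' : Reach P B c' u c'') : Reach P B c (t + u) c'' := by
  refine ⟨by rw [run_add, h.1, h'.1], fun w hw => ?_⟩
  by_cases hwt : w ≤ t
  · exact h.2 w hwt
  · obtain ⟨r, rfl⟩ := Nat.exists_eq_add_of_le (Nat.le_of_not_le hwt)
    rw [run_add, h.1]
    exact h'.2 r (by omega)

theorem Reach.cast_time {P : Program} {B : ℕ} {c c' : Config} {t u : ℕ} (h : Reach P B c t c')
    (htu : t = u) : Reach P B c u c' := htu ▸ h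

theorem Reach.bounded {P : Program} {B : ℕ} {c c' : Config} {t : ℕ} (h : Reach P B c t c') :
    c'.BoundedBy B := h.1 ▸ h.2 t le_rfl

theorem Reach.one {P : Program} {B : ℕ} {c : Config} {i : Instr} (hi : P[c.pc]? = some i)
    (hc : c.BoundedBy B) (hc' : (i.exec c).BoundedBy B) : Reach P B c 1 (i.exec c) := by
  have h1 : run P c 1 = i.exec c := by simp [run, step, hi]
  refine ⟨h1, fun u hu => ?_⟩
  interval_cases u
  · exact hc
  · rw [h1]; exact hc'

theorem Config.BoundedBy.update_reg {c : Config} {B : ℕ} (h : c.BoundedBy B) {w : ℕ} (hw : w ≤ B)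
    (p d : ℕ) : (Config.mk p (Function.update c.reg d w) c.mem).BoundedBy B := by
  refine ⟨fun r => ?_, h.2⟩
  simp only [Function.update_apply]
  split_ifs
  · exact hw
  · exact h.1 r

theorem Config.BoundedBy.update_mem {c : Config} {B : ℕ} (h : c.BoundedBy B) {w : ℕ} (hw : w ≤ B)
    (p d : ℕ) : (Config.mk p c.reg (Function.update c.mem d w)).BoundedBy B := by
  refine ⟨h.1, fun r => ?_⟩
  simp only [Function.update_apply]
  split_ifs
  · exact hw
  · exact h.2 r

theorem Reach.regOp {P : Program} {B : ℕ} {c : Config} {i : Instr} {d w : ℕ}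
    (hi : P[c.pc]? = some i) (he : i.exec c = ⟨c.pc + 1, Function.update c.reg d w, c.mem⟩)
    (hc : c.BoundedBy B) (hw : w ≤ B) :
    Reach P B c 1 ⟨c.pc + 1, Function.update c.reg d w, c.mem⟩ := by
  rw [← he]
  exact Reach.one hi hc (he ▸ hc.update_reg hw _ _)

/-! ## A structured language with bounded loops -/

/-- Variables. The first six are parameters, which are never assigned. -/
inductive Var where
  | n | s | k | k1 | kk | nb
  | x | j | u | cnt | cnt0 | st | root | o | oc | p | q | r | t | a | b
  | fa | ea | da | fb | eb | db | f | e | d | ca | cb | va | ans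
  deriving DecidableEq

/-- Arrays. -/
inductive Arr where
  | K | L | R | M | F | E | D | sz | T
  deriving DecidableEq

/-- The register of a variable. -/
def Var.code (x : Var) : ℕ := x.ctorIdx

/-- The residue class of an array among the memory cells behind the input. -/
def Arr.code (A : Arr) : ℕ := A.ctorIdx

theorem Var.code_injective : Function.Injective Var.code :=
  Function.LeftInverse.injective Var.ofNat_ctorIdx

theorem Arr.code_injective : Function.Injective Arr.code :=
  Function.LeftInverse.injective Arr.ofNat_ctorIdx

theorem Var.code_lt (x : Var) : x.code < 98 := by cases x <;> decide

theorem Arr.code_lt (A : Arr) : A.code < 9 := by cases A <;> decide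

/-- The parameters. -/
def Var.isParam (x : Var) : Bool := x.code < 6

/-- States: variables, arrays and the input array. -/
structure Store where
  v : Var → ℕ
  a : Arr → ℕ → ℕ
  inp : ℕ → ℕ

def Store.setV (σ : Store) (x : Var) (w : ℕ) : Store := { σ with v := Function.update σ.v x w }

def Store.setA (σ : Store) (A : Arr) (i w : ℕ) : Store :=
  { σ with a := Function.update σ.a A (Function.update (σ.a A) i w) }

/-- Expressions. -/
inductive Expr where
  | var (x : Var)
  | lit (m : ℕ)
  | add (a b : Expr)
  | sub (a b : Expr)
  | mul (a b : Expr)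
  | div (a b : Expr)
  | get (A : Arr) (i : Expr)
  | inp (i : Expr)

def Expr.val (σ : Store) : Expr → ℕ
  | var x => σ.v x
  | lit m => m
  | add a b => a.val σ + b.val σ
  | sub a b => a.val σ - b.val σ
  | mul a b => a.val σ * b.val σ
  | div a b => a.val σ / b.val σ
  | get A i => σ.a A (i.val σ)
  | inp i => σ.inp (i.val σ)

/-- An exponent such that all numbers in an evaluation are at most that power of a bound on the
state. -/
def Expr.deg : Expr → ℕ
  | var _ => 1
  | lit m => m + 1
  | add a b => max a.deg b.deg + 1
  | sub a b => max a.deg b.deg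
  | mul a b => a.deg + b.deg
  | div a b => max a.deg b.deg
  | get _ i => i.deg + 3
  | inp i => i.deg + 1

/-- The number of instructions of the code of an expression. -/
def Expr.len : Expr → ℕ
  | var _ => 1
  | lit _ => 1
  | add a b => a.len + b.len + 1
  | sub a b => a.len + b.len + 1
  | mul a b => a.len + b.len + 1
  | div a b => a.len + b.len + 1
  | get _ i => i.len + 6
  | inp i => i.len + 8

/-- Registers for intermediate results. -/
def tmp (d : ℕ) : ℕ := 102 + 3 * d

/-- A register that always holds `0`. -/
def zeroReg : ℕ := 98

/-- A register that holds the size of the input matrix. -/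
def baseReg : ℕ := 99

/-- Computes in the register `tmp d` the address of the cell of `A` with index in `tmp d`. -/
def addrCode (A : Arr) (d : ℕ) : List Instr :=
  [.const (tmp (d + 1)) 9, .mul (tmp d) (tmp d) (tmp (d + 1)), .const (tmp (d + 1)) A.code,
    .add (tmp d) (tmp d) (tmp (d + 1)), .add (tmp d) baseReg (tmp d)]

/-- Code that computes an expression in the register `tmp d`. -/
def Expr.code : Expr → ℕ → List Instr
  | var x, d => [.add (tmp d) x.code zeroReg]
  | lit m, d => [.const (tmp d) m]
  | add a b, d => a.code d ++ (b.code (d + 1) ++ [.add (tmp d) (tmp d) (tmp (d + 1))])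
  | sub a b, d => a.code d ++ (b.code (d + 1) ++ [.sub (tmp d) (tmp d) (tmp (d + 1))])
  | mul a b, d => a.code d ++ (b.code (d + 1) ++ [.mul (tmp d) (tmp d) (tmp (d + 1))])
  | div a b, d => a.code d ++ (b.code (d + 1) ++ [.div (tmp d) (tmp d) (tmp (d + 1))])
  | get A i, d => i.code d ++ (addrCode A d ++ [.load (tmp d) (tmp d)])
  -- The factor `1 - (i + 1 - base)` is `1` inside the matrix and `0` beyond it. Applied to the
  -- address and to the loaded value, it makes a read beyond the matrix return `0` instead of the
  -- content of an array cell.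
  | inp i, d => i.code d ++
      [.const (tmp (d + 1)) 1, .add (tmp (d + 1)) (tmp d) (tmp (d + 1)),
        .sub (tmp (d + 1)) (tmp (d + 1)) baseReg, .const (tmp (d + 2)) 1,
        .sub (tmp (d + 1)) (tmp (d + 2)) (tmp (d + 1)), .mul (tmp d) (tmp d) (tmp (d + 1)),
        .load (tmp d) (tmp d), .mul (tmp d) (tmp d) (tmp (d + 1))]

theorem Expr.code_length (e : Expr) (d : ℕ) : (e.code d).length = e.len := by
  induction e generalizing d with
  | var | lit => rfl
  | add a b iha ihb | sub a b iha ihb | mul a b iha ihb | div a b iha ihb =>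
    simp [code, len, iha, ihb, add_assoc]
  | get A i ih => simp [code, len, ih, addrCode]
  | inp i ih => simp [code, len, ih]

/-- The machine configuration `c` represents the state `σ`. -/
structure Rel (base : ℕ) (σ : Store) (c : Config) : Prop where
  var : ∀ x : Var, c.reg x.code = σ.v x
  zero : c.reg zeroReg = 0
  baseEq : c.reg baseReg = base
  inp : ∀ i < base, c.mem i = σ.inp i
  inp_zero : ∀ i, base ≤ i → σ.inp i = 0
  arr : ∀ A i, c.mem (base + (i * 9 + A.code)) = σ.a A i

/-- All numbers in the state are at most `N`. -/
structure Store.Bd (σ : Store) (N : ℕ) : Prop where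
  v : ∀ x, σ.v x ≤ N
  a : ∀ A i, σ.a A i ≤ N
  inp : ∀ i, σ.inp i ≤ N

/-! ### Size and correctness of compiled expressions -/

theorem Expr.deg_pos (e : Expr) : 1 ≤ e.deg := by
  induction e <;> simp only [deg] <;> omega

theorem Expr.val_le {σ : Store} {N : ℕ} (hN : 16 ≤ N) (hσ : σ.Bd N) (e : Expr) :
    e.val σ ≤ N ^ e.deg := by
  have mono : ∀ {i j : ℕ}, i ≤ j → N ^ i ≤ N ^ j := fun h => Nat.pow_le_pow_right (by omega) h
  induction e with
  | var x => simpa [val, deg] using hσ.v x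
  | lit m =>
    exact (Nat.lt_pow_self (by omega : 1 < N)).le.trans (mono (Nat.le_succ m))
  | add a b iha ihb =>
    have h1 := iha.trans (mono (le_max_left a.deg b.deg))
    have h2 := ihb.trans (mono (le_max_right a.deg b.deg))
    simp only [val, deg, pow_succ]
    nlinarith
  | sub a b iha ihb =>
    exact (Nat.sub_le _ _).trans (iha.trans (mono (le_max_left _ _)))
  | mul a b iha ihb =>
    simp only [val, deg, pow_add]
    exact Nat.mul_le_mul iha ihb
  | div a b iha ihb =>
    exact (Nat.div_le_self _ _).trans (iha.trans (mono (le_max_left _ _)))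
  | get A i ih => exact (hσ.a A _).trans (by simpa [deg] using mono (show 1 ≤ i.deg + 3 by omega))
  | inp i ih => exact (hσ.inp _).trans (by simpa [deg] using mono (show 1 ≤ i.deg + 1 by omega))

theorem tmp_inj {d e : ℕ} : tmp d = tmp e ↔ d = e := by unfold tmp; omega

theorem Var.code_ne_tmp (x : Var) (d : ℕ) : x.code ≠ tmp d := by
  have := x.code_lt; unfold tmp; omega

/-- Changing temporary registers keeps the representation. -/
theorem Rel.of_tmp {base : ℕ} {σ : Store} {c c' : Config} (h : Rel base σ c)
    (hr : ∀ r, (∀ d, r ≠ tmp d) → c'.reg r = c.reg r) (hm : c'.mem = c.mem) : Rel base σ c' where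
  var x := by rw [hr _ (fun d => x.code_ne_tmp d), h.var]
  zero := by rw [hr _ (fun d => by unfold zeroReg tmp; omega), h.zero]
  baseEq := by rw [hr _ (fun d => by unfold baseReg tmp; omega), h.baseEq]
  inp := by rw [hm]; exact h.inp
  inp_zero := h.inp_zero
  arr := by rw [hm]; exact h.arr

/-- The code of an address computation is correct. -/
theorem addrCode_reach {P : Program} {B N base : ℕ} {σ : Store} {c : Config} (A : Arr) {d D w : ℕ}
    (hcode : CodeAt P c.pc (addrCode A d)) (hrel : Rel base σ c) (hc : c.BoundedBy B)
    (hN : 16 ≤ N) (hbase : base ≤ N) (hw : c.reg (tmp d) = w) (hwD : w ≤ N ^ D)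
    (hB : N ^ (D + 3) ≤ B) :
    ∃ c', Reach P B c 5 c' ∧ c'.pc = c.pc + 5 ∧ c'.reg (tmp d) = base + (w * 9 + A.code) ∧
      (∀ r, (∀ d', d ≤ d' → r ≠ tmp d') → c'.reg r = c.reg r) ∧ c'.mem = c.mem := by
  simp only [addrCode, codeAt_cons] at hcode
  obtain ⟨h1, h2, h3, h4, h5, -⟩ := hcode
  have hA := A.code_lt
  have hNp : 1 ≤ N ^ D := Nat.one_le_pow _ _ (by omega)
  -- With `16 ≤ N`, the factor `9`, the array code and `base ≤ N` are all absorbed by three further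
  -- powers of `N`.
  have hp : N ^ (D + 3) = N ^ D * N * N * N := by ring
  have b1 : N ≤ N ^ D * N := Nat.le_mul_of_pos_left _ hNp
  have b2 : 16 * (N ^ D * N) ≤ N ^ D * N * N := by
    rw [mul_comm 16]; exact Nat.mul_le_mul_left _ hN
  have b3 : 16 * (N ^ D * N * N) ≤ N ^ D * N * N * N := by
    rw [mul_comm 16]; exact Nat.mul_le_mul_left _ hN
  have b4 : 16 * N ^ D ≤ N ^ D * N := by
    rw [mul_comm 16]; exact Nat.mul_le_mul_left _ hN
  have ne1 : tmp d ≠ tmp (d + 1) := by simp [tmp_inj]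
  have ne1' : tmp (d + 1) ≠ tmp d := by simp [tmp_inj]
  have neb : baseReg ≠ tmp d := by unfold baseReg tmp; omega
  have neb' : baseReg ≠ tmp (d + 1) := by unfold baseReg tmp; omega
  have r1 := Reach.regOp (d := tmp (d + 1)) (w := 9) h1 rfl hc (by omega)
  have r2 := Reach.regOp (d := tmp d) (w := w * 9) h2
    (by simp [Instr.exec, ne1, hw]) r1.bounded (by omega)
  have r3 := Reach.regOp (d := tmp (d + 1)) (w := A.code) h3 rfl r2.bounded (by omega)
  have r4 := Reach.regOp (d := tmp d) (w := w * 9 + A.code) h4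
    (by simp [Instr.exec, ne1]) r3.bounded (by omega)
  have r5 := Reach.regOp (d := tmp d) (w := base + (w * 9 + A.code)) h5
    (by simp [Instr.exec, neb, neb', hrel.baseEq]) r4.bounded (by omega)
  refine ⟨_, (((r1.trans r2).trans r3).trans r4).trans r5, rfl, by simp, fun r hr => ?_, rfl⟩
  have q1 := hr d le_rfl
  have q2 := hr (d + 1) (by omega)
  simp [q1, q2]

/-- The common part of the four arithmetic operations: the second operand only uses temporaries from
`d + 1` on, so the first result survives in `tmp d`. -/
theorem Expr.code_reach_binop {P : Program} {B : ℕ} {c : Config}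
    {d w w' z len₁ len₂ : ℕ} {i : Instr} {c₁ c₂ : Config}
    (r₁ : Reach P B c len₁ c₁) (p₁ : c₁.pc = c.pc + len₁) (v₁ : c₁.reg (tmp d) = w)
    (f₁ : ∀ r, (∀ d', d ≤ d' → r ≠ tmp d') → c₁.reg r = c.reg r) (m₁ : c₁.mem = c.mem)
    (r₂ : Reach P B c₁ len₂ c₂) (p₂ : c₂.pc = c₁.pc + len₂) (v₂ : c₂.reg (tmp (d + 1)) = w')
    (f₂ : ∀ r, (∀ d', d + 1 ≤ d' → r ≠ tmp d') → c₂.reg r = c₁.reg r) (m₂ : c₂.mem = c₁.mem)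
    (hi : P[c.pc + len₁ + len₂]? = some i)
    (he : c₂.reg (tmp d) = w → c₂.reg (tmp (d + 1)) = w' →
      i.exec c₂ = ⟨c₂.pc + 1, Function.update c₂.reg (tmp d) z, c₂.mem⟩) (hz : z ≤ B) :
    ∃ c', Reach P B c (len₁ + len₂ + 1) c' ∧ c'.pc = c.pc + (len₁ + len₂ + 1) ∧
      c'.reg (tmp d) = z ∧ (∀ r, (∀ d', d ≤ d' → r ≠ tmp d') → c'.reg r = c.reg r) ∧
      c'.mem = c.mem := by
  have hv : c₂.reg (tmp d) = w := by
    rw [f₂ _ (fun d' hd' => by rw [Ne, tmp_inj]; omega), v₁]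
  have r₃ := Reach.regOp (d := tmp d) (w := z) (by rw [p₂, p₁]; exact hi) (he hv v₂) r₂.bounded hz
  refine ⟨_, (r₁.trans r₂).trans r₃, by simp [p₂, p₁]; omega, by simp, fun r hr => ?_, ?_⟩
  · have := hr d le_rfl
    simp only [Function.update_apply, this, if_false]
    rw [f₂ r (fun d' hd' => hr d' (by omega)), f₁ r hr]
  · exact m₂.trans m₁

/-- The code of an expression computes its value. -/
theorem Expr.code_reach {P : Program} {B N base : ℕ} {σ : Store} (hN : 16 ≤ N) (hbase : base ≤ N)
    (hσ : σ.Bd N) (e : Expr) {c : Config} {d : ℕ} (hcode : CodeAt P c.pc (e.code d))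
    (hrel : Rel base σ c) (hc : c.BoundedBy B) (hB : N ^ e.deg ≤ B) :
    ∃ c', Reach P B c e.len c' ∧ c'.pc = c.pc + e.len ∧ c'.reg (tmp d) = e.val σ ∧
      (∀ r, (∀ d', d ≤ d' → r ≠ tmp d') → c'.reg r = c.reg r) ∧ c'.mem = c.mem := by
  have mono : ∀ {i j : ℕ}, i ≤ j → N ^ i ≤ N ^ j := fun h => Nat.pow_le_pow_right (by omega) h
  have hval := (e.val_le hN hσ).trans hB
  induction e generalizing c d with
  | var x =>
    simp only [code, codeAt_cons] at hcode
    have r := Reach.regOp (d := tmp d) (w := σ.v x) hcode.1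
      (by simp [Instr.exec, hrel.zero, hrel.var]) hc hval
    refine ⟨_, r, rfl, by simp [val], fun r hr => ?_, rfl⟩
    simp [hr d le_rfl]
  | lit m =>
    simp only [code, codeAt_cons] at hcode
    have r := Reach.regOp (d := tmp d) (w := m) hcode.1 rfl hc hval
    refine ⟨_, r, rfl, by simp [val], fun r hr => ?_, rfl⟩
    simp [hr d le_rfl]
  | add a b iha ihb | sub a b iha ihb | mul a b iha ihb | div a b iha ihb =>
    simp only [code, codeAt_append, codeAt_cons, code_length] at hcode
    obtain ⟨ha, hb, hi, -⟩ := hcode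
    simp only [deg] at hB
    have ha' : N ^ a.deg ≤ B := (mono (by have := b.deg_pos; omega)).trans hB
    have hb' : N ^ b.deg ≤ B := (mono (by have := a.deg_pos; omega)).trans hB
    obtain ⟨c₁, r₁, p₁, v₁, f₁, m₁⟩ := iha ha hrel hc ha' ((a.val_le hN hσ).trans ha')
    have hrel₁ := hrel.of_tmp (fun r hr => f₁ r (fun d' _ => hr d')) m₁
    rw [← p₁] at hb
    obtain ⟨c₂, r₂, p₂, v₂, f₂, m₂⟩ := ihb hb hrel₁ r₁.bounded hb' ((b.val_le hN hσ).trans hb')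
    exact code_reach_binop r₁ p₁ v₁ f₁ m₁ r₂ p₂ v₂ f₂ m₂ hi
      (fun h₁ h₂ => by simp [Instr.exec, h₁, h₂, val]) hval
  | get A i ih =>
    simp only [code, codeAt_append, codeAt_cons, code_length] at hcode
    obtain ⟨ha, hb, hi, -⟩ := hcode
    simp only [deg] at hB
    have ha' : N ^ i.deg ≤ B := (mono (by omega)).trans hB
    obtain ⟨c₁, r₁, p₁, v₁, f₁, m₁⟩ := ih ha hrel hc ha' ((i.val_le hN hσ).trans ha')
    have hrel₁ := hrel.of_tmp (fun r hr => f₁ r (fun d' _ => hr d')) m₁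
    rw [← p₁] at hb
    obtain ⟨c₂, r₂, p₂, v₂, f₂, m₂⟩ := addrCode_reach A hb hrel₁ r₁.bounded hN hbase v₁
      (i.val_le hN hσ) hB
    have r₃ := Reach.regOp (i := .load (tmp d) (tmp d)) (d := tmp d) (w := σ.a A (i.val σ))
      (by rw [p₂, p₁]; exact hi)
      (by simp only [Instr.exec, v₂]; rw [m₂, hrel₁.arr]) r₂.bounded hval
    refine ⟨_, (r₁.trans r₂).trans r₃, by simp [p₂, p₁, len]; omega, by simp [val],
      fun r hr => ?_, m₂.trans m₁⟩
    have := hr d le_rfl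
    simp only [Function.update_apply, this, if_false]
    rw [f₂ r hr, f₁ r hr]
  | inp i ih =>
    simp only [code, codeAt_append, codeAt_cons, code_length] at hcode
    obtain ⟨ha, h1, h2, h3, h4, h5, h6, h7, h8, -⟩ := hcode
    simp only [deg] at hB
    have ha' : N ^ i.deg ≤ B := (mono (by omega)).trans hB
    obtain ⟨c₁, r₁, p₁, v₁, f₁, m₁⟩ := ih ha hrel hc ha' ((i.val_le hN hσ).trans ha')
    have hrel₁ := hrel.of_tmp (fun r hr => f₁ r (fun d' _ => hr d')) m₁
    have hNp : 1 ≤ N ^ i.deg := Nat.one_le_pow _ _ (by omega)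
    have hle := i.val_le hN hσ
    have hB2 : 2 * N ^ i.deg ≤ B := by
      refine le_trans ?_ hB
      rw [pow_succ, mul_comm 2]
      exact Nat.mul_le_mul_left _ (by omega)
    set w := i.val σ with hw
    rw [← p₁] at h1 h2 h3 h4 h5 h6 h7 h8
    have n01 : tmp d ≠ tmp (d + 1) := by simp [tmp_inj]
    have n12 : tmp (d + 1) ≠ tmp (d + 2) := by simp [tmp_inj]
    have n02 : tmp d ≠ tmp (d + 2) := by simp [tmp_inj]
    have nb0 : baseReg ≠ tmp d := by unfold baseReg tmp; omega
    have nb1 : baseReg ≠ tmp (d + 1) := by unfold baseReg tmp; omega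
    have nb2 : baseReg ≠ tmp (d + 2) := by unfold baseReg tmp; omega
    have s1 := Reach.regOp (d := tmp (d + 1)) (w := 1) h1 rfl r₁.bounded (by omega)
    have s2 := Reach.regOp (d := tmp (d + 1)) (w := w + 1) h2
      (by simp [Instr.exec, n01, v₁]) s1.bounded (by omega)
    have s3 := Reach.regOp (d := tmp (d + 1)) (w := w + 1 - base) h3
      (by simp [Instr.exec, nb1, hrel₁.baseEq]) s2.bounded (by omega)
    have s4 := Reach.regOp (d := tmp (d + 2)) (w := 1) h4 rfl s3.bounded (by omega)
    have s5 := Reach.regOp (d := tmp (d + 1)) (w := 1 - (w + 1 - base)) h5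
      (by simp [Instr.exec, n12]) s4.bounded (by omega)
    have hmul : w * (1 - (w + 1 - base)) ≤ w :=
      (Nat.mul_le_mul_left w (Nat.sub_le _ _)).trans (by simp)
    have s6 := Reach.regOp (d := tmp d) (w := w * (1 - (w + 1 - base))) h6
      (by simp [Instr.exec, n01, n02, v₁]) s5.bounded (by omega)
    have s7 := Reach.regOp (d := tmp d) (w := c₁.mem (w * (1 - (w + 1 - base)))) h7
      (by simp [Instr.exec]) s6.bounded (r₁.bounded.2 _)
    have hres : c₁.mem (w * (1 - (w + 1 - base))) * (1 - (w + 1 - base)) = σ.inp w := by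
      by_cases hwb : w < base
      · rw [show w + 1 - base = 0 by omega]
        simpa using hrel₁.inp w hwb
      · rw [show 1 - (w + 1 - base) = 0 by omega, hrel.inp_zero w (by omega)]
        simp
    have s8 := Reach.regOp (d := tmp d) (w := σ.inp w) h8
      (by simp [Instr.exec, n01.symm, hres]) s7.bounded hval
    refine ⟨_, r₁.trans (((((((s1.trans s2).trans s3).trans s4).trans s5).trans s6).trans s7).trans
      s8), by simp [p₁, len]; omega, by simp [val, hw], fun r hr => ?_, m₁⟩
    have q0 := hr d le_rfl
    have q1 := hr (d + 1) (by omega)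
    have q2 := hr (d + 2) (by omega)
    simp only [Function.update_apply, q0, q1, q2, if_false]
    exact f₁ r hr

/-- Commands. The loop `loop x b c` runs `c` with `x = 0, …, b - 1`. -/
inductive Cmd where
  | skip
  | set (x : Var) (e : Expr)
  | put (A : Arr) (i e : Expr)
  | seq (c₁ c₂ : Cmd)
  /-- if `a ≤ b` then `c₁` else `c₂` -/
  | branch (a b : Expr) (c₁ c₂ : Cmd)
  | loop (x b : Var) (c : Cmd)

infixr:60 " ;; " => Cmd.seq

/-- Iteration with a counter. -/
def iter (f : ℕ → Store → Store) : ℕ → Store → Store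
  | 0, σ => σ
  | m + 1, σ => f m (iter f m σ)

/-- The effect of a command. -/
def Cmd.ev : Cmd → Store → Store
  | skip, σ => σ
  | set x e, σ => σ.setV x (e.val σ)
  | put A i e, σ => σ.setA A (i.val σ) (e.val σ)
  | seq c₁ c₂, σ => c₂.ev (c₁.ev σ)
  | branch a b c₁ c₂, σ => if a.val σ ≤ b.val σ then c₁.ev σ else c₂.ev σ
  | loop x b c, σ => iter (fun j τ => c.ev (τ.setV x j)) (σ.v b) σ

/-- The running time of the code of a command. -/
def Cmd.cost : Cmd → Store → ℕ
  | skip, _ => 0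
  | set _ e, _ => e.len + 1
  | put _ i e, _ => i.len + 5 + e.len + 1
  | seq c₁ c₂, σ => c₁.cost σ + c₂.cost (c₁.ev σ)
  | branch a b c₁ c₂, σ =>
      a.len + b.len + 1 + if a.val σ ≤ b.val σ then c₁.cost σ else c₂.cost σ + 1
  | loop x b c, σ => 3 + ∑ j ∈ Finset.range (σ.v b),
      (5 + c.cost ((iter (fun j τ => c.ev (τ.setV x j)) j σ).setV x j))

/-- The length of the code of a command. -/
def Cmd.len : Cmd → ℕ
  | skip => 0
  | set _ e => e.len + 1
  | put _ i e => i.len + 5 + e.len + 1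
  | seq c₁ c₂ => c₁.len + c₂.len
  | branch a b c₁ c₂ => a.len + b.len + 1 + c₂.len + 1 + c₁.len
  | loop _ _ c => 4 + c.len + 3

/-- From register `100` on, the residue modulo `3` separates loop counters, loop bounds and
temporaries, so loops and expressions of any depth do not collide. -/
def cntReg (d : ℕ) : ℕ := 100 + 3 * d

def bndReg (d : ℕ) : ℕ := 101 + 3 * d

/-- The code of a command that starts at position `pos`, inside of `d` loops. -/
def Cmd.code : Cmd → ℕ → ℕ → List Instr
  | skip, _, _ => []
  | set x e, _, _ => e.code 0 ++ [.add x.code (tmp 0) zeroReg]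
  | put A i e, _, _ => i.code 0 ++ (addrCode A 0 ++ (e.code 1 ++ [.store (tmp 0) (tmp 1)]))
  | seq c₁ c₂, pos, d => c₁.code pos d ++ c₂.code (pos + c₁.len) d
  | branch a b c₁ c₂, pos, d =>
      let p₂ := pos + a.len + b.len + 1
      let p₁ := p₂ + c₂.len + 1
      a.code 0 ++ (b.code 1 ++ (.jle (tmp 0) (tmp 1) p₁ ::
        (c₂.code p₂ d ++ (.jle zeroReg zeroReg (p₁ + c₁.len) :: c₁.code p₁ d))))
  | loop x b c, pos, d =>
      .add (bndReg d) b.code zeroReg :: .const (cntReg d) 0 ::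
        .jle (bndReg d) (cntReg d) (pos + 4 + c.len + 3) :: .add x.code (cntReg d) zeroReg ::
        (c.code (pos + 4) (d + 1) ++
          [.const (tmp 0) 1, .add (cntReg d) (cntReg d) (tmp 0), .jle zeroReg zeroReg (pos + 2)])

theorem Cmd.code_length (c : Cmd) (pos d : ℕ) : (c.code pos d).length = c.len := by
  induction c generalizing pos d with
  | skip => rfl
  | set x e => simp [code, len, Expr.code_length]
  | put A i e => simp [code, len, Expr.code_length, addrCode]; omega
  | seq c₁ c₂ ih₁ ih₂ => simp [code, len, ih₁, ih₂]
  | branch a b c₁ c₂ ih₁ ih₂ => simp [code, len, ih₁, ih₂, Expr.code_length]; omega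
  | loop x b c ih => simp [code, len, ih]; omega

/-- Expressions whose value is at most the largest number in the state (or `2`). -/
def Expr.flat : Expr → Bool
  | var _ => true
  | lit m => m ≤ 2
  | add _ _ => false
  | sub a _ => a.flat
  | mul _ _ => false
  | div a _ => a.flat
  | get _ _ => true
  | inp _ => true

/-- Expressions whose value exceeds the largest number in the state by at most one. -/
def Expr.tame : Expr → Bool
  | add a (lit 1) => a.flat
  | e => e.flat

theorem Expr.val_le_of_flat {σ : Store} {N : ℕ} (hN : 2 ≤ N) (hσ : σ.Bd N) {e : Expr}
    (he : e.flat) : e.val σ ≤ N := by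
  induction e with
  | var x => exact hσ.v x
  | lit m => exact (of_decide_eq_true he).trans hN
  | add => simp [flat] at he
  | mul => simp [flat] at he
  | sub a b ih => exact (Nat.sub_le _ _).trans (ih he)
  | div a b ih => exact (Nat.div_le_self _ _).trans (ih he)
  | get A i => exact hσ.a A _
  | inp i => exact hσ.inp _

theorem Expr.val_le_of_tame {σ : Store} {N : ℕ} (hN : 2 ≤ N) (hσ : σ.Bd N) {e : Expr}
    (he : e.tame) : e.val σ ≤ N + 1 := by
  unfold tame at he
  split at he
  · exact Nat.succ_le_succ (val_le_of_flat hN hσ he)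
  · exact (val_le_of_flat hN hσ he).trans (Nat.le_succ _)

/-- All assigned expressions are tame. -/
def Cmd.tame : Cmd → Bool
  | skip => true
  | set _ e => e.tame
  | put _ _ e => e.tame
  | seq c₁ c₂ => c₁.tame && c₂.tame
  | branch _ _ c₁ c₂ => c₁.tame && c₂.tame
  | loop _ _ c => c.tame

/-- If the states stay below `N`, then this power of `N` bounds the temporaries; the summand `3`
pays for an address. -/
def Cmd.deg : Cmd → ℕ
  | skip => 0
  | set _ e => e.deg
  | put _ i e => max (i.deg + 3) e.deg
  | seq c₁ c₂ => max c₁.deg c₂.deg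
  | branch a b c₁ c₂ => max (max a.deg b.deg) (max c₁.deg c₂.deg)
  | loop _ _ c => c.deg

theorem Store.Bd.mono {σ : Store} {M N : ℕ} (h : σ.Bd M) (hMN : M ≤ N) : σ.Bd N :=
  ⟨fun x => (h.v x).trans hMN, fun A i => (h.a A i).trans hMN, fun i => (h.inp i).trans hMN⟩

theorem Store.Bd.setV {σ : Store} {N w : ℕ} (h : σ.Bd N) (hw : w ≤ N) (x : Var) :
    (σ.setV x w).Bd N := by
  refine ⟨fun y => ?_, h.a, h.inp⟩
  simp only [Store.setV, Function.update_apply]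
  split_ifs
  exacts [hw, h.v y]

theorem Store.Bd.setA {σ : Store} {N w : ℕ} (h : σ.Bd N) (hw : w ≤ N) (A : Arr) (i : ℕ) :
    (σ.setA A i w).Bd N := by
  refine ⟨h.v, fun A' i' => ?_, h.inp⟩
  simp only [Store.setA, Function.update_apply]
  split_ifs
  · simp only [Function.update_apply]
    split_ifs
    exacts [hw, h.a _ _]
  · exact h.a _ _

/-- The numbers in the state grow by at most one in every step. -/
theorem Cmd.ev_bd (c : Cmd) (hc : c.tame) {σ : Store} {M : ℕ} (hM : 2 ≤ M) (hσ : σ.Bd M) :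
    (c.ev σ).Bd (M + c.cost σ) := by
  induction c generalizing σ M with
  | skip => exact hσ
  | set x e =>
    exact (hσ.mono (by simp [cost])).setV ((Expr.val_le_of_tame hM hσ hc).trans
      (by simp only [cost]; omega)) x
  | put A i e =>
    exact (hσ.mono (by simp [cost])).setA ((Expr.val_le_of_tame hM hσ hc).trans
      (by simp only [cost]; omega)) A _
  | seq c₁ c₂ ih₁ ih₂ =>
    simp only [tame, Bool.and_eq_true] at hc
    have := ih₂ hc.2 (by omega) (ih₁ hc.1 hM hσ)
    simpa only [ev, cost, add_assoc] using this
  | branch a b c₁ c₂ ih₁ ih₂ =>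
    simp only [tame, Bool.and_eq_true] at hc
    simp only [ev, cost]
    split_ifs
    · exact (ih₁ hc.1 hM hσ).mono (by omega)
    · exact (ih₂ hc.2 hM hσ).mono (by omega)
  | loop x b c ih =>
    simp only [ev, cost]
    generalize σ.v b = m
    induction m with
    | zero => exact hσ.mono (by omega)
    | succ m ihm =>
      rw [Finset.sum_range_succ]
      set τ := iter (fun j τ => c.ev (τ.setV x j)) m σ
      set S := ∑ j ∈ Finset.range m, (5 + c.cost ((iter (fun j τ => c.ev (τ.setV x j)) j σ).setV x j))
        with hS
      -- The loop variable receives `m`, which need not be bounded by the state at that moment, but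
      -- each of the `m` earlier rounds has cost at least `5`.
      have hm : 5 * m ≤ S := by
        rw [hS]
        calc 5 * m = ∑ j ∈ Finset.range m, 5 := by simp [mul_comm]
          _ ≤ _ := Finset.sum_le_sum (fun j _ => by omega)
      have := ih hc (M := M + (3 + S)) (by omega) (ihm.setV (w := m) (by omega) x)
      exact this.mono (by omega)

/-! ### Correctness of compiled commands -/

theorem Rel.of_lt {base : ℕ} {σ : Store} {c c' : Config} (h : Rel base σ c)
    (hr : ∀ r < 100, c'.reg r = c.reg r) (hm : c'.mem = c.mem) : Rel base σ c' where
  var x := by rw [hr _ (by have := x.code_lt; omega), h.var]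
  zero := by rw [hr _ (by decide), h.zero]
  baseEq := by rw [hr _ (by decide), h.baseEq]
  inp := by rw [hm]; exact h.inp
  inp_zero := h.inp_zero
  arr := by rw [hm]; exact h.arr

theorem Rel.setV {base : ℕ} {σ : Store} {c : Config} (h : Rel base σ c) (p w : ℕ) (x : Var) :
    Rel base (σ.setV x w) ⟨p, Function.update c.reg x.code w, c.mem⟩ where
  var y := by
    simp only [Store.setV, Function.update_apply, Var.code_injective.eq_iff, h.var]
  zero := by
    have := x.code_lt
    simpa [Function.update_apply, show zeroReg ≠ x.code by unfold zeroReg; omega] using h.zero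
  baseEq := by
    have := x.code_lt
    simpa [Function.update_apply, show baseReg ≠ x.code by unfold baseReg; omega] using h.baseEq
  inp := h.inp
  inp_zero := h.inp_zero
  arr := h.arr

theorem Rel.setA {base : ℕ} {σ : Store} {c : Config} (h : Rel base σ c) (p w : ℕ) (A : Arr)
    (i : ℕ) :
    Rel base (σ.setA A i w) ⟨p, c.reg, Function.update c.mem (base + (i * 9 + A.code)) w⟩ where
  var := h.var
  zero := h.zero
  baseEq := h.baseEq
  inp j hj := by
    exact (Function.update_of_ne (by omega) _ _).trans (h.inp j hj)
  inp_zero := h.inp_zero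
  arr A' i' := by
    have hA := A.code_lt
    have hA' := A'.code_lt
    simp only [Store.setA]
    by_cases hAA : A' = A
    · subst hAA
      by_cases hii : i' = i
      · subst hii; simp
      · simp only [Function.update_apply, hii, if_true, if_false]
        rw [if_neg (by omega), h.arr]
    · have : A'.code ≠ A.code := fun h => hAA (Arr.code_injective h)
      simp only [Function.update_apply, hAA, if_false]
      rw [if_neg (by omega), h.arr]

/-- The registers of the first `d` nested loops agree. -/
def SameLoops (d : ℕ) (c c' : Config) : Prop :=
  ∀ h < d, c'.reg (cntReg h) = c.reg (cntReg h) ∧ c'.reg (bndReg h) = c.reg (bndReg h)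

theorem SameLoops.trans {d : ℕ} {c c' c'' : Config} (h : SameLoops d c c')
    (h' : SameLoops d c' c'') : SameLoops d c c'' := fun i hi =>
  ⟨(h' i hi).1.trans (h i hi).1, (h' i hi).2.trans (h i hi).2⟩

theorem SameLoops.of_tmp {d : ℕ} {c c' : Config}
    (hr : ∀ r, (∀ e, r ≠ tmp e) → c'.reg r = c.reg r) : SameLoops d c c' := fun i _ =>
  ⟨hr _ (fun e => by unfold cntReg tmp; omega), hr _ (fun e => by unfold bndReg tmp; omega)⟩

theorem SameLoops.update {d : ℕ} {c : Config} {p r w : ℕ} {m : ℕ → ℕ}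
    (hr : r < 100 ∨ 100 + 3 * d ≤ r) : SameLoops d c ⟨p, Function.update c.reg r w, m⟩ :=
  fun i hi => ⟨by simp only [Function.update_apply]; rw [if_neg (by unfold cntReg; omega)],
    by simp only [Function.update_apply]; rw [if_neg (by unfold bndReg; omega)]⟩

theorem Reach.jump {P : Program} {B : ℕ} {c : Config} {a b l : ℕ}
    (hi : P[c.pc]? = some (.jle a b l)) (hc : c.BoundedBy B) :
    Reach P B c 1 ⟨if c.reg a ≤ c.reg b then l else c.pc + 1, c.reg, c.mem⟩ :=
  Reach.one hi hc hc

/-- The code of a command is correct. -/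
theorem Cmd.code_reach {P : Program} {B N base : ℕ} (hN : 16 ≤ N) (hbase : base ≤ N)
    (c : Cmd) (htame : c.tame) (hdeg : N ^ c.deg ≤ B) (hNB : N ≤ B) {σ : Store} {γ : Config}
    {M d : ℕ} (hM : 2 ≤ M) (hσ : σ.Bd M) (hMN : M + c.cost σ ≤ N)
    (hcode : CodeAt P γ.pc (c.code γ.pc d)) (hrel : Rel base σ γ) (hγ : γ.BoundedBy B) :
    ∃ γ', Reach P B γ (c.cost σ) γ' ∧ γ'.pc = γ.pc + c.len ∧ Rel base (c.ev σ) γ' ∧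
      SameLoops d γ γ' := by
  have mono : ∀ {i j : ℕ}, i ≤ j → N ^ i ≤ N ^ j := fun h => Nat.pow_le_pow_right (by omega) h
  induction c generalizing σ γ M d with
  | skip => exact ⟨γ, Reach.refl hγ, rfl, hrel, fun _ _ => ⟨rfl, rfl⟩⟩
  | set x e =>
    simp only [code, codeAt_append, codeAt_cons, Expr.code_length] at hcode
    have hσN : σ.Bd N := hσ.mono (by omega)
    obtain ⟨γ₁, r₁, p₁, v₁, f₁, m₁⟩ := e.code_reach hN hbase hσN hcode.1 hrel hγ hdeg
    have hrel₁ := hrel.of_tmp (fun r hr => f₁ r (fun d' _ => hr d')) m₁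
    have r₂ := Reach.regOp (d := x.code) (w := e.val σ) (by rw [p₁]; exact hcode.2.1)
      (by simp [Instr.exec, v₁, hrel₁.zero]) r₁.bounded ((e.val_le hN hσN).trans hdeg)
    refine ⟨_, r₁.trans r₂, by simp [p₁, len]; omega, hrel₁.setV _ _ x, ?_⟩
    exact (SameLoops.of_tmp (fun r hr => f₁ r (fun d' _ => hr d'))).trans
      (.update (Or.inl (by have := x.code_lt; omega)))
  | put A i e =>
    simp only [code, codeAt_append, codeAt_cons, Expr.code_length] at hcode
    obtain ⟨hi, ha, he, hs, -⟩ := hcode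
    have hσN : σ.Bd N := hσ.mono (by omega)
    simp only [deg] at hdeg
    have hd1 : N ^ (i.deg + 3) ≤ B := (mono (by omega)).trans hdeg
    have hd2 : N ^ i.deg ≤ B := (mono (by omega)).trans hdeg
    have hd3 : N ^ e.deg ≤ B := (mono (by omega)).trans hdeg
    obtain ⟨γ₁, r₁, p₁, v₁, f₁, m₁⟩ := i.code_reach hN hbase hσN hi hrel hγ hd2
    have hrel₁ := hrel.of_tmp (fun r hr => f₁ r (fun d' _ => hr d')) m₁
    rw [← p₁] at ha he hs
    obtain ⟨γ₂, r₂, p₂, v₂, f₂, m₂⟩ := addrCode_reach A ha hrel₁ r₁.bounded hN hbase v₁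
      (i.val_le hN hσN) hd1
    have hrel₂ := hrel₁.of_tmp (fun r hr => f₂ r (fun d' _ => hr d')) m₂
    have hal : (addrCode A 0).length = 5 := rfl
    rw [hal, ← p₂] at he hs
    obtain ⟨γ₃, r₃, p₃, v₃, f₃, m₃⟩ := e.code_reach hN hbase hσN he hrel₂ r₂.bounded hd3
    have hrel₃ := hrel₂.of_tmp (fun r hr => f₃ r (fun d' _ => hr d')) m₃
    rw [← p₃] at hs
    have v₃' : γ₃.reg (tmp 0) = base + (i.val σ * 9 + A.code) := by
      rw [f₃ _ (fun d' hd' => by rw [Ne, tmp_inj]; omega), v₂]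
    have hx : (Instr.store (tmp 0) (tmp 1)).exec γ₃ = ⟨γ₃.pc + 1, γ₃.reg,
        Function.update γ₃.mem (base + (i.val σ * 9 + A.code)) (e.val σ)⟩ := by
      simp [Instr.exec, v₃', v₃]
    have r₄ := Reach.one hs r₃.bounded
      (by rw [hx]; exact r₃.bounded.update_mem ((e.val_le hN hσN).trans hd3) _ _)
    rw [hx] at r₄
    refine ⟨_, ((r₁.trans r₂).trans r₃).trans r₄, by simp [p₃, p₂, p₁, len]; omega,
      hrel₃.setA _ _ A _, ?_⟩
    refine ((SameLoops.of_tmp (fun r hr => f₁ r (fun d' _ => hr d'))).trans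
      (SameLoops.of_tmp (fun r hr => f₂ r (fun d' _ => hr d')))).trans
      ((SameLoops.of_tmp (fun r hr => f₃ r (fun d' _ => hr d'))).trans ?_)
    exact fun _ _ => ⟨rfl, rfl⟩
  | seq c₁ c₂ ih₁ ih₂ =>
    simp only [code, codeAt_append, Cmd.code_length] at hcode
    simp only [tame, Bool.and_eq_true] at htame
    simp only [deg] at hdeg
    simp only [cost] at hMN
    obtain ⟨γ₁, r₁, p₁, h₁, s₁⟩ := ih₁ htame.1 ((mono (by omega)).trans hdeg) hM hσ (by omega)
      hcode.1 hrel hγ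
    rw [← p₁] at hcode
    obtain ⟨γ₂, r₂, p₂, h₂, s₂⟩ := ih₂ htame.2 ((mono (by omega)).trans hdeg)
      (M := M + c₁.cost σ) (by omega) (c₁.ev_bd htame.1 hM hσ) (by omega) hcode.2 h₁ r₁.bounded
    exact ⟨γ₂, r₁.trans r₂, by simp [p₂, p₁, len]; omega, h₂, s₁.trans s₂⟩
  | branch a b c₁ c₂ ih₁ ih₂ =>
    simp only [code, codeAt_append, codeAt_cons, Expr.code_length, Cmd.code_length] at hcode
    simp only [tame, Bool.and_eq_true] at htame
    simp only [deg] at hdeg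
    simp only [cost] at hMN
    obtain ⟨ha, hb, hj, hc₂, hj', hc₁⟩ := hcode
    have hσN : σ.Bd N := hσ.mono (by omega)
    obtain ⟨γ₁, r₁, p₁, v₁, f₁, m₁⟩ := a.code_reach hN hbase hσN ha hrel hγ
      ((mono (by omega)).trans hdeg)
    have hrel₁ := hrel.of_tmp (fun r hr => f₁ r (fun d' _ => hr d')) m₁
    rw [← p₁] at hb
    obtain ⟨γ₂, r₂, p₂, v₂, f₂, m₂⟩ := b.code_reach hN hbase hσN hb hrel₁ r₁.bounded
      ((mono (by omega)).trans hdeg)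
    have hrel₂ := hrel₁.of_tmp (fun r hr => f₂ r (fun d' _ => hr d')) m₂
    have v₁' : γ₂.reg (tmp 0) = a.val σ := by
      rw [f₂ _ (fun d' hd' => by rw [Ne, tmp_inj]; omega), v₁]
    have r₃ := Reach.jump (by rw [p₂, p₁]; exact hj) r₂.bounded
    rw [v₁', v₂] at r₃
    have hs : SameLoops d γ γ₂ := (SameLoops.of_tmp (fun r hr => f₁ r (fun d' _ => hr d'))).trans
      (SameLoops.of_tmp (fun r hr => f₂ r (fun d' _ => hr d')))
    simp only [ev, cost]
    by_cases hab : a.val σ ≤ b.val σ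
    · simp only [hab, if_true] at r₃ hMN ⊢
      have hc₁' : CodeAt P (γ.pc + a.len + b.len + 1 + c₂.len + 1)
        (c₁.code (γ.pc + a.len + b.len + 1 + c₂.len + 1) d) := hc₁
      obtain ⟨γ₄, r₄, p₄, h₄, s₄⟩ := ih₁ htame.1 ((mono (by omega)).trans hdeg) hM hσ (by omega)
        (γ := ⟨_, γ₂.reg, γ₂.mem⟩) hc₁' (hrel₂.of_tmp (fun _ _ => rfl) rfl) r₃.bounded
      exact ⟨γ₄, ((r₁.trans r₂).trans r₃).trans r₄, by rw [p₄]; simp only [len]; omega, h₄, hs.trans s₄⟩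
    · simp only [hab, if_false] at r₃ hMN ⊢
      have hpc : γ₂.pc + 1 = γ.pc + a.len + b.len + 1 := by omega
      rw [hpc] at r₃
      obtain ⟨γ₄, r₄, p₄, h₄, s₄⟩ := ih₂ htame.2 ((mono (by omega)).trans hdeg) hM hσ (by omega)
        (γ := ⟨_, γ₂.reg, γ₂.mem⟩) hc₂ (hrel₂.of_tmp (fun _ _ => rfl) rfl) r₃.bounded
      have r₅ := Reach.jump (by rw [p₄]; exact hj') r₄.bounded
      rw [if_pos le_rfl] at r₅
      exact ⟨_, (((r₁.trans r₂).trans r₃).trans (r₄.trans r₅)), by simp only [len]; omega,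
        h₄.of_tmp (fun _ _ => rfl) rfl, (hs.trans s₄).trans fun _ _ => ⟨rfl, rfl⟩⟩
  | loop x b c ih =>
    simp only [code, codeAt_append, codeAt_cons, Cmd.code_length] at hcode
    obtain ⟨h1, h2, h3, h4, h5, h6, h7, h8, -⟩ := hcode
    simp only [deg] at hdeg
    simp only [cost] at hMN
    simp only [ev, cost]
    set F : ℕ → Store → Store := fun j τ => c.ev (τ.setV x j)
    have hvb : σ.v b ≤ B := ((hσ.v b).trans (by omega)).trans hNB
    set m := σ.v b with hm
    have n1 : cntReg d ≠ bndReg d := by unfold cntReg bndReg; omega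
    have s1 := Reach.regOp (d := bndReg d) (w := m) h1
      (by simp [Instr.exec, hrel.zero, hrel.var, hm]) hγ hvb
    have s2 := Reach.regOp (d := cntReg d) (w := 0) h2 rfl s1.bounded (by omega)
    have hbd : ∀ i, (iter F i σ).Bd (M + (3 + ∑ j ∈ Finset.range i,
        (5 + c.cost ((iter F j σ).setV x j)))) ∧
        i ≤ M + (3 + ∑ j ∈ Finset.range i, (5 + c.cost ((iter F j σ).setV x j))) := by
      intro i
      induction i with
      | zero => exact ⟨hσ.mono (by omega), by omega⟩
      | succ i ihi =>
        rw [Finset.sum_range_succ]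
        exact ⟨(c.ev_bd htame (by omega) (ihi.1.setV ihi.2 x)).mono (by omega), by omega⟩
    -- The invariant is stated at the loop test, two instructions after the start; the final test is
    -- the third step of the overhead `3` in `Cmd.cost`.
    have key : ∀ i ≤ m, ∃ γ', Reach P B γ (2 + ∑ j ∈ Finset.range i,
        (5 + c.cost ((iter F j σ).setV x j))) γ' ∧ γ'.pc = γ.pc + 2 ∧ Rel base (iter F i σ) γ' ∧
        γ'.reg (cntReg d) = i ∧ γ'.reg (bndReg d) = m ∧ SameLoops d γ γ' := by
      intro i hi
      induction i with
      | zero =>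
        refine ⟨_, s1.trans s2, by simp, hrel.of_lt (fun r hr => ?_) rfl, by simp,
          by simp [n1.symm], ?_⟩
        · simp only [Function.update_apply]
          rw [if_neg (by unfold cntReg; omega), if_neg (by unfold bndReg; omega)]
        · refine SameLoops.trans (c' := ⟨γ.pc + 1, Function.update γ.reg (bndReg d) m, γ.mem⟩)
            (.update (Or.inr (by unfold bndReg; omega))) ?_
          exact SameLoops.update (Or.inr (by unfold cntReg; omega))
      | succ i ihi =>
        obtain ⟨γ', r, hp, hr, hcn, hbn, hsl⟩ := ihi (by omega)
        have htot : ∑ j ∈ Finset.range (i + 1), (5 + c.cost ((iter F j σ).setV x j)) ≤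
            ∑ j ∈ Finset.range m, (5 + c.cost ((iter F j σ).setV x j)) :=
          Finset.sum_le_sum_of_subset (Finset.range_mono (by omega))
        rw [Finset.sum_range_succ] at htot ⊢
        have hbi := hbd i
        set S := ∑ j ∈ Finset.range i, (5 + c.cost ((iter F j σ).setV x j))
        have t1 := Reach.jump (by rw [hp]; exact h3) r.bounded
        rw [hcn, hbn, if_neg (by omega)] at t1
        have t2 := Reach.regOp (d := x.code) (w := i) (by rw [hp]; exact h4)
          (by simp [Instr.exec, hcn, hr.zero]) t1.bounded (by omega)
        have hr2 := hr.setV (γ'.pc + 1 + 1) i x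
        have hpc : γ'.pc + 1 + 1 = γ.pc + 4 := by omega
        simp only [hpc] at t2 hr2
        obtain ⟨γ₃, t3, p3, hr3, s3⟩ := ih htame hdeg (M := M + (3 + S)) (d := d + 1) (by omega)
          (hbi.1.setV hbi.2 x) (by omega) (γ := ⟨γ.pc + 4, Function.update γ'.reg x.code i, γ'.mem⟩)
          h5 hr2 t2.bounded
        have hx := x.code_lt
        -- The body is compiled at depth `d + 1`, so it preserves the counter and the bound of this
        -- loop even if it assigns the loop variable.
        have c3 : γ₃.reg (cntReg d) = i := by
          rw [(s3 d (by omega)).1, ← hcn]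
          exact Function.update_of_ne (by unfold cntReg; omega) _ _
        have b3 : γ₃.reg (bndReg d) = m := by
          rw [(s3 d (by omega)).2, ← hbn]
          exact Function.update_of_ne (by unfold bndReg; omega) _ _
        have t4 := Reach.regOp (d := tmp 0) (w := 1) (by rw [p3]; exact h6) rfl t3.bounded
          (by omega)
        have n2 : cntReg d ≠ tmp 0 := by unfold cntReg tmp; omega
        have n3 : bndReg d ≠ tmp 0 := by unfold bndReg tmp; omega
        have t5 := Reach.regOp (d := cntReg d) (w := i + 1) (by simp only [p3]; exact h7)
          (by simp [Instr.exec, n2, c3]) t4.bounded (by omega)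
        have t6 := Reach.jump (by simp only [p3]; exact h8) t5.bounded
        rw [if_pos le_rfl] at t6
        refine ⟨_, (r.trans ((t1.trans t2).trans (t3.trans ((t4.trans t5).trans t6)))).cast_time ?_, rfl,
          hr3.of_lt (fun r hr => ?_) rfl, by simp, by simp [n1.symm, n3, b3], ?_⟩
        · omega
        · simp only [Function.update_apply]
          rw [if_neg (by unfold cntReg; omega), if_neg (by unfold tmp; omega)]
        · refine hsl.trans fun h hh => ?_
          have e1 := s3 h (by omega)
          simp only [Function.update_apply] at e1 ⊢
          rw [if_neg (by unfold cntReg; omega), if_neg (by unfold tmp cntReg; omega),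
            if_neg (by unfold bndReg cntReg; omega), if_neg (by unfold tmp bndReg; omega),
            e1.1, e1.2, if_neg (by unfold cntReg; omega), if_neg (by unfold bndReg; omega)]
          exact ⟨rfl, rfl⟩
    obtain ⟨γ', r, hp, hr, hcn, hbn, hsl⟩ := key m le_rfl
    have t1 := Reach.jump (by rw [hp]; exact h3) r.bounded
    rw [hcn, hbn, if_pos le_rfl] at t1
    exact ⟨_, (r.trans t1).cast_time (by omega), by simp only [len]; omega,
      hr.of_tmp (fun _ _ => rfl) rfl, hsl.trans fun _ _ => ⟨rfl, rfl⟩⟩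

/-! ## Bounding the running time -/

/-- A bound on the running time in terms of the parameters. -/
def Cmd.costB (p : Var → ℕ) : Cmd → ℕ
  | skip => 0
  | set _ e => e.len + 1
  | put _ i e => i.len + 5 + e.len + 1
  | seq c₁ c₂ => c₁.costB p + c₂.costB p
  | branch a b c₁ c₂ => a.len + b.len + 1 + (c₁.costB p + c₂.costB p + 1)
  | loop _ b c => 3 + p b * (5 + c.costB p)

/-- Parameters are not assigned, and bounds of loops are parameters. -/
def Cmd.wf : Cmd → Bool
  | skip => true
  | set x _ => !x.isParam
  | put _ _ _ => true
  | seq c₁ c₂ => c₁.wf && c₂.wf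
  | branch _ _ c₁ c₂ => c₁.wf && c₂.wf
  | loop x b c => !x.isParam && b.isParam && c.wf

theorem iter_induction (I : ℕ → Store → Prop) {f : ℕ → Store → Store} {m : ℕ} {σ : Store}
    (h0 : I 0 σ) (hs : ∀ j < m, ∀ τ, I j τ → I (j + 1) (f j τ)) : I m (iter f m σ) := by
  induction m with
  | zero => exact h0
  | succ m ih => exact hs m (by omega) _ (ih fun j hj => hs j (by omega))

theorem setV_param {σ : Store} {x y : Var} {w : ℕ} (hx : (!x.isParam) = true) (hy : y.isParam) :
    (σ.setV x w).v y = σ.v y :=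
  Function.update_of_ne (by rintro rfl; simp [hy] at hx) _ _

theorem Cmd.ev_param (c : Cmd) (hc : c.wf) (σ : Store) {y : Var} (hy : y.isParam) :
    (c.ev σ).v y = σ.v y := by
  induction c generalizing σ with
  | skip => rfl
  | set x e => exact setV_param hc hy
  | put A i e => rfl
  | seq c₁ c₂ ih₁ ih₂ =>
    simp only [wf, Bool.and_eq_true] at hc
    rw [ev, ih₂ hc.2, ih₁ hc.1]
  | branch a b c₁ c₂ ih₁ ih₂ =>
    simp only [wf, Bool.and_eq_true] at hc
    rw [ev]
    split_ifs
    exacts [ih₁ hc.1 σ, ih₂ hc.2 σ]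
  | loop x b c ih =>
    simp only [wf, Bool.and_eq_true] at hc
    refine iter_induction (fun _ τ => τ.v y = σ.v y) rfl fun j _ τ hτ => ?_
    rw [ih hc.2, setV_param hc.1.1 hy, hτ]

/-- Loop bounds are parameters, which keep their initial values during the whole run; a branch is
charged with both of its alternatives. -/
theorem Cmd.cost_le (c : Cmd) (hc : c.wf) (σ : Store) (p : Var → ℕ)
    (hp : ∀ y : Var, y.isParam → σ.v y = p y) : c.cost σ ≤ c.costB p := by
  induction c generalizing σ with
  | skip => exact le_rfl
  | set x e => exact le_rfl
  | put A i e => exact le_rfl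
  | seq c₁ c₂ ih₁ ih₂ =>
    simp only [wf, Bool.and_eq_true] at hc
    exact Nat.add_le_add (ih₁ hc.1 σ hp)
      (ih₂ hc.2 _ fun y hy => by rw [c₁.ev_param hc.1 σ hy, hp y hy])
  | branch a b c₁ c₂ ih₁ ih₂ =>
    simp only [wf, Bool.and_eq_true] at hc
    have h₁ := ih₁ hc.1 σ hp
    have h₂ := ih₂ hc.2 σ hp
    simp only [cost, costB]
    split_ifs <;> omega
  | loop x b c ih =>
    simp only [wf, Bool.and_eq_true] at hc
    simp only [cost, costB]
    refine Nat.add_le_add_left ?_ _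
    rw [hp b hc.1.2]
    refine (Finset.sum_le_card_nsmul _ _ (5 + c.costB p) fun j _ => ?_).trans (by simp)
    refine Nat.add_le_add_left (ih hc.2 _ fun y hy => ?_) _
    rw [setV_param hc.1.1 hy, ← hp y hy]
    refine iter_induction (fun _ τ => τ.v y = σ.v y) rfl fun i _ τ hτ => ?_
    rw [c.ev_param hc.2 _ hy, setV_param hc.1.1 hy, hτ]

end WordRAM

/-! ## Cotrees and insertion of a vertex -/

/-- Binary cotrees; `node true` is a join and `node false` is a disjoint union. -/
inductive Cotree (V : Type*) where
  | leaf (v : V)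
  | node (o : Bool) (a b : Cotree V)

/-- `G` restricted to a pair of distinct vertices is an edge if `o` and a non-edge otherwise. -/
def SimpleGraph.Pair {V : Type*} (G : SimpleGraph V) (o : Bool) (u v : V) : Prop :=
  u ≠ v ∧ (G.Adj u v ↔ o = true)

theorem SimpleGraph.Pair.symm {V : Type*} {G : SimpleGraph V} {o : Bool} {u v : V}
    (h : G.Pair o u v) : G.Pair o v u := ⟨h.1.symm, by rw [G.adj_comm]; exact h.2⟩

theorem IsCograph.not_path {V : Type*} {G : SimpleGraph V} (hG : IsCograph G) {a b c d : V}
    (hab : G.Pair true a b) (hbc : G.Pair true b c) (hcd : G.Pair true c d)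
    (hac : G.Pair false a c) (hbd : G.Pair false b d) (had : G.Pair false a d) : False := by
  refine hG ⟨⟨⟨![a, b, c, d], ?_⟩, ?_⟩⟩
  · have := hab.1; have := hbc.1; have := hcd.1; have := hac.1; have := hbd.1; have := had.1
    intro i j hij
    fin_cases i <;> fin_cases j <;> simp_all
  · have q1 := hab.2; have q2 := hbc.2; have q3 := hcd.2; have q4 := hac.2; have q5 := hbd.2
    have q6 := had.2
    have q1' := hab.symm.2; have q2' := hbc.symm.2; have q3' := hcd.symm.2
    have q4' := hac.symm.2; have q5' := hbd.symm.2
    have q6' := had.symm.2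
    have key : ∀ i j : Fin 4, G.Adj (![a, b, c, d] i) (![a, b, c, d] j) ↔
        (SimpleGraph.pathGraph 4).Adj i j := by
      intro i j
      fin_cases i <;> fin_cases j <;> simp [SimpleGraph.pathGraph_adj, q1, q2, q3, q4, q5, q6,
        q1', q2', q3', q4', q5', q6']
    exact fun {i j} => key i j

/-- The complement of the path `a b c d` is the path `b d a c`. This lets neighbors and
non-neighbors, joins and unions be treated alike. -/
theorem IsCograph.not_alternating {V : Type*} {G : SimpleGraph V} (hG : IsCograph G) {o : Bool}
    {a b c d : V} (hab : G.Pair o a b) (hbc : G.Pair o b c) (hcd : G.Pair o c d)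
    (hac : G.Pair (!o) a c) (hbd : G.Pair (!o) b d) (had : G.Pair (!o) a d) : False := by
  cases o
  · exact hG.not_path hbd had.symm hac hab.symm hcd.symm hbc
  · exact hG.not_path hab hbc hcd hac hbd had

namespace Cotree

variable {V : Type*} [DecidableEq V]

/-- The vertices of a cotree. -/
def verts : Cotree V → Finset V
  | leaf v => {v}
  | node _ a b => a.verts ∪ b.verts

/-- The number of nodes. -/
def size : Cotree V → ℕ
  | leaf _ => 1
  | node _ a b => a.size + b.size + 1

/-- The cotree represents the subgraph of `G` that is induced by its vertices. -/
def Rep (G : SimpleGraph V) : Cotree V → Prop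
  | leaf _ => True
  | node o a b => a.Rep G ∧ b.Rep G ∧ ∀ u ∈ a.verts, ∀ v ∈ b.verts, G.Pair o u v

/-- The label of the root. -/
def op : Cotree V → Bool
  -- This default is immaterial: at a leaf one of the two parts is empty, so the condition on cross
  -- pairs is vacuous.
  | leaf _ => false
  | node o _ _ => o

theorem verts_nonempty (t : Cotree V) : t.verts.Nonempty := by
  induction t with
  | leaf v => exact ⟨v, by simp [verts]⟩
  | node o a b iha ihb => exact iha.mono Finset.subset_union_left

theorem Rep.disjoint {G : SimpleGraph V} {o : Bool} {a b : Cotree V}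
    (h : (node o a b).Rep G) : Disjoint a.verts b.verts :=
  Finset.disjoint_left.2 fun u hu hv => (h.2.2 u hu u hv).1 rfl

/-- A binary tree has one inner node fewer than leaves. This keeps the number of nodes visited per
insertion linear. -/
theorem Rep.size_add_one {G : SimpleGraph V} {t : Cotree V} (h : t.Rep G) :
    t.size + 1 = 2 * t.verts.card := by
  induction t with
  | leaf v => simp [size, verts]
  | node o a b iha ihb =>
    simp only [size, verts]
    rw [Finset.card_union_of_disjoint h.disjoint]
    have := iha h.1
    have := ihb h.2.1
    omega

/-- The vertices of an optional cotree. -/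
def overts : Option (Cotree V) → Finset V
  | none => ∅
  | some t => t.verts

def ORep (G : SimpleGraph V) : Option (Cotree V) → Prop
  | none => True
  | some t => t.Rep G

/-- Union or join of two optional cotrees. -/
def merge (o : Bool) : Option (Cotree V) → Option (Cotree V) → Option (Cotree V)
  | none, y => y
  | some a, none => some a
  | some a, some b => some (node o a b)

theorem merge_none_left (o : Bool) (t : Option (Cotree V)) : merge o none t = t := rfl

theorem merge_none_right (o : Bool) (t : Option (Cotree V)) : merge o t none = t := by
  cases t <;> rfl

theorem overts_merge (o : Bool) (s t : Option (Cotree V)) :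
    overts (merge o s t) = overts s ∪ overts t := by
  cases s <;> cases t <;> simp [merge, overts, verts]

theorem ORep.merge {G : SimpleGraph V} {o : Bool} {s t : Option (Cotree V)} (hs : ORep G s)
    (ht : ORep G t) (h : ∀ u ∈ overts s, ∀ v ∈ overts t, G.Pair o u v) :
    ORep G (Cotree.merge o s t) := by
  cases s with
  | none => exact ht
  | some s =>
    cases t with
    | none => exact hs
    | some t => exact ⟨hs, ht, h⟩

/-- The result of inserting a vertex `x`: either the cotree `D` of the new graph, or the parts of
the graph that consist of neighbours (`P true`) and of non-neighbours (`P false`) of `x`. -/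
structure Ins (V : Type*) where
  P : Bool → Option (Cotree V)
  D : Option (Cotree V)

/-- Attaches `x` to the two parts of a graph. -/
def attach (x : V) (o : Bool) (P : Bool → Option (Cotree V)) : Option (Cotree V) :=
  merge o (P o) (merge (!o) (P (!o)) (some (leaf x)))

/-- Prepares the result at a child `t` for its parent with label `o`. -/
def adjust (x : V) (o : Bool) (t : Cotree V) (r : Ins V) : Ins V :=
  if (r.P true).isSome ∧ (r.P false).isSome ∧ t.op ≠ o then ⟨fun _ => none, attach x t.op r.P⟩
  else r

/-- Combines the results at the two children of a node. -/
def combine (o : Bool) (r₁ r₂ : Ins V) : Ins V :=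
  if (merge o r₁.D r₂.D).isSome then
    ⟨fun _ => none, merge o (merge o r₁.D r₂.D)
      (merge o (merge o (r₁.P true) (r₂.P true)) (merge o (r₁.P false) (r₂.P false)))⟩
  else ⟨fun c => merge o (r₁.P c) (r₂.P c), none⟩

/-- Inserts `x`, whose neighbours are given by `adj`. -/
def ins (x : V) (adj : V → Bool) : Cotree V → Ins V
  | leaf v => ⟨fun c => if c = adj v then some (leaf v) else none, none⟩
  | node o a b => combine o (adjust x o a (ins x adj a)) (adjust x o b (ins x adj b))

/-- The cotree with the vertex `x` inserted. -/
def insert (x : V) (adj : V → Bool) : Option (Cotree V) → Option (Cotree V)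
  | none => some (leaf x)
  | some t =>
      if (ins x adj t).D.isSome then (ins x adj t).D else attach x t.op (ins x adj t).P

/-- The graph on `S` consists of the two parts, which are related by `o`. -/
structure IsSplit (G : SimpleGraph V) (adj : V → Bool) (S : Finset V) (o : Bool) (r : Ins V) :
    Prop where
  D : r.D = none
  rep : ∀ c, ORep G (r.P c)
  pure : ∀ c, ∀ v ∈ overts (r.P c), adj v = c
  union : overts (r.P true) ∪ overts (r.P false) = S
  cross : ∀ u ∈ overts (r.P true), ∀ v ∈ overts (r.P false), G.Pair o u v

/-- A cotree for `S ∪ {x}` has been found. -/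
structure IsDone (G : SimpleGraph V) (x : V) (S : Finset V) (r : Ins V) : Prop where
  P : ∀ c, r.P c = none
  D : r.D ≠ none
  rep : ORep G r.D
  verts : overts r.D = Insert.insert x S

/-- `S` contains a neighbour and a non-neighbour of `x` that are related by `o`. -/
def Mixed (G : SimpleGraph V) (adj : V → Bool) (S : Finset V) (o : Bool) : Prop :=
  ∃ p ∈ S, ∃ q ∈ S, adj p = true ∧ adj q = false ∧ G.Pair o p q

theorem Mixed.mono {G : SimpleGraph V} {adj : V → Bool} {S T : Finset V} {o : Bool}
    (h : Mixed G adj S o) (hST : S ⊆ T) : Mixed G adj T o :=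
  let ⟨p, hp, q, hq, h'⟩ := h
  ⟨p, hST hp, q, hST hq, h'⟩

/-- Both kinds of vertices appear in any order. -/
theorem Mixed.exists_pair {G : SimpleGraph V} {adj : V → Bool} {S : Finset V} {o : Bool}
    (h : Mixed G adj S o) (c : Bool) :
    ∃ p ∈ S, ∃ q ∈ S, adj p = c ∧ adj q = !c ∧ G.Pair o p q := by
  obtain ⟨p, hp, q, hq, h1, h2, h3⟩ := h
  cases c
  · exact ⟨q, hq, p, hp, h2, h1, h3.symm⟩
  · exact ⟨p, hp, q, hq, h1, h2, h3⟩

/-! ### Correctness of the insertion of a vertex -/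

variable {G : SimpleGraph V} {x : V} {adj : V → Bool}

theorem IsSplit.cross' {S : Finset V} {o : Bool} {r : Ins V} (h : IsSplit G adj S o r) (c : Bool) :
    ∀ u ∈ overts (r.P c), ∀ v ∈ overts (r.P (!c)), G.Pair o u v := by
  cases c
  · exact fun u hu v hv => (h.cross v hv u hu).symm
  · exact h.cross

theorem IsSplit.mem {S : Finset V} {o : Bool} {r : Ins V} (h : IsSplit G adj S o r) {c : Bool}
    {v : V} (hv : v ∈ overts (r.P c)) : v ∈ S := by
  rw [← h.union]
  cases c
  · exact Finset.mem_union_right _ hv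
  · exact Finset.mem_union_left _ hv

theorem IsSplit.union' {S : Finset V} {o : Bool} {r : Ins V} (h : IsSplit G adj S o r) (c : Bool) :
    overts (r.P c) ∪ overts (r.P (!c)) = S := by
  cases c
  · rw [Finset.union_comm]; exact h.union
  · exact h.union

theorem pair_of_adj (hadj : ∀ v, adj v = true ↔ G.Adj x v) {v : V} (hv : v ≠ x) {c : Bool}
    (h : adj v = c) : G.Pair c x v :=
  ⟨hv.symm, by rw [← hadj, h]⟩

/-- The part `P o` is related by `o` both to the other part and to `x`, while `P (!o)` is related to
`x` by `!o`; so `x` first joins `P (!o)` and the result joins `P o`. -/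
theorem IsSplit.attach (hadj : ∀ v, adj v = true ↔ G.Adj x v) {S : Finset V} {o : Bool} {r : Ins V}
    (h : IsSplit G adj S o r) (hx : x ∉ S) :
    ORep G (attach x o r.P) ∧ overts (attach x o r.P) = Insert.insert x S := by
  have hne : ∀ {c v}, v ∈ overts (r.P c) → v ≠ x := fun hv => by
    rintro rfl; exact hx (h.mem hv)
  constructor
  · refine (h.rep o).merge ((h.rep (!o)).merge trivial ?_) ?_
    · intro u hu v hv
      obtain rfl : v = x := by simpa [overts, verts] using hv
      exact (pair_of_adj hadj (hne hu) (h.pure _ _ hu)).symm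
    · intro u hu v hv
      rw [overts_merge, Finset.mem_union] at hv
      rcases hv with hv | hv
      · exact h.cross' o u hu v hv
      · obtain rfl : v = x := by simpa [overts, verts] using hv
        exact (pair_of_adj hadj (hne hu) (h.pure _ _ hu)).symm
  · unfold Cotree.attach
    rw [overts_merge, overts_merge, ← Finset.union_assoc, h.union' o, Finset.union_comm]
    rfl

/-- A split with an empty part is a split for every label. Otherwise the cross pairs have type
`t.op`; if that is not `o`, the parts cannot be passed to the parent, `x` is attached here, and a
cross pair witnesses `Mixed` for `!o`. -/
theorem adjust_spec (hadj : ∀ v, adj v = true ↔ G.Adj x v) {t : Cotree V} (hx : x ∉ t.verts)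
    (o : Bool) {r : Ins V}
    (h : IsSplit G adj t.verts t.op r ∨
      IsDone G x t.verts r ∧ ∀ c, Mixed G adj t.verts c) :
    IsSplit G adj t.verts o (adjust x o t r) ∨
      IsDone G x t.verts (adjust x o t r) ∧ Mixed G adj t.verts (!o) := by
  unfold adjust
  rcases h with h | ⟨h, hm⟩
  · split_ifs with hc
    · right
      obtain ⟨h1, h2, h3⟩ := hc
      have ht : t.op = !o := by cases o <;> simpa using h3
      obtain ⟨ha, hb⟩ := h.attach hadj hx
      refine ⟨⟨fun _ => rfl, fun h0 => ?_, ha, hb⟩, ?_⟩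
      · simp only at h0
        rw [h0] at hb
        exact absurd hb.symm (Finset.insert_ne_empty _ _)
      · obtain ⟨a, ha⟩ := Option.isSome_iff_exists.1 h1
        obtain ⟨b, hb⟩ := Option.isSome_iff_exists.1 h2
        obtain ⟨p, hp⟩ := a.verts_nonempty
        obtain ⟨q, hq⟩ := b.verts_nonempty
        have hp' : p ∈ overts (r.P true) := by rw [ha]; exact hp
        have hq' : q ∈ overts (r.P false) := by rw [hb]; exact hq
        exact ⟨p, h.mem hp', q, h.mem hq', h.pure _ _ hp', h.pure _ _ hq', ht ▸ h.cross p hp' q hq'⟩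
    · left
      refine ⟨h.D, h.rep, h.pure, h.union, fun u hu v hv => ?_⟩
      have : t.op = o := by
        by_contra hne
        refine hc ⟨?_, ?_, hne⟩
        · cases hP : r.P true
          · rw [hP] at hu; simp [overts] at hu
          · rfl
        · cases hP : r.P false
          · rw [hP] at hv; simp [overts] at hv
          · rfl
      exact this ▸ h.cross u hu v hv
  · right
    rw [if_neg (by simp [h.P])]
    exact ⟨h, hm _⟩

/-- In a cograph, a mixed part determines the adjacency of `x` to the other part. -/
theorem adj_eq_of_mixed (hG : IsCograph G) (hadj : ∀ v, adj v = true ↔ G.Adj x v)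
    {S S' : Finset V} (hx : x ∉ S) (hx' : x ∉ S') {o : Bool}
    (hS : ∀ u ∈ S, ∀ v ∈ S', G.Pair o u v) (hm : Mixed G adj S (!o)) {y : V} (hy : y ∈ S') :
    adj y = o := by
  by_contra hne
  have hyo : adj y = !o := by cases o <;> simpa using hne
  obtain ⟨p, hp, q, hq, h1, h2, h3⟩ := hm.exists_pair (!o)
  have ne : ∀ {v}, v ∈ S → v ≠ x := fun hv => by rintro rfl; exact hx hv
  have ney : y ≠ x := by rintro rfl; exact hx' hy
  -- If `y` had the other relation to `x`, then `y x p q` would be an induced path in `G` or in its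
  -- complement.
  refine hG.not_alternating (o := !o) (a := y) (b := x) (c := p) (d := q)
    (pair_of_adj hadj ney hyo).symm (pair_of_adj hadj (ne hp) h1) h3 ?_ ?_ ?_
  · simpa using (hS p hp y hy).symm
  · exact pair_of_adj hadj (ne hq) h2
  · simpa using (hS q hq y hy).symm

/-- By `adj_eq_of_mixed`, `x` is related to all of `S'` by `o`, just like `S`, so the finished
cotree is combined with `S'` by `o`. A vertex of `S'` and one of `S` with the opposite relation to
`x` supply the mixed pair for `o` itself, so the result is mixed in both ways, as every further
ancestor needs. -/
theorem combine_done (hG : IsCograph G) (hadj : ∀ v, adj v = true ↔ G.Adj x v)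
    {S S' : Finset V} (hx : x ∉ S) (hx' : x ∉ S') (hne : S'.Nonempty) {o : Bool}
    (hS : ∀ u ∈ S, ∀ v ∈ S', G.Pair o u v) (hm : Mixed G adj S (!o)) {r r' : Ins V}
    (h : IsDone G x S r) (h' : IsSplit G adj S' o r') :
    ORep G (merge o r.D (merge o (r'.P true) (r'.P false))) ∧
      overts (merge o r.D (merge o (r'.P true) (r'.P false))) = Insert.insert x (S ∪ S') ∧
      ∀ c, Mixed G adj (S ∪ S') c := by
  have key : ∀ y ∈ S', adj y = o := fun y hy => adj_eq_of_mixed hG hadj hx hx' hS hm hy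
  refine ⟨h.rep.merge ((h'.rep _).merge (h'.rep _) h'.cross) ?_, ?_, ?_⟩
  · intro u hu v hv
    rw [overts_merge, h'.union] at hv
    rw [h.verts, Finset.mem_insert] at hu
    rcases hu with rfl | hu
    · exact pair_of_adj hadj (by rintro rfl; exact hx' hv) (key v hv)
    · exact hS u hu v hv
  · rw [overts_merge, overts_merge, h'.union, h.verts, Finset.insert_union]
  · intro c
    by_cases hc : c = o
    · subst hc
      obtain ⟨y, hy⟩ := hne
      obtain ⟨p, hp, -, -, h1, -, -⟩ := hm.exists_pair (!c)
      have hpy := hS p hp y hy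
      have hy' := key y hy
      cases c
      · exact ⟨p, by simp [hp], y, by simp [hy], h1, hy', hpy⟩
      · exact ⟨y, by simp [hy], p, by simp [hp], hy', h1, hpy.symm⟩
    · have : c = !o := by cases o <;> simpa using hc
      exact this ▸ hm.mono Finset.subset_union_left

/-- Induction on the cotree. Carrying `Mixed` for both labels in the finished case makes the
hypothesis usable whatever the label of the parent is. -/
theorem ins_spec (hG : IsCograph G) (hadj : ∀ v, adj v = true ↔ G.Adj x v) {t : Cotree V}
    (ht : t.Rep G) (hx : x ∉ t.verts) :
    IsSplit G adj t.verts t.op (ins x adj t) ∨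
      IsDone G x t.verts (ins x adj t) ∧ ∀ c, Mixed G adj t.verts c := by
  induction t with
  | leaf v =>
    left
    cases hv : adj v <;> constructor <;> simp [ins, hv, overts, verts, ORep, Rep]
  | node o a b iha ihb =>
    simp only [verts, Finset.mem_union, not_or] at hx
    have ha := adjust_spec hadj hx.1 o (iha ht.1 hx.1)
    have hb := adjust_spec hadj hx.2 o (ihb ht.2.1 hx.2)
    have hS := ht.2.2
    have hS' : ∀ u ∈ b.verts, ∀ v ∈ a.verts, G.Pair o u v := fun u hu v hv => (hS v hv u hu).symm
    simp only [ins, verts, op]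
    set r₁ := adjust x o a (ins x adj a)
    set r₂ := adjust x o b (ins x adj b)
    unfold combine
    rcases ha with ha | ⟨ha, ma⟩ <;> rcases hb with hb | ⟨hb, mb⟩
    · left
      rw [if_neg (by simp [ha.D, hb.D, merge])]
      refine ⟨rfl, fun c => (ha.rep c).merge (hb.rep c) fun u hu v hv =>
        hS u (ha.mem hu) v (hb.mem hv), fun c v hv => ?_, ?_, fun u hu v hv => ?_⟩
      · rw [overts_merge, Finset.mem_union] at hv
        exact hv.elim (ha.pure c v) (hb.pure c v)
      · simp only [overts_merge]
        rw [← ha.union, ← hb.union]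
        ac_rfl
      · rw [overts_merge, Finset.mem_union] at hu hv
        rcases hu with hu | hu <;> rcases hv with hv | hv
        · exact ha.cross u hu v hv
        · exact hS u (ha.mem hu) v (hb.mem hv)
        · exact hS' u (hb.mem hu) v (ha.mem hv)
        · exact hb.cross u hu v hv
    · right
      obtain ⟨d, hd⟩ := Option.ne_none_iff_exists'.1 hb.D
      have := combine_done hG hadj hx.2 hx.1 a.verts_nonempty hS' mb hb ha
      rw [if_pos (by simp [ha.D, hd, merge])]
      simp only [hb.P, merge_none_right, merge_none_left, ha.D]
      rw [Finset.union_comm b.verts] at this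
      refine ⟨⟨fun _ => rfl, fun h0 => ?_, this.1, this.2.1⟩, this.2.2⟩
      have h1 := (congrArg overts h0).symm.trans this.2.1
      exact absurd h1.symm (Finset.insert_ne_empty _ _)
    · right
      obtain ⟨d, hd⟩ := Option.ne_none_iff_exists'.1 ha.D
      have := combine_done hG hadj hx.1 hx.2 b.verts_nonempty hS ma ha hb
      rw [if_pos (by simp [hb.D, hd, merge])]
      simp only [ha.P, merge_none_right, merge_none_left, hb.D]
      refine ⟨⟨fun _ => rfl, fun h0 => ?_, this.1, this.2.1⟩, this.2.2⟩
      have h1 := (congrArg overts h0).symm.trans this.2.1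
      exact absurd h1.symm (Finset.insert_ne_empty _ _)
    -- Both children cannot be finished: the first forces relation `o` between `x` and the whole
    -- second child, which contains a vertex with relation `!o`.
    · obtain ⟨y, hy, -, -, h1, -⟩ := mb.exists_pair (!o)
      have := adj_eq_of_mixed hG hadj hx.1 hx.2 hS ma hy
      rw [h1] at this
      simp at this

theorem insert_spec (hG : IsCograph G) (hadj : ∀ v, adj v = true ↔ G.Adj x v)
    {t : Option (Cotree V)} (ht : ORep G t) (hx : x ∉ overts t) :
    ORep G (insert x adj t) ∧ overts (insert x adj t) = Insert.insert x (overts t) := by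
  cases t with
  | none => exact ⟨trivial, rfl⟩
  | some t =>
    unfold insert
    rcases ins_spec hG hadj (t := t) ht hx with h | ⟨h, -⟩
    · simp only [h.D, Option.isSome_none, Bool.false_eq_true, if_false]
      exact h.attach hadj hx
    · dsimp only
      rw [if_pos (Option.isSome_iff_ne_none.2 h.D)]
      exact ⟨h.rep, h.verts⟩

end Cotree

/-! ## Coverage by stars -/

namespace StarCover

variable {V : Type*} [DecidableEq V] {G : SimpleGraph V} {s : ℕ}

/-- `g` assigns each leaf in `L` to an adjacent center in `C`, and each center has at most `s`
leaves. -/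
structure Assign (G : SimpleGraph V) (s : ℕ) (C L : Finset V) (g : V → V) : Prop where
  disj : Disjoint C L
  mem : ∀ v ∈ L, g v ∈ C
  adj : ∀ v ∈ L, G.Adj v (g v)
  load : ∀ z ∈ C, (L.filter (g · = z)).card ≤ s

/-- In `U` one can choose `c` centers and assign `l` leaves to them. -/
def Covers (G : SimpleGraph V) (s : ℕ) (U : Finset V) (c l : ℕ) : Prop :=
  ∃ C L g, C ⊆ U ∧ L ⊆ U ∧ C.card = c ∧ L.card = l ∧ Assign G s C L g

theorem Assign.subset {C L L' : Finset V} {g : V → V} (h : Assign G s C L g) (hL : L' ⊆ L) :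
    Assign G s C L' g where
  disj := h.disj.mono_right hL
  mem v hv := h.mem v (hL hv)
  adj v hv := h.adj v (hL hv)
  load z hz := (Finset.card_le_card (Finset.filter_subset_filter _ hL)).trans (h.load z hz)

theorem Covers.mono {U : Finset V} {c l l' : ℕ} (h : Covers G s U c l) (hl : l' ≤ l) :
    Covers G s U c l' := by
  obtain ⟨C, L, g, hC, hL, hc, hl', ha⟩ := h
  obtain ⟨L', hL', hcard⟩ := Finset.exists_subset_card_eq (s := L) (n := l') (by omega)
  exact ⟨C, L', g, hC, hL'.trans hL, hc, hcard, ha.subset hL'⟩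

theorem Covers.add_le {U : Finset V} {c l : ℕ} (h : Covers G s U c l) : c + l ≤ U.card := by
  obtain ⟨C, L, g, hC, hL, rfl, rfl, ha⟩ := h
  rw [← Finset.card_union_of_disjoint ha.disj]
  exact Finset.card_le_card (Finset.union_subset hC hL)

theorem Covers.le_mul {U : Finset V} {c l : ℕ} (h : Covers G s U c l) : l ≤ s * c := by
  obtain ⟨C, L, g, hC, hL, rfl, rfl, ha⟩ := h
  exact Finset.card_le_mul_card_image_of_maps_to ha.mem s ha.load

theorem covers_zero {U : Finset V} {c : ℕ} (hc : c ≤ U.card) : Covers G s U c 0 := by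
  obtain ⟨C, hC, hcard⟩ := Finset.exists_subset_card_eq hc
  exact ⟨C, ∅, id, hC, by simp, hcard, by simp, by simp, by simp, by simp, by simp⟩

/-- Further leaves can be assigned to centers that are adjacent to all of them and have enough spare
capacity. -/
theorem Assign.extend {C C' L : Finset V} {g : V → V} (h : Assign G s C L g) (hC' : C' ⊆ C)
    (A : Finset V) (hAC : Disjoint C A) (hAL : Disjoint L A)
    (hadj : ∀ v ∈ A, ∀ z ∈ C', G.Adj v z)
    (hcap : A.card + (L.filter (g · ∈ C')).card ≤ s * C'.card) :
    ∃ g', Assign G s C (L ∪ A) g' ∧ (∀ v ∈ L, g' v = g v) ∧ ∀ v ∈ A, g' v ∈ C' := by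
  induction A using Finset.induction_on with
  | empty => exact ⟨g, by simpa using h, by simp, by simp⟩
  | insert a A ha ih =>
    rw [Finset.card_insert_of_notMem ha] at hcap
    rw [Finset.disjoint_insert_right] at hAC hAL
    obtain ⟨g', hg, hgL, hgA⟩ := ih hAC.2 hAL.2
      (fun v hv => hadj v (Finset.mem_insert_of_mem hv)) (by omega)
    -- Some center in `C'` has room: if all were full, they would carry at least `s * C'.card`
    -- leaves, against the capacity that remains with `a` still to be placed.
    obtain ⟨z, hz, hload⟩ : ∃ z ∈ C', ((L ∪ A).filter (g' · = z)).card < s := by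
      by_contra! hcon
      have h1 : s * C'.card ≤ ((L ∪ A).filter (g' · ∈ C')).card := by
        refine Finset.mul_card_image_le_card_of_maps_to (f := g') (t := C')
          (fun v hv => (Finset.mem_filter.1 hv).2) s fun z hz => (hcon z hz).trans ?_
        refine Finset.card_le_card fun v hv => ?_
        simp only [Finset.mem_filter] at hv ⊢
        exact ⟨⟨hv.1, hv.2 ▸ hz⟩, hv.2⟩
      have h2 : (L ∪ A).filter (g' · ∈ C') ⊆ L.filter (g · ∈ C') ∪ A := by
        intro v hv
        simp only [Finset.mem_filter, Finset.mem_union] at hv ⊢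
        rcases hv with ⟨hv | hv, hv'⟩
        · exact Or.inl ⟨hv, hgL v hv ▸ hv'⟩
        · exact Or.inr hv
      have h3 := (Finset.card_le_card h2).trans (Finset.card_union_le _ _)
      omega
    have haU : a ∉ L ∪ A := by simp [hAL.1, ha]
    have hne : ∀ v ∈ L ∪ A, Function.update g' a z v = g' v := fun v hv =>
      Function.update_of_ne (by rintro rfl; exact haU hv) _ _
    have hins : L ∪ insert a A = insert a (L ∪ A) := Finset.union_insert _ _ _
    refine ⟨Function.update g' a z, ⟨?_, ?_, ?_, ?_⟩, ?_, ?_⟩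
    · rw [hins, Finset.disjoint_insert_right]
      exact ⟨hAC.1, hg.disj⟩
    · intro v hv
      rw [hins, Finset.mem_insert] at hv
      rcases hv with rfl | hv
      · simpa using hC' hz
      · rw [hne v hv]; exact hg.mem v hv
    · intro v hv
      rw [hins, Finset.mem_insert] at hv
      rcases hv with rfl | hv
      · simpa using hadj v (Finset.mem_insert_self _ _) z hz
      · rw [hne v hv]; exact hg.adj v hv
    · intro y hy
      rw [hins, Finset.filter_insert]
      have hfil : (L ∪ A).filter (Function.update g' a z · = y) = (L ∪ A).filter (g' · = y) :=
        Finset.filter_congr fun v hv => by rw [hne v hv]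
      rw [hfil]
      split_ifs with hay
      · rw [Function.update_self] at hay
        subst hay
        exact (Finset.card_insert_le _ _).trans hload
      · exact hg.load y hy
    · intro v hv
      rw [hne v (Finset.mem_union_left _ hv), hgL v hv]
    · intro v hv
      rw [Finset.mem_insert] at hv
      rcases hv with rfl | hv
      · simpa using hz
      · rw [hne v (Finset.mem_union_right _ hv)]; exact hgA v hv

/-- Assignments in disjoint sets can be combined. -/
theorem Assign.union {C₁ C₂ L₁ L₂ : Finset V} {g₁ g₂ : V → V} (h₁ : Assign G s C₁ L₁ g₁)
    (h₂ : Assign G s C₂ L₂ g₂) (hC : Disjoint C₁ C₂) (hL : Disjoint L₁ L₂)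
    (h12 : Disjoint C₁ L₂) (h21 : Disjoint C₂ L₁) :
    Assign G s (C₁ ∪ C₂) (L₁ ∪ L₂) (fun v => if v ∈ L₁ then g₁ v else g₂ v) := by
  have e₁ : ∀ v ∈ L₁, (if v ∈ L₁ then g₁ v else g₂ v) = g₁ v := fun v hv => if_pos hv
  have e₂ : ∀ v ∈ L₂, (if v ∈ L₁ then g₁ v else g₂ v) = g₂ v := fun v hv =>
    if_neg (Finset.disjoint_right.1 hL hv)
  refine ⟨?_, ?_, ?_, ?_⟩
  · simp only [Finset.disjoint_union_left, Finset.disjoint_union_right]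
    exact ⟨⟨h₁.disj, h21⟩, h12, h₂.disj⟩
  · intro v hv
    rcases Finset.mem_union.1 hv with hv | hv
    · rw [e₁ v hv]; exact Finset.mem_union_left _ (h₁.mem v hv)
    · rw [e₂ v hv]; exact Finset.mem_union_right _ (h₂.mem v hv)
  · intro v hv
    rcases Finset.mem_union.1 hv with hv | hv
    · rw [e₁ v hv]; exact h₁.adj v hv
    · rw [e₂ v hv]; exact h₂.adj v hv
  · intro z hz
    rw [Finset.filter_union, Finset.filter_congr (fun v hv => by rw [e₁ v hv] : ∀ v ∈ L₁,
      (if v ∈ L₁ then g₁ v else g₂ v) = z ↔ g₁ v = z),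
      Finset.filter_congr (fun v hv => by rw [e₂ v hv] : ∀ v ∈ L₂,
      (if v ∈ L₁ then g₁ v else g₂ v) = z ↔ g₂ v = z)]
    rcases Finset.mem_union.1 hz with hz | hz
    · rw [Finset.filter_false_of_mem (s := L₂) fun v hv hvz =>
        Finset.disjoint_left.1 hC hz ((show g₂ v = z from hvz) ▸ h₂.mem v hv), Finset.union_empty]
      exact h₁.load z hz
    · rw [Finset.filter_false_of_mem (s := L₁) fun v hv hvz =>
        Finset.disjoint_right.1 hC hz ((show g₁ v = z from hvz) ▸ h₁.mem v hv), Finset.empty_union]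
      exact h₂.load z hz

/-- The number of leaves that are covered at a node, if `lᵢ` leaves can be covered in the `i`-th
child with `cᵢ` centers. -/
def nodeVal (s : ℕ) (o : Bool) (n₁ n₂ c₁ c₂ l₁ l₂ : ℕ) : ℕ :=
  if o then min (min (n₁ + n₂ - (c₁ + c₂)) (s * (c₁ + c₂)))
    (min (l₁ + s * c₂ + (n₂ - c₂)) (l₂ + s * c₁ + (n₁ - c₁)))
  else l₁ + l₂

theorem nodeVal_mono {o : Bool} {n₁ n₂ c₁ c₂ l₁ l₂ l₁' l₂' : ℕ} (h₁ : l₁ ≤ l₁') (h₂ : l₂ ≤ l₂') :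
    nodeVal s o n₁ n₂ c₁ c₂ l₁ l₂ ≤ nodeVal s o n₁ n₂ c₁ c₂ l₁' l₂' := by
  unfold nodeVal
  split_ifs
  · gcongr
  · omega

/-- The maximum flow through a join. -/
theorem exists_flow {p₁ p₂ q₁ q₂ l₁ l₂ : ℕ} (h1 : l₁ ≤ p₁) (h2 : l₂ ≤ p₂) (h3 : l₁ ≤ q₁)
    (h4 : l₂ ≤ q₂) : ∃ b₁ b₂ a₁ a₂, b₁ ≤ l₁ ∧ b₂ ≤ l₂ ∧ a₁ + b₁ ≤ p₁ ∧ a₂ + b₂ ≤ p₂ ∧ a₂ + b₁ ≤ q₁ ∧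
      a₁ + b₂ ≤ q₂ ∧
      b₁ + b₂ + a₁ + a₂ = min (min (q₁ + q₂) (p₁ + p₂)) (min (l₁ + p₂ + q₂) (l₂ + p₁ + q₁)) := by
  generalize hm : min (min (q₁ + q₂) (p₁ + p₂)) (min (l₁ + p₂ + q₂) (l₂ + p₁ + q₁)) = m
  by_cases ha : q₂ + l₁ ≤ p₁ + l₂
  · by_cases hb : q₁ + l₂ ≤ p₂ + l₁
    · exact ⟨l₁, l₂, q₂ - l₂, q₁ - l₁, by omega⟩
    -- Here side `2` lacks capacity. Starting from `b₂ = l₂`, which gives the total `l₁ + p₂ + q₂ -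
    -- l₂`, each unit taken from `b₂` lets one more leaf cross in each direction, a net gain of one;
    -- so `b₂` is lowered by what is missing to `m`. The third case is symmetric.
    · refine ⟨l₁, l₂ - (m - (l₁ + p₂ + q₂ - l₂)), q₂ - (l₂ - (m - (l₁ + p₂ + q₂ - l₂))),
        p₂ - (l₂ - (m - (l₁ + p₂ + q₂ - l₂))), by omega⟩
  · by_cases hb : q₁ + l₂ ≤ p₂ + l₁
    · refine ⟨l₁ - (m - (l₂ + p₁ + q₁ - l₁)), l₂, p₁ - (l₁ - (m - (l₂ + p₁ + q₁ - l₁))),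
        q₁ - (l₁ - (m - (l₂ + p₁ + q₁ - l₁))), by omega⟩
    · exact ⟨l₁, l₂, p₁ - l₁, p₂ - l₂, by omega⟩

/-! ### The recursion at a node of the cotree -/

variable {U₁ U₂ : Finset V}

theorem Covers.union (hU : Disjoint U₁ U₂) {c₁ c₂ l₁ l₂ : ℕ} (h₁ : Covers G s U₁ c₁ l₁)
    (h₂ : Covers G s U₂ c₂ l₂) : Covers G s (U₁ ∪ U₂) (c₁ + c₂) (l₁ + l₂) := by
  obtain ⟨C₁, L₁, g₁, hC₁, hL₁, rfl, rfl, ha₁⟩ := h₁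
  obtain ⟨C₂, L₂, g₂, hC₂, hL₂, rfl, rfl, ha₂⟩ := h₂
  have dC : Disjoint C₁ C₂ := hU.mono hC₁ hC₂
  have dL : Disjoint L₁ L₂ := hU.mono hL₁ hL₂
  exact ⟨C₁ ∪ C₂, L₁ ∪ L₂, _, Finset.union_subset_union hC₁ hC₂, Finset.union_subset_union hL₁ hL₂,
    Finset.card_union_of_disjoint dC, Finset.card_union_of_disjoint dL,
    ha₁.union ha₂ dC dL (hU.mono hC₁ hL₂) (hU.symm.mono hC₂ hL₁)⟩

/-- Here `bᵢ` leaves stay on side `i`, and `aᵢ` unused vertices of the other side are given to the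
centers of side `i`. Adjacency across the join is complete, so counting suffices and `Assign.extend`
applies twice. -/
theorem Covers.join (hU : ∀ u ∈ U₁, ∀ v ∈ U₂, G.Adj u v) {c₁ c₂ b₁ b₂ a₁ a₂ : ℕ}
    (h₁ : Covers G s U₁ c₁ b₁) (h₂ : Covers G s U₂ c₂ b₂) (hp₁ : a₁ + b₁ ≤ s * c₁)
    (hp₂ : a₂ + b₂ ≤ s * c₂) (hq₁ : a₂ + b₁ ≤ U₁.card - c₁) (hq₂ : a₁ + b₂ ≤ U₂.card - c₂) :
    Covers G s (U₁ ∪ U₂) (c₁ + c₂) (b₁ + b₂ + a₁ + a₂) := by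
  have dU : Disjoint U₁ U₂ := Finset.disjoint_left.2 fun u hu hv => (hU u hu u hv).ne rfl
  obtain ⟨C₁, L₁, g₁, hC₁, hL₁, rfl, rfl, ha₁⟩ := h₁
  obtain ⟨C₂, L₂, g₂, hC₂, hL₂, rfl, rfl, ha₂⟩ := h₂
  have dC : Disjoint C₁ C₂ := dU.mono hC₁ hC₂
  have dL : Disjoint L₁ L₂ := dU.mono hL₁ hL₂
  have hr₁ : (U₁ \ (C₁ ∪ L₁)).card = U₁.card - C₁.card - L₁.card := by
    rw [Finset.card_sdiff_of_subset (Finset.union_subset hC₁ hL₁),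
      Finset.card_union_of_disjoint ha₁.disj]; omega
  have hr₂ : (U₂ \ (C₂ ∪ L₂)).card = U₂.card - C₂.card - L₂.card := by
    rw [Finset.card_sdiff_of_subset (Finset.union_subset hC₂ hL₂),
      Finset.card_union_of_disjoint ha₂.disj]; omega
  obtain ⟨A₁, hA₁, rfl⟩ := Finset.exists_subset_card_eq (s := U₂ \ (C₂ ∪ L₂)) (n := a₁) (by omega)
  obtain ⟨A₂, hA₂, rfl⟩ := Finset.exists_subset_card_eq (s := U₁ \ (C₁ ∪ L₁)) (n := a₂) (by omega)
  have hA₁U : A₁ ⊆ U₂ := hA₁.trans Finset.sdiff_subset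
  have hA₂U : A₂ ⊆ U₁ := hA₂.trans Finset.sdiff_subset
  have dA₁ : Disjoint (C₂ ∪ L₂) A₁ := Finset.disjoint_sdiff.mono_right hA₁
  have dA₂ : Disjoint (C₁ ∪ L₁) A₂ := Finset.disjoint_sdiff.mono_right hA₂
  rw [Finset.disjoint_union_left] at dA₁ dA₂
  have h0 := ha₁.union ha₂ dC dL (dU.mono hC₁ hL₂) (dU.symm.mono hC₂ hL₁)
  set g := fun v => if v ∈ L₁ then g₁ v else g₂ v with hg
  have e₁ : ∀ v ∈ L₁, g v ∈ C₁ := fun v hv => by simpa [hg, hv] using ha₁.mem v hv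
  have e₂ : ∀ v ∈ L₂, g v ∈ C₂ := fun v hv => by
    simpa [hg, Finset.disjoint_right.1 dL hv] using ha₂.mem v hv
  have f₁ : (L₁ ∪ L₂).filter (g · ∈ C₁) ⊆ L₁ := fun v hv => by
    rw [Finset.mem_filter, Finset.mem_union] at hv
    exact hv.1.resolve_right fun h => Finset.disjoint_left.1 dC hv.2 (e₂ v h)
  obtain ⟨g', h0', hgL, hgA⟩ := h0.extend (C' := C₁) Finset.subset_union_left A₁
    (Finset.disjoint_union_left.2 ⟨dU.mono hC₁ hA₁U, dA₁.1⟩)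
    (Finset.disjoint_union_left.2 ⟨dU.mono hL₁ hA₁U, dA₁.2⟩)
    (fun v hv z hz => (hU z (hC₁ hz) v (hA₁U hv)).symm)
    (by have := Finset.card_le_card f₁; omega)
  have f₂ : (L₁ ∪ L₂ ∪ A₁).filter (g' · ∈ C₂) ⊆ L₂ := fun v hv => by
    rw [Finset.mem_filter, Finset.mem_union, Finset.mem_union] at hv
    obtain ⟨(h | h) | h, h'⟩ := hv
    · rw [hgL v (Finset.mem_union_left _ h)] at h'
      exact absurd h' (Finset.disjoint_left.1 dC (e₁ v h))
    · exact h
    · exact absurd h' (Finset.disjoint_left.1 dC (hgA v h))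
  obtain ⟨g'', h0'', -⟩ := h0'.extend (C' := C₂) Finset.subset_union_right A₂
    (Finset.disjoint_union_left.2 ⟨dA₂.1, dU.symm.mono hC₂ hA₂U⟩)
    (Finset.disjoint_union_left.2 ⟨Finset.disjoint_union_left.2 ⟨dA₂.2, dU.symm.mono hL₂ hA₂U⟩,
      dU.symm.mono hA₁U hA₂U⟩)
    (fun v hv z hz => hU v (hA₂U hv) z (hC₂ hz))
    (by have := Finset.card_le_card f₂; omega)
  refine ⟨C₁ ∪ C₂, L₁ ∪ L₂ ∪ A₁ ∪ A₂, g'', Finset.union_subset_union hC₁ hC₂, ?_,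
    Finset.card_union_of_disjoint dC, ?_, h0''⟩
  · refine Finset.union_subset (Finset.union_subset (Finset.union_subset_union hL₁ hL₂) ?_) ?_
    · exact hA₁U.trans Finset.subset_union_right
    · exact hA₂U.trans Finset.subset_union_left
  · rw [Finset.card_union_of_disjoint, Finset.card_union_of_disjoint,
      Finset.card_union_of_disjoint dL]
    · exact Finset.disjoint_union_left.2 ⟨dU.mono hL₁ hA₁U, dA₁.2⟩
    · exact Finset.disjoint_union_left.2 ⟨Finset.disjoint_union_left.2
        ⟨dA₂.2, dU.symm.mono hL₂ hA₂U⟩, dU.symm.mono hA₁U hA₂U⟩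

/-- The lower bound of the recursion. At a join, a maximum flow may use fewer than `lᵢ` leaves
within side `i`, which `Covers.mono` permits. -/
theorem Covers.node {o : Bool} (hU : ∀ u ∈ U₁, ∀ v ∈ U₂, G.Pair o u v) {c₁ c₂ l₁ l₂ : ℕ}
    (h₁ : Covers G s U₁ c₁ l₁) (h₂ : Covers G s U₂ c₂ l₂) :
    Covers G s (U₁ ∪ U₂) (c₁ + c₂) (nodeVal s o U₁.card U₂.card c₁ c₂ l₁ l₂) := by
  have dU : Disjoint U₁ U₂ := Finset.disjoint_left.2 fun u hu hv => (hU u hu u hv).1 rfl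
  cases o with
  | false => exact h₁.union dU h₂
  | true =>
    have k1 := h₁.add_le
    have k2 := h₂.add_le
    obtain ⟨b₁, b₂, a₁, a₂, hb₁, hb₂, e1, e2, e3, e4, e5⟩ := exists_flow (p₁ := s * c₁)
      (p₂ := s * c₂) (q₁ := U₁.card - c₁) (q₂ := U₂.card - c₂) h₁.le_mul h₂.le_mul (by omega)
      (by omega : l₂ ≤ _)
    have := Covers.join (fun u hu v hv => (hU u hu v hv).2.2 rfl) (h₁.mono hb₁) (h₂.mono hb₂)
      e1 e2 e3 e4
    rw [e5] at this
    have hv : nodeVal s true U₁.card U₂.card c₁ c₂ l₁ l₂ = _ := if_pos rfl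
    rw [hv, mul_add]
    convert this using 3
    omega

theorem Assign.restrict {C L : Finset V} {g : V → V} (h : Assign G s C L g) (U : Finset V) :
    Covers G s U (C ∩ U).card (L.filter fun v => v ∈ U ∧ g v ∈ U).card := by
  refine ⟨C ∩ U, L.filter fun v => v ∈ U ∧ g v ∈ U, g, Finset.inter_subset_right,
    fun v hv => (Finset.mem_filter.1 hv).2.1, rfl, rfl, ?_, ?_, ?_, ?_⟩
  · exact h.disj.mono Finset.inter_subset_left (Finset.filter_subset _ _)
  · intro v hv
    rw [Finset.mem_filter] at hv
    exact Finset.mem_inter.2 ⟨h.mem v hv.1, hv.2.2⟩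
  · exact fun v hv => h.adj v (Finset.mem_filter.1 hv).1
  · exact fun z hz => (Finset.card_le_card (Finset.filter_subset_filter _
      (Finset.filter_subset _ _))).trans (h.load z (Finset.mem_inter.1 hz).1)

/-- Leaves in `U₁` with a center in `U₁`, leaves with a center in `U₂`, and leaves in `U₂` exhaust
all leaves. -/
theorem Assign.card_le {C L : Finset V} {g : V → V} (h : Assign G s C L g) (hC : C ⊆ U₁ ∪ U₂)
    (hL : L ⊆ U₁ ∪ U₂) :
    L.card ≤ (L.filter fun v => v ∈ U₁ ∧ g v ∈ U₁).card + s * (C ∩ U₂).card +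
      (U₂.card - (C ∩ U₂).card) := by
  have h1 : L ⊆ ((L.filter fun v => v ∈ U₁ ∧ g v ∈ U₁) ∪ L.filter (fun v => g v ∈ C ∩ U₂)) ∪
      (U₂ \ C) := by
    intro v hv
    have hv' := Finset.mem_union.1 (hL hv)
    have hg := h.mem v hv
    have hg' := Finset.mem_union.1 (hC hg)
    have hvC := Finset.disjoint_right.1 h.disj hv
    simp only [Finset.mem_union, Finset.mem_filter, Finset.mem_inter, Finset.mem_sdiff]
    tauto
  have h2 : (L.filter (fun v => g v ∈ C ∩ U₂)).card ≤ s * (C ∩ U₂).card := by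
    refine Finset.card_le_mul_card_image_of_maps_to (f := g)
      (fun v hv => (Finset.mem_filter.1 hv).2) s fun z hz => ?_
    exact (Finset.card_le_card (Finset.filter_subset_filter _
      (Finset.filter_subset _ _))).trans (h.load z (Finset.mem_inter.1 hz).1)
  have h3 : (U₂ \ C).card = U₂.card - (C ∩ U₂).card := Finset.card_sdiff
  have h4 := (Finset.card_le_card h1).trans (Finset.card_union_le _ _)
  have h5 := Finset.card_union_le (L.filter fun v => v ∈ U₁ ∧ g v ∈ U₁)
    (L.filter (fun v => g v ∈ C ∩ U₂))
  omega

/-- The upper bound of the recursion: restrict an assignment to both sides. At a join,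
`Assign.card_le` in both directions gives two cuts, and the number of non-centers and the total
capacity give the others. At a union no leaf crosses. -/
theorem Covers.exists_of_node {o : Bool} (hU : ∀ u ∈ U₁, ∀ v ∈ U₂, G.Pair o u v) {c l : ℕ}
    (h : Covers G s (U₁ ∪ U₂) c l) : ∃ c₁ c₂ l₁ l₂, c₁ + c₂ = c ∧ Covers G s U₁ c₁ l₁ ∧
      Covers G s U₂ c₂ l₂ ∧ l ≤ nodeVal s o U₁.card U₂.card c₁ c₂ l₁ l₂ := by
  have dU : Disjoint U₁ U₂ := Finset.disjoint_left.2 fun u hu hv => (hU u hu u hv).1 rfl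
  have b1 := h.add_le
  have b2 := h.le_mul
  rw [Finset.card_union_of_disjoint dU] at b1
  obtain ⟨C, L, g, hC, hL, rfl, rfl, ha⟩ := h
  have hcc : (C ∩ U₁).card + (C ∩ U₂).card = C.card := by
    rw [← Finset.card_union_of_disjoint (dU.mono Finset.inter_subset_right
      Finset.inter_subset_right), ← Finset.inter_union_distrib_left,
      Finset.inter_eq_left.2 hC]
  refine ⟨_, _, _, _, hcc, ha.restrict U₁, ha.restrict U₂, ?_⟩
  have m1 := ha.card_le hC hL
  have m2 := ha.card_le (U₁ := U₂) (U₂ := U₁) (by rwa [Finset.union_comm])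
    (by rwa [Finset.union_comm])
  unfold nodeVal
  cases o with
  | true =>
    rw [if_pos rfl, hcc]
    simp only [le_min_iff]
    exact ⟨⟨by omega, b2⟩, m1, m2⟩
  | false =>
    rw [if_neg (by simp), ← Finset.card_union_of_disjoint]
    · refine Finset.card_le_card fun v hv => ?_
      have hv' := Finset.mem_union.1 (hL hv)
      have hg' := Finset.mem_union.1 (hC (ha.mem v hv))
      have hadj := ha.adj v hv
      have n1 : ¬ (v ∈ U₁ ∧ g v ∈ U₂) := fun h => by
        simpa [hadj] using (hU v h.1 _ h.2).2
      have n2 : ¬ (v ∈ U₂ ∧ g v ∈ U₁) := fun h => by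
        simpa [hadj.symm] using (hU _ h.2 _ h.1).2
      simp only [Finset.mem_union, Finset.mem_filter]
      tauto
    · rw [Finset.disjoint_left]
      intro v h1 h2
      exact Finset.disjoint_left.1 dU (Finset.mem_filter.1 h1).2.1 (Finset.mem_filter.1 h2).2.1

/-- `l` is the maximum number of leaves that can be covered in `U` with `c` centers. -/
def IsBest (G : SimpleGraph V) (s : ℕ) (U : Finset V) (c l : ℕ) : Prop :=
  Covers G s U c l ∧ ∀ l', Covers G s U c l' → l' ≤ l

theorem isBest_singleton {v : V} {c : ℕ} (hc : c ≤ 1) : IsBest G s {v} c 0 := by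
  refine ⟨covers_zero (by simpa using hc), fun l hl => ?_⟩
  have h1 := hl.add_le
  have h2 := hl.le_mul
  rw [Finset.card_singleton] at h1
  by_cases h : c = 0
  · subst h; simpa using h2
  · omega

/-! ## Star partitions -/

/-- Counting in both directions: `k` disjoint stars embed `k * (s + 1)` vertices, which is at least
`n`; conversely, `s * k` leaves on `k` centers of capacity `s` fill each center exactly, and centers
and leaves exhaust the vertices. -/
theorem hasStarPartition_iff {V : Type*} [Fintype V] [DecidableEq V] (G : SimpleGraph V) (s : ℕ) :
    HasStarPartition G s ↔ Fintype.card V = numStars (Fintype.card V) s * (s + 1) ∧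
      Covers G s Finset.univ (numStars (Fintype.card V) s) (s * numStars (Fintype.card V) s) := by
  set k := numStars (Fintype.card V) s with hk
  have hle : Fintype.card V ≤ k * (s + 1) := by
    have h := le_smul_ceilDiv (a := s + 1) (b := Fintype.card V) (by omega)
    rw [smul_eq_mul, mul_comm] at h
    exact h
  constructor
  · rintro ⟨P, hd, -, hs⟩
    have hc : ∀ i, ∃ f : Fin 1 ⊕ Fin s → V, Function.Injective f ∧ (∀ a, f a ∈ P i) ∧
        ∀ j, G.Adj (f (.inr j)) (f (.inl 0)) := by
      intro i
      obtain ⟨φ⟩ := hs i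
      refine ⟨fun a => (φ.toHom a : V), fun a b hab => φ.injective' (Subtype.ext hab),
        fun a => (φ.toHom a).2, fun j => ?_⟩
      have : (starK s).Adj (.inr j) (.inl 0) := by simp [starK]
      exact φ.toHom.map_adj this
    choose f hinj hmem hadj using hc
    have hdis : ∀ {i i' v}, v ∈ P i → v ∈ P i' → i = i' := fun {i i' v} h h' => by
      by_contra hne
      exact Set.disjoint_left.1 (hd i i' hne) h h'
    have hinj' : Function.Injective fun p : Fin k × (Fin 1 ⊕ Fin s) => f p.1 p.2 := by
      rintro ⟨i, a⟩ ⟨i', a'⟩ h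
      simp only at h
      obtain rfl : i = i' := hdis (hmem i a) (h ▸ hmem i' a')
      rw [hinj i h]
    have hcard := Fintype.card_le_of_injective _ hinj'
    simp only [Fintype.card_prod, Fintype.card_fin, Fintype.card_sum] at hcard
    refine ⟨by rw [add_comm 1 s] at hcard; omega, ?_⟩
    -- The assignment sends each vertex to the center of its class, which is unique by disjointness;
    -- values outside the classes are arbitrary.
    have hidx : ∀ v, ∃ z, ∀ i, v ∈ P i → z = f i (.inl 0) := fun v => by
      by_cases h : ∃ i, v ∈ P i
      · obtain ⟨i, hi⟩ := h
        exact ⟨f i (.inl 0), fun i' hi' => by rw [hdis hi hi']⟩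
      · exact ⟨v, fun i hi => absurd ⟨i, hi⟩ h⟩
    choose g hg using hidx
    refine ⟨Finset.univ.image fun i => f i (.inl 0),
      Finset.univ.image fun p : Fin k × Fin s => f p.1 (.inr p.2), g, Finset.subset_univ _,
      Finset.subset_univ _, ?_, ?_, ?_, ?_, ?_, ?_⟩
    · rw [Finset.card_image_of_injective _ fun i i' h => ?_, Finset.card_univ, Fintype.card_fin]
      exact (Prod.ext_iff.1 (hinj' (a₁ := (i, .inl 0)) (a₂ := (i', .inl 0)) h)).1
    · rw [Finset.card_image_of_injective _ fun p p' h => ?_, Finset.card_univ, Fintype.card_prod,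
        Fintype.card_fin, Fintype.card_fin, mul_comm]
      have := hinj' (a₁ := (p.1, .inr p.2)) (a₂ := (p'.1, .inr p'.2)) h
      simp only [Prod.mk.injEq, Sum.inr.injEq] at this
      exact Prod.ext this.1 this.2
    · rw [Finset.disjoint_left]
      intro v h1 h2
      simp only [Finset.mem_image, Finset.mem_univ, true_and] at h1 h2
      obtain ⟨i, hi⟩ := h1
      obtain ⟨p, hp⟩ := h2
      have := hinj' (a₁ := (i, .inl 0)) (a₂ := (p.1, .inr p.2)) (hi.trans hp.symm)
      simp at this
    · intro v hv
      simp only [Finset.mem_image, Finset.mem_univ, true_and] at hv ⊢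
      obtain ⟨p, rfl⟩ := hv
      exact ⟨p.1, (hg _ _ (hmem _ _)).symm⟩
    · intro v hv
      simp only [Finset.mem_image, Finset.mem_univ, true_and] at hv
      obtain ⟨p, rfl⟩ := hv
      rw [hg _ _ (hmem p.1 _)]
      exact hadj _ _
    · intro z hz
      simp only [Finset.mem_image, Finset.mem_univ, true_and] at hz
      obtain ⟨i, rfl⟩ := hz
      have hsub : ((Finset.univ.image fun p : Fin k × Fin s => f p.1 (.inr p.2)).filter
          (g · = f i (.inl 0))) ⊆ Finset.univ.image fun j => f i (.inr j) := by
        intro v hv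
        simp only [Finset.mem_filter, Finset.mem_image, Finset.mem_univ, true_and] at hv ⊢
        obtain ⟨⟨p, rfl⟩, h2⟩ := hv
        rw [hg _ _ (hmem p.1 _)] at h2
        have := hinj' (a₁ := (p.1, .inl 0)) (a₂ := (i, .inl 0)) h2
        simp only [Prod.mk.injEq, and_true] at this
        exact ⟨p.2, by rw [this]⟩
      exact (Finset.card_le_card hsub).trans (Finset.card_image_le.trans (by simp))
  · rintro ⟨hn, C, L, g, -, -, hC, hL, ha⟩
    have huniv : C ∪ L = Finset.univ := by
      rw [← Finset.card_eq_iff_eq_univ, Finset.card_union_of_disjoint ha.disj, hC, hL, hn]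
      ring
    -- The loads are at most `s` and add up to `s` times the number of centers, so each equals `s`.
    have hfib : ∀ z ∈ C, (L.filter (g · = z)).card = s := by
      refine (Finset.sum_eq_sum_iff_of_le ha.load).1 ?_
      rw [← Finset.card_eq_sum_card_fiberwise ha.mem, hL, Finset.sum_const, hC, smul_eq_mul,
        mul_comm]
    let e : Fin k ≃ C := (C.equivFinOfCardEq hC).symm
    refine ⟨fun i => {v | v = e i ∨ v ∈ L ∧ g v = e i}, ?_, ?_, ?_⟩
    · intro i j hij
      have hne : (e i : V) ≠ e j := fun h => hij (e.injective (Subtype.ext h))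
      rw [Set.disjoint_left]
      rintro v (h | h) (h' | h')
      · exact hne (h.symm.trans h')
      · exact Finset.disjoint_left.1 ha.disj (e i).2 (h ▸ h'.1)
      · exact Finset.disjoint_left.1 ha.disj (e j).2 (h' ▸ h.1)
      · exact hne (h.2.symm.trans h'.2)
    · rw [Set.eq_univ_iff_forall]
      intro v
      rw [Set.mem_iUnion]
      have hv : v ∈ C ∪ L := huniv ▸ Finset.mem_univ v
      rcases Finset.mem_union.1 hv with hv | hv
      · exact ⟨e.symm ⟨v, hv⟩, Or.inl (by simp)⟩
      · exact ⟨e.symm ⟨g v, ha.mem v hv⟩, Or.inr ⟨hv, by simp⟩⟩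
    · intro i
      let ε := ((L.filter (g · = e i)).equivFinOfCardEq (hfib _ (e i).2)).symm
      have hε : ∀ j, (ε j : V) ∈ L ∧ g (ε j) = e i := fun j =>
        Finset.mem_filter.1 (ε j).2
      have hadj : ∀ j, G.Adj (ε j) (e i) := fun j => by
        have := ha.adj _ (hε j).1
        rwa [(hε j).2] at this
      refine ⟨⟨⟨Sum.elim (fun _ => ⟨e i, Or.inl rfl⟩) (fun j => ⟨ε j, Or.inr (hε j)⟩), ?_⟩, ?_⟩⟩
      · rintro (a | a) (b | b) hab
        · simp [starK] at hab
        · exact (hadj b).symm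
        · exact hadj a
        · simp [starK] at hab
      · have hne : ∀ j, (ε j : V) ≠ e i := fun j => (hadj j).ne
        rintro (a | a) (b | b) hab
        · rw [Subsingleton.elim a b]
        · exact absurd (Subtype.ext_iff.1 hab).symm (hne b)
        · exact absurd (Subtype.ext_iff.1 hab) (hne a)
        · have hab' := Subtype.ext_iff.1 hab
          have : ε a = ε b := Subtype.ext hab'
          rw [ε.injective this]

end StarCover

namespace WordRAM

/-! ### Reading updated states -/

@[simp] theorem Store.setV_v (σ : Store) (x y : Var) (w : ℕ) :
    (σ.setV x w).v y = if y = x then w else σ.v y := Function.update_apply ..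

@[simp] theorem Store.setV_a (σ : Store) (x : Var) (w : ℕ) : (σ.setV x w).a = σ.a := rfl

@[simp] theorem Store.setV_inp (σ : Store) (x : Var) (w : ℕ) : (σ.setV x w).inp = σ.inp := rfl

@[simp] theorem Store.setA_v (σ : Store) (A : Arr) (i w : ℕ) : (σ.setA A i w).v = σ.v := rfl

@[simp] theorem Store.setA_inp (σ : Store) (A : Arr) (i w : ℕ) : (σ.setA A i w).inp = σ.inp := rfl

@[simp] theorem Store.setA_a (σ : Store) (A A' : Arr) (i i' w : ℕ) :
    (σ.setA A i w).a A' i' = if A' = A ∧ i' = i then w else σ.a A' i' := by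
  simp only [setA, Function.update_apply]
  by_cases h : A' = A
  · subst h; simp [Function.update_apply]
  · simp [h]

/-! ## Building the cotree -/

namespace StarProg

open WordRAM.Cmd WordRAM.Expr

/-- `d := ` union or join (as `o` says) of the cotrees at `a` and `b`. -/
def mergeC (o a b d : Var) : Cmd :=
  branch (var a) (lit 0) (set d (var b)) <| branch (var b) (lit 0) (set d (var a)) <|
    put .K (var .cnt) (var o) ;; put .L (var .cnt) (var a) ;; put .R (var .cnt) (var b) ;;
    set d (var .cnt) ;; set .cnt (add (var .cnt) (lit 1))

/-- `d := ` a new leaf. -/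
def leafC (v : Expr) (d : Var) : Cmd :=
  put .K (var .cnt) (lit 0) ;; put .L (var .cnt) v ;; set d (var .cnt) ;;
    set .cnt (add (var .cnt) (lit 1))

/-- `r := ` the label of the root of the cotree at `a`. -/
def opC (a r : Var) : Cmd := set r (lit 1) ;; branch (lit 2) (get .K (var a)) (set r (lit 2)) skip

/-- `d := ` the cotree that arises by attaching the vertex `x` to the parts at `f` and `e`. -/
def attachC (o f e d : Var) : Cmd :=
  leafC (var .x) .t ;;
  branch (var o) (lit 1) (set .oc (lit 2) ;; set .p (var e) ;; set .q (var f))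
    (set .oc (lit 1) ;; set .p (var f) ;; set .q (var e)) ;;
  mergeC .oc .q .t .t ;; mergeC o .p .t d

/-- Prepares the result `f`, `e`, `d` at the child `a` for its parent with label `o`. -/
def adjustC (a o f e d : Var) : Cmd :=
  opC a .r ;; (branch (var f) (lit 0) skip <| branch (var e) (lit 0) skip <|
    branch (add (sub (var .r) (var o)) (sub (var o) (var .r))) (lit 0) skip <|
      attachC .r f e d ;; set f (lit 0) ;; set e (lit 0))

/-- Loads the two children of node `u` and their results. -/
def loadC : Cmd :=
  set .o (get .K (var .u)) ;; set .a (get .L (var .u)) ;; set .b (get .R (var .u)) ;;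
  set .fa (get .F (var .a)) ;; set .ea (get .E (var .a)) ;; set .da (get .D (var .a)) ;;
  set .fb (get .F (var .b)) ;; set .eb (get .E (var .b)) ;; set .db (get .D (var .b))

/-- Stores the result at node `u`. -/
def saveC : Cmd :=
  put .F (var .u) (var .f) ;; put .E (var .u) (var .e) ;; put .D (var .u) (var .d)

/-- Combines the results at two children. -/
def combineC : Cmd :=
  mergeC .o .fa .fb .f ;; mergeC .o .ea .eb .e ;; mergeC .o .da .db .d ;;
  branch (var .d) (lit 0) skip
    (mergeC .o .f .e .q ;; mergeC .o .d .q .d ;; set .f (lit 0) ;; set .e (lit 0))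

/-- The result of the insertion of `x` at a leaf. -/
def visitLeafC : Cmd :=
  leafC (get .L (var .u)) .t ;; set .f (lit 0) ;; set .e (lit 0) ;; set .d (lit 0) ;;
  branch (lit 1) (inp (add (mul (var .x) (var .n)) (get .L (var .u)))) (set .f (var .t))
    (set .e (var .t)) ;; saveC

/-- Computes the result of the insertion of `x` at node `u`. -/
def visitC : Cmd :=
  branch (get .K (var .u)) (lit 0) visitLeafC <|
    loadC ;; adjustC .a .o .fa .ea .da ;; adjustC .b .o .fb .eb .db ;; combineC ;; saveC

/-- Marks the nodes of the current cotree. -/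
def markC : Cmd :=
  set .cnt0 (var .cnt) ;; put .M (var .root) (lit 1) ;;
  loop .j .nb (set .u (sub (sub (var .cnt0) (lit 1)) (var .j)) ;;
    branch (var .st) (var .u) (branch (lit 1) (get .M (var .u)) (branch (lit 1) (get .K (var .u))
      (put .M (get .L (var .u)) (lit 1) ;; put .M (get .R (var .u)) (lit 1)) skip) skip) skip)

/-- Runs `c` if the node `u` of the current cotree is marked, and goes to the next node. -/
def stepC (c : Cmd) : Cmd :=
  branch (var .cnt0) (var .u) skip
    (branch (lit 1) (get .M (var .u)) c skip ;; set .u (add (var .u) (lit 1)))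

/-- Runs `c` for all marked nodes of the current cotree. -/
def forMarkedC (c : Cmd) : Cmd := set .u (var .st) ;; loop .j .nb (stepC c)

/-- Computes the root of the new cotree. -/
def finishC : Cmd :=
  branch (var .root) (lit 0) (leafC (var .x) .root) <|
    set .f (get .F (var .root)) ;; set .e (get .E (var .root)) ;; set .d (get .D (var .root)) ;;
    branch (var .d) (lit 0) (opC .root .o ;; attachC .o .f .e .root) (set .root (var .d))

/-- Inserts the vertex `x`. -/
def insertC : Cmd := markC ;; forMarkedC visitC ;; finishC ;; set .st (var .cnt0)

/-- Node numbers start at `1`, because `0` stands for the empty cotree. -/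
def buildC : Cmd := set .cnt (lit 1) ;; set .st (lit 1) ;; loop .x .n insertC

/-! ## Correctness of the construction -/

/-- The remaining value `0` of the array `K` marks leaves. -/
def opCode (o : Bool) : ℕ := if o then 2 else 1

variable {n : ℕ}

/-- The cotree is stored at node `u`; all nodes are at least `lo`. -/
def Enc (σ : Store) (lo : ℕ) : Cotree (Fin n) → ℕ → Prop
  | .leaf v, u => lo ≤ u ∧ σ.a .K u = 0 ∧ σ.a .L u = v
  | .node o a b, u => lo ≤ u ∧ σ.a .K u = opCode o ∧ σ.a .L u < u ∧ σ.a .R u < u ∧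
      Enc σ lo a (σ.a .L u) ∧ Enc σ lo b (σ.a .R u)

/-- An optional cotree is stored at `u`, where `0` represents `none`. -/
def OEnc (σ : Store) (lo : ℕ) : Option (Cotree (Fin n)) → ℕ → Prop
  | none, u => u = 0
  | some t, u => Enc σ lo t u ∧ u < σ.v .cnt

theorem Enc.le {σ : Store} {lo : ℕ} {t : Cotree (Fin n)} {u : ℕ} (h : Enc σ lo t u) : lo ≤ u := by
  cases t <;> exact h.1

/-- These arrays hold the stored cotrees; changing marks, results or tables leaves every encoding
intact. -/
def Arr.IsHeap (A : Arr) : Prop := A = .K ∨ A = .L ∨ A = .R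

/-- Children have smaller numbers than their parent, so cells beyond `u` are irrelevant. In
particular, a stored cotree survives the creation of further nodes. -/
theorem Enc.congr {σ τ : Store} {lo : ℕ} {t : Cotree (Fin n)} {u : ℕ} (h : Enc σ lo t u)
    (hst : ∀ A, Arr.IsHeap A → ∀ i ≤ u, τ.a A i = σ.a A i) : Enc τ lo t u := by
  induction t generalizing u with
  | leaf v =>
    simp only [Enc] at h ⊢
    rw [hst .K (by simp [Arr.IsHeap]) u le_rfl, hst .L (by simp [Arr.IsHeap]) u le_rfl]
    exact h
  | node o a b iha ihb =>
    simp only [Enc] at h ⊢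
    rw [hst .K (by simp [Arr.IsHeap]) u le_rfl, hst .L (by simp [Arr.IsHeap]) u le_rfl,
      hst .R (by simp [Arr.IsHeap]) u le_rfl]
    exact ⟨h.1, h.2.1, h.2.2.1, h.2.2.2.1,
      iha h.2.2.2.2.1 fun A hA i hi => hst A hA i (by omega),
      ihb h.2.2.2.2.2 fun A hA i hi => hst A hA i (by omega)⟩

/-- At most `e` new nodes have been created, and among the variables only those in `ws` have been
changed. -/
structure Grow (e : ℕ) (ws : List Var) (σ τ : Store) : Prop where
  le : σ.v .cnt ≤ τ.v .cnt
  le_add : τ.v .cnt ≤ σ.v .cnt + e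
  arr : ∀ A i, (i < σ.v .cnt ∨ ¬ Arr.IsHeap A) → τ.a A i = σ.a A i
  var : ∀ y, y ∉ ws → y ≠ .cnt → τ.v y = σ.v y
  inp : τ.inp = σ.inp

theorem Grow.trans {e e' : ℕ} {ws ws' : List Var} {σ τ υ : Store} (h : Grow e ws σ τ)
    (h' : Grow e' ws' τ υ) : Grow (e + e') (ws ++ ws') σ υ where
  le := h.le.trans h'.le
  le_add := by have := h.le_add; have := h'.le_add; omega
  arr A i hi := by
    rw [h'.arr A i (hi.imp_left fun h1 => h1.trans_le h.le), h.arr A i hi]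
  var y hy hc := by
    rw [List.mem_append, not_or] at hy
    rw [h'.var y hy.2 hc, h.var y hy.1 hc]
  inp := h'.inp.trans h.inp

theorem Grow.mono {e e' : ℕ} {ws ws' : List Var} {σ τ : Store} (h : Grow e ws σ τ) (he : e ≤ e')
    (hws : ws ⊆ ws') : Grow e' ws' σ τ :=
  ⟨h.le, h.le_add.trans (by omega), h.arr, fun y hy => h.var y fun h => hy (hws h), h.inp⟩

theorem Grow.setV (σ : Store) {y : Var} (hy : y ≠ .cnt) (w : ℕ) : Grow 0 [y] σ (σ.setV y w) :=
  ⟨by simp [hy.symm], by simp [hy.symm], fun _ _ _ => rfl,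
    fun z hz _ => by simpa using fun h => absurd h (by simpa using hz), rfl⟩

theorem Enc.grow {e : ℕ} {ws : List Var} {σ τ : Store} (g : Grow e ws σ τ) {lo : ℕ}
    {t : Cotree (Fin n)} {u : ℕ} (h : Enc σ lo t u) (hu : u < σ.v .cnt) : Enc τ lo t u :=
  h.congr fun _ _ _ hi => g.arr _ _ (Or.inl (by omega))

theorem OEnc.grow {e : ℕ} {ws : List Var} {σ τ : Store} (g : Grow e ws σ τ) {lo : ℕ}
    {t : Option (Cotree (Fin n))} {u : ℕ} (h : OEnc σ lo t u) : OEnc τ lo t u := by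
  cases t with
  | none => exact h
  | some t => exact ⟨h.1.grow g h.2, h.2.trans_le g.le⟩

theorem OEnc.eq_zero_iff {σ : Store} {lo : ℕ} (hlo : 1 ≤ lo) {t : Option (Cotree (Fin n))} {u : ℕ}
    (h : OEnc σ lo t u) : u = 0 ↔ t = none := by
  cases t with
  | none => exact iff_of_true h rfl
  | some t => simpa using fun h0 : u = 0 => by have := h.1.le; omega

theorem mergeC_spec {σ : Store} {o a b d : Var} {lo : ℕ} {O : Bool}
    {ta tb : Option (Cotree (Fin n))} (hd : d ≠ .cnt) (hlo : 1 ≤ lo) (hcnt : lo ≤ σ.v .cnt)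
    (ho : σ.v o = opCode O) (ha : OEnc σ lo ta (σ.v a)) (hb : OEnc σ lo tb (σ.v b)) :
    Grow 1 [d] σ ((mergeC o a b d).ev σ) ∧
      OEnc ((mergeC o a b d).ev σ) lo (Cotree.merge O ta tb) (((mergeC o a b d).ev σ).v d) := by
  have za := ha.eq_zero_iff hlo
  have zb := hb.eq_zero_iff hlo
  cases ta with
  | none =>
    have h0 : σ.v a = 0 := ha
    have hev : (mergeC o a b d).ev σ = σ.setV d (σ.v b) := by
      simp [mergeC, Cmd.ev, Expr.val, h0]
    have g := Grow.setV σ hd (σ.v b)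
    rw [hev]
    exact ⟨g.mono (by omega) (List.Subset.refl _), by simpa [Cotree.merge] using hb.grow g⟩
  | some ta =>
    have h0 : σ.v a ≠ 0 := by simpa using za
    cases tb with
    | none =>
      have h1 : σ.v b = 0 := hb
      have hev : (mergeC o a b d).ev σ = σ.setV d (σ.v a) := by
        simp [mergeC, Cmd.ev, Expr.val, h0, h1]
      have g := Grow.setV σ hd (σ.v a)
      rw [hev]
      exact ⟨g.mono (by omega) (List.Subset.refl _), by simpa [Cotree.merge] using ha.grow g⟩
    | some tb =>
      have h1 : σ.v b ≠ 0 := by simpa using zb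
      have hev : (mergeC o a b d).ev σ = ((((σ.setA .K (σ.v .cnt) (σ.v o)).setA .L (σ.v .cnt)
          (σ.v a)).setA .R (σ.v .cnt) (σ.v b)).setV d (σ.v .cnt)).setV .cnt (σ.v .cnt + 1) := by
        simp [mergeC, Cmd.ev, Expr.val, h0, h1, hd.symm]
      rw [hev]
      have g : Grow 1 [d] σ (((((σ.setA .K (σ.v .cnt) (σ.v o)).setA .L (σ.v .cnt)
          (σ.v a)).setA .R (σ.v .cnt) (σ.v b)).setV d (σ.v .cnt)).setV .cnt (σ.v .cnt + 1)) := by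
        refine ⟨by simp, by simp, fun A i hi => ?_, fun y hy hc => ?_, rfl⟩
        · have : ¬ (Arr.IsHeap A ∧ i = σ.v .cnt) := by
            rintro ⟨h1, h2⟩
            rcases hi with hi | hi
            · omega
            · exact hi h1
          simp only [Arr.IsHeap] at this
          simp only [Store.setV_a, Store.setA_a]
          rw [if_neg (by tauto), if_neg (by tauto), if_neg (by tauto)]
        · have : y ≠ d := by simpa using hy
          simp [hc, this]
      have ha' := ha.grow g
      have hb' := hb.grow g
      refine ⟨g, ⟨by simpa [hd] using hcnt, by simp [hd, ho], ?_, ?_, ?_, ?_⟩, by simp [hd]⟩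
      · simpa [hd] using ha.2
      · simpa [hd] using hb.2
      · simpa [hd] using ha'.1
      · simpa [hd] using hb'.1

theorem leafC_spec {σ : Store} {d : Var} {lo : ℕ} {e : Expr} {v : Fin n} (hd : d ≠ .cnt)
    (hcnt : lo ≤ σ.v .cnt) (he : e.val (σ.setA .K (σ.v .cnt) 0) = v) :
    Grow 1 [d] σ ((leafC e d).ev σ) ∧
      OEnc ((leafC e d).ev σ) lo (some (Cotree.leaf v)) (((leafC e d).ev σ).v d) := by
  have hev : (leafC e d).ev σ = (((σ.setA .K (σ.v .cnt) 0).setA .L (σ.v .cnt) v).setV d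
      (σ.v .cnt)).setV .cnt (σ.v .cnt + 1) := by
    simp [leafC, Cmd.ev, Expr.val, hd.symm, he]
  rw [hev]
  refine ⟨⟨by simp, by simp, fun A i hi => ?_, fun y hy hc => ?_, rfl⟩, ?_⟩
  · have : ¬ (Arr.IsHeap A ∧ i = σ.v .cnt) := by
      rintro ⟨h1, h2⟩
      rcases hi with hi | hi
      · omega
      · exact hi h1
    simp only [Arr.IsHeap] at this
    simp only [Store.setV_a, Store.setA_a]
    rw [if_neg (by tauto), if_neg (by tauto)]
  · have : y ≠ d := by simpa using hy
    simp [hc, this]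
  · simp [OEnc, Enc, hd, hcnt]

theorem opC_spec {σ : Store} {a r : Var} {lo : ℕ} {t : Cotree (Fin n)} (hra : a ≠ r) (hr : r ≠ .cnt)
    (h : Enc σ lo t (σ.v a)) :
    Grow 0 [r] σ ((opC a r).ev σ) ∧ ((opC a r).ev σ).v r = opCode t.op := by
  have hev : (opC a r).ev σ = if 2 ≤ σ.a .K (σ.v a) then (σ.setV r 1).setV r 2 else σ.setV r 1 := by
    simp [opC, Cmd.ev, Expr.val, hra]
  rw [hev]
  have hk : σ.a .K (σ.v a) = 0 ∧ t.op = false ∨ σ.a .K (σ.v a) = opCode t.op := by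
    cases t with
    | leaf v => exact Or.inl ⟨h.2.1, rfl⟩
    | node o a b => exact Or.inr h.2.1
  constructor
  · split_ifs
    · exact ((Grow.setV σ hr 1).trans (Grow.setV _ hr 2)).mono le_rfl (by simp)
    · exact Grow.setV σ hr 1
  · rcases hk with ⟨h1, h2⟩ | h1
    · simp [h1, h2, opCode]
    · rw [h1]
      cases t.op <;> simp [opCode]

/-- Three new nodes suffice: the leaf `x` and one node for each of the two merges. The exclusions
keep the scratch variables from overwriting the arguments. -/
theorem attachC_spec {σ : Store} {o f e d : Var} {lo : ℕ} {O : Bool} {x : Fin n}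
    {P : Bool → Option (Cotree (Fin n))} (ho : o ∉ [Var.t, .oc, .p, .q, .cnt])
    (hf : f ∉ [Var.t, .oc, .p, .q, .cnt]) (he : e ∉ [Var.t, .oc, .p, .q, .cnt])
    (hd : d ≠ .cnt) (hlo : 1 ≤ lo) (hcnt : lo ≤ σ.v .cnt) (hx : σ.v .x = x)
    (hO : σ.v o = opCode O) (hF : OEnc σ lo (P true) (σ.v f)) (hE : OEnc σ lo (P false) (σ.v e)) :
    Grow 3 [.t, .oc, .p, .q, d] σ ((attachC o f e d).ev σ) ∧
      OEnc ((attachC o f e d).ev σ) lo (Cotree.attach x O P) (((attachC o f e d).ev σ).v d) := by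
  simp only [List.mem_cons, List.not_mem_nil, or_false, not_or] at ho hf he
  simp only [attachC, Cmd.ev]
  obtain ⟨g₁, t₁⟩ := leafC_spec (σ := σ) (d := .t) (e := var .x) (v := x) (by decide) hcnt
    (by simp [Expr.val, hx])
  set σ₁ := (leafC (var .x) .t).ev σ
  have hF₁ : OEnc σ₁ lo (P true) (σ₁.v f) := by
    rw [g₁.var f (by simpa using hf.1) hf.2.2.2.2]; exact hF.grow g₁
  have hE₁ : OEnc σ₁ lo (P false) (σ₁.v e) := by
    rw [g₁.var e (by simpa using he.1) he.2.2.2.2]; exact hE.grow g₁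
  have hO₁ : σ₁.v o = opCode O := by rw [g₁.var o (by simpa using ho.1) ho.2.2.2.2]; exact hO
  obtain ⟨σ₂, hσ₂, g₂, p₂, q₂, oc₂⟩ : ∃ σ₂, (if Expr.val σ₁ (var o) ≤ Expr.val σ₁ (lit 1) then
      ((((σ₁.setV .oc 2).setV .p ((σ₁.setV .oc 2).v e)).setV .q
        (((σ₁.setV .oc 2).setV .p ((σ₁.setV .oc 2).v e)).v f)))
      else ((((σ₁.setV .oc 1).setV .p ((σ₁.setV .oc 1).v f)).setV .q
        (((σ₁.setV .oc 1).setV .p ((σ₁.setV .oc 1).v f)).v e)))) = σ₂ ∧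
      Grow 0 [.oc, .p, .q] σ₁ σ₂ ∧ OEnc σ₁ lo (P O) (σ₂.v .p) ∧ OEnc σ₁ lo (P (!O)) (σ₂.v .q) ∧
      σ₂.v .oc = opCode (!O) := by
    refine ⟨_, rfl, ?_, ?_⟩
    · split_ifs <;> exact (((Grow.setV _ (by decide) _).trans (Grow.setV _ (by decide) _)).trans
        (Grow.setV _ (by decide) _))
    · simp only [Expr.val, hO₁]
      cases O <;> simp [opCode, hf, he, hF₁, hE₁]
  simp only [Expr.val] at hσ₂ ⊢
  rw [hσ₂]
  have tt₂ : σ₂.v .t = σ₁.v .t := g₂.var _ (by decide) (by decide)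
  obtain ⟨g₃, m₃⟩ := mergeC_spec (σ := σ₂) (o := .oc) (a := .q) (b := .t) (d := .t) (by decide) hlo
    (hcnt.trans (g₁.le.trans g₂.le)) oc₂ (q₂.grow g₂) (by rw [tt₂]; exact t₁.grow g₂)
  set σ₃ := (mergeC .oc .q .t .t).ev σ₂
  have p₃ : OEnc σ₃ lo (P O) (σ₃.v .p) := by
    rw [g₃.var .p (by decide) (by decide)]; exact (p₂.grow g₂).grow g₃
  have ho₃ : σ₃.v o = opCode O := by
    rw [g₃.var o (by simpa using ho.1) ho.2.2.2.2, g₂.var o (by simp; tauto) ho.2.2.2.2, hO₁]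
  obtain ⟨g₄, m₄⟩ := mergeC_spec (σ := σ₃) (o := o) (a := .p) (b := .t) (d := d) hd hlo
    (hcnt.trans (g₁.le.trans (g₂.le.trans g₃.le))) ho₃ p₃ m₃
  exact ⟨(((g₁.trans g₂).trans g₃).trans g₄).mono le_rfl (by intro y; simp; tauto), m₄⟩

/-- The result of an insertion is stored at `f`, `e` and `d`. -/
structure InsEnc (σ : Store) (lo : ℕ) (r : Cotree.Ins (Fin n)) (f e d : ℕ) : Prop where
  f : OEnc σ lo (r.P true) f
  e : OEnc σ lo (r.P false) e
  d : OEnc σ lo r.D d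

theorem InsEnc.grow {k : ℕ} {ws : List Var} {σ τ : Store} (g : Grow k ws σ τ) {lo : ℕ}
    {r : Cotree.Ins (Fin n)} {f e d : ℕ} (h : InsEnc σ lo r f e d) : InsEnc τ lo r f e d :=
  ⟨h.f.grow g, h.e.grow g, h.d.grow g⟩

/-- Two bounds occur because two generations of nodes coexist: the old cotree lies from `lo'` on,
and the results are made of nodes from `lo` on. -/
theorem adjustC_spec {σ : Store} {a o f e d : Var} {lo lo' : ℕ} {O : Bool} {x : Fin n}
    {t : Cotree (Fin n)} {r : Cotree.Ins (Fin n)} (ha : a ≠ .r)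
    (ho : o ∉ [Var.t, .oc, .p, .q, .r, .cnt])
    (hf : f ∉ [Var.t, .oc, .p, .q, .r, .cnt]) (he : e ∉ [Var.t, .oc, .p, .q, .r, .cnt])
    (hd : d ∉ [f, e, .r, .cnt]) (hfe : f ≠ e) (hlo : 1 ≤ lo) (hcnt : lo ≤ σ.v .cnt)
    (hx : σ.v .x = x) (hO : σ.v o = opCode O) (ht : Enc σ lo' t (σ.v a))
    (hr : InsEnc σ lo r (σ.v f) (σ.v e) (σ.v d)) :
    Grow 3 [.r, .t, .oc, .p, .q, d, f, e] σ ((adjustC a o f e d).ev σ) ∧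
      InsEnc ((adjustC a o f e d).ev σ) lo (Cotree.adjust x O t r)
        (((adjustC a o f e d).ev σ).v f) (((adjustC a o f e d).ev σ).v e)
        (((adjustC a o f e d).ev σ).v d) := by
  simp only [List.mem_cons, List.not_mem_nil, or_false, not_or] at ho hf he hd
  simp only [adjustC, Cmd.ev]
  obtain ⟨g₁, r₁⟩ := opC_spec (σ := σ) (a := a) (r := .r) ha (by decide) ht
  set σ₁ := (opC a .r).ev σ
  have vf : σ₁.v f = σ.v f := g₁.var _ (by simp; tauto) (by tauto)
  have ve : σ₁.v e = σ.v e := g₁.var _ (by simp; tauto) (by tauto)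
  have vd : σ₁.v d = σ.v d := g₁.var _ (by simp; tauto) (by tauto)
  have vo : σ₁.v o = opCode O := (g₁.var _ (by simp; tauto) (by tauto)).trans hO
  have hr₁ : InsEnc σ₁ lo r (σ₁.v f) (σ₁.v e) (σ₁.v d) := by rw [vf, ve, vd]; exact hr.grow g₁
  have zf := hr₁.f.eq_zero_iff hlo
  have ze := hr₁.e.eq_zero_iff hlo
  have hsub : ([.r] : List Var) ⊆ [.r, .t, .oc, .p, .q, d, f, e] := by simp
  have hid : ∀ h : ¬ ((r.P true).isSome ∧ (r.P false).isSome ∧ t.op ≠ O),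
      Grow 3 [.r, .t, .oc, .p, .q, d, f, e] σ σ₁ ∧
      InsEnc σ₁ lo (Cotree.adjust x O t r) (σ₁.v f) (σ₁.v e) (σ₁.v d) := fun h => by
    rw [Cotree.adjust, if_neg h]
    exact ⟨g₁.mono (by omega) hsub, hr₁⟩
  simp only [Expr.val, Nat.le_zero]
  split_ifs with h1 h2 h3
  · exact hid (by simp [zf.1 h1])
  · exact hid (by simp [ze.1 h2])
  · refine hid ?_
    rw [r₁, vo] at h3
    rintro ⟨-, -, h⟩
    apply h
    cases hto : t.op <;> cases O <;> simp_all [opCode]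
  · obtain ⟨g₂, m₂⟩ := attachC_spec (σ := σ₁) (o := .r) (f := f) (e := e) (d := d) (x := x)
      (by decide) (by simp; tauto) (by simp; tauto) (by tauto) hlo (hcnt.trans g₁.le)
      ((g₁.var .x (by decide) (by decide)).trans hx) r₁ hr₁.f hr₁.e
    have hc : (r.P true).isSome ∧ (r.P false).isSome ∧ t.op ≠ O := by
      refine ⟨Option.isSome_iff_ne_none.2 (mt zf.2 h1), Option.isSome_iff_ne_none.2 (mt ze.2 h2),
        fun h => h3 ?_⟩
      rw [r₁, vo, h]
      simp
    rw [Cotree.adjust, if_pos hc]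
    set σ₂ := (attachC .r f e d).ev σ₁
    have g₃ := (Grow.setV σ₂ (y := f) (by tauto) 0).trans
      (Grow.setV (σ₂.setV f 0) (y := e) (by tauto) 0)
    refine ⟨((g₁.trans g₂).trans g₃).mono le_rfl (by intro y; simp), ?_, ?_, ?_⟩
    · simp [OEnc, hfe]
    · simp [OEnc]
    · have := m₂.grow g₃
      simpa [hd] using this

/-- The number `5` counts the merges: three for the parts and the finished trees, two more if one
child is finished. -/
theorem combineC_spec {σ : Store} {lo : ℕ} {O : Bool} {r₁ r₂ : Cotree.Ins (Fin n)}
    (hlo : 1 ≤ lo) (hcnt : lo ≤ σ.v .cnt) (hO : σ.v .o = opCode O)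
    (h₁ : InsEnc σ lo r₁ (σ.v .fa) (σ.v .ea) (σ.v .da))
    (h₂ : InsEnc σ lo r₂ (σ.v .fb) (σ.v .eb) (σ.v .db)) :
    Grow 5 [.f, .e, .d, .q] σ (combineC.ev σ) ∧
      InsEnc (combineC.ev σ) lo (Cotree.combine O r₁ r₂) ((combineC.ev σ).v .f)
        ((combineC.ev σ).v .e) ((combineC.ev σ).v .d) := by
  simp only [combineC, Cmd.ev]
  obtain ⟨g₁, m₁⟩ := mergeC_spec (σ := σ) (d := .f) (by decide) hlo hcnt hO h₁.f h₂.f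
  set σ₁ := (mergeC .o .fa .fb .f).ev σ
  have c₁ := hcnt.trans g₁.le
  obtain ⟨g₂, m₂⟩ := mergeC_spec (σ := σ₁) (o := .o) (a := .ea) (b := .eb) (d := .e)
    (by decide) hlo c₁ ((g₁.var .o (by decide) (by decide)).trans hO)
    (by rw [g₁.var .ea (by decide) (by decide)]; exact h₁.e.grow g₁)
    (by rw [g₁.var .eb (by decide) (by decide)]; exact h₂.e.grow g₁)
  set σ₂ := (mergeC .o .ea .eb .e).ev σ₁
  have g12 := g₁.trans g₂
  have c₂ := hcnt.trans g12.le
  obtain ⟨g₃, m₃⟩ := mergeC_spec (σ := σ₂) (o := .o) (a := .da) (b := .db) (d := .d)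
    (by decide) hlo c₂ ((g12.var .o (by decide) (by decide)).trans hO)
    (by rw [g12.var .da (by decide) (by decide)]; exact h₁.d.grow g12)
    (by rw [g12.var .db (by decide) (by decide)]; exact h₂.d.grow g12)
  set σ₃ := (mergeC .o .da .db .d).ev σ₂
  have g13 := g12.trans g₃
  have c₃ := hcnt.trans g13.le
  have mf : OEnc σ₃ lo (Cotree.merge O (r₁.P true) (r₂.P true)) (σ₃.v .f) := by
    rw [(g₂.trans g₃).var .f (by decide) (by decide)]; exact m₁.grow (g₂.trans g₃)
  have me : OEnc σ₃ lo (Cotree.merge O (r₁.P false) (r₂.P false)) (σ₃.v .e) := by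
    rw [g₃.var .e (by decide) (by decide)]; exact m₂.grow g₃
  have zd := m₃.eq_zero_iff hlo
  simp only [Expr.val, Nat.le_zero]
  split_ifs with h
  · rw [Cotree.combine, if_neg (by simp [zd.1 h])]
    exact ⟨g13.mono (by omega) (by decide), mf, me, by simpa [OEnc] using h⟩
  · rw [Cotree.combine, if_pos (Option.isSome_iff_ne_none.2 (mt zd.2 h))]
    have o₃ : σ₃.v .o = opCode O := (g13.var .o (by decide) (by decide)).trans hO
    obtain ⟨g₄, m₄⟩ := mergeC_spec (σ := σ₃) (o := .o) (a := .f) (b := .e) (d := .q)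
      (by decide) hlo c₃ o₃ mf me
    set σ₄ := (mergeC .o .f .e .q).ev σ₃
    obtain ⟨g₅, m₅⟩ := mergeC_spec (σ := σ₄) (o := .o) (a := .d) (b := .q) (d := .d)
      (by decide) hlo (c₃.trans g₄.le) ((g₄.var .o (by decide) (by decide)).trans o₃)
      (by rw [g₄.var .d (by decide) (by decide)]; exact m₃.grow g₄) m₄
    set σ₅ := (mergeC .o .d .q .d).ev σ₄
    have g₆ := (Grow.setV σ₅ (y := .f) (by decide) 0).trans
      (Grow.setV (σ₅.setV .f 0) (y := .e) (by decide) 0)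
    refine ⟨(((g13.trans g₄).trans g₅).trans g₆).mono le_rfl (by decide), ?_, ?_, ?_⟩
    · simp [OEnc]
    · simp [OEnc]
    · simpa using m₅.grow g₆

/-- The arrays that hold the results of an insertion. -/
def Arr.IsRes (A : Arr) : Prop := A = .F ∨ A = .E ∨ A = .D

/-- The variables that are used in a visit of a node. -/
def visitVars : List Var :=
  [.t, .oc, .p, .q, .r, .o, .a, .b, .fa, .ea, .da, .fb, .eb, .db, .f, .e, .d]

theorem loadC_spec (σ : Store) : Grow 0 visitVars σ (loadC.ev σ) ∧
    (loadC.ev σ).v .o = σ.a .K (σ.v .u) ∧ (loadC.ev σ).v .a = σ.a .L (σ.v .u) ∧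
    (loadC.ev σ).v .b = σ.a .R (σ.v .u) ∧
    (loadC.ev σ).v .fa = σ.a .F (σ.a .L (σ.v .u)) ∧ (loadC.ev σ).v .ea = σ.a .E (σ.a .L (σ.v .u)) ∧
    (loadC.ev σ).v .da = σ.a .D (σ.a .L (σ.v .u)) ∧
    (loadC.ev σ).v .fb = σ.a .F (σ.a .R (σ.v .u)) ∧ (loadC.ev σ).v .eb = σ.a .E (σ.a .R (σ.v .u)) ∧
    (loadC.ev σ).v .db = σ.a .D (σ.a .R (σ.v .u)) := by
  refine ⟨⟨?_, ?_, ?_, ?_, ?_⟩, ?_⟩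
  · simp [loadC, Cmd.ev, Expr.val]
  · simp [loadC, Cmd.ev, Expr.val]
  · intro A i _
    simp [loadC, Cmd.ev]
  · intro y hy _
    simp only [visitVars, List.mem_cons, List.not_mem_nil, or_false, not_or] at hy
    simp [loadC, Cmd.ev, hy]
  · simp [loadC, Cmd.ev]
  · simp [loadC, Cmd.ev, Expr.val]

theorem Grow.ite {e : ℕ} {ws : List Var} {σ τ τ' : Store} {P : Prop} [Decidable P]
    (h : Grow e ws σ τ) (h' : Grow e ws σ τ') : Grow e ws σ (if P then τ else τ') := by
  split_ifs
  exacts [h, h']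

/-- The effect of the computation of a result before it is stored. -/
theorem visitC_spec_aux {σ : Store} {lo lo' : ℕ} {x : Fin n} {adj : Fin n → Bool}
    {t : Cotree (Fin n)} (hlo : 1 ≤ lo) (hcnt : lo ≤ σ.v .cnt) (hx : σ.v .x = x)
    (hn : σ.v .n = n) (hadj : ∀ v : Fin n, adj v = true ↔ 1 ≤ σ.inp (x * n + v))
    (hu : σ.v .u < σ.v .cnt) (ht : Enc σ lo' t (σ.v .u))
    (hch : ∀ o a b, t = .node o a b →
      InsEnc σ lo (Cotree.ins x adj a) (σ.a .F (σ.a .L (σ.v .u))) (σ.a .E (σ.a .L (σ.v .u)))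
        (σ.a .D (σ.a .L (σ.v .u))) ∧
      InsEnc σ lo (Cotree.ins x adj b) (σ.a .F (σ.a .R (σ.v .u))) (σ.a .E (σ.a .R (σ.v .u)))
        (σ.a .D (σ.a .R (σ.v .u)))) :
    ∃ τ, visitC.ev σ = saveC.ev τ ∧ Grow 11 visitVars σ τ ∧
      InsEnc τ lo (Cotree.ins x adj t) (τ.v .f) (τ.v .e) (τ.v .d) := by
  cases t with
  | leaf v =>
    obtain ⟨h1, h2, h3⟩ := ht
    obtain ⟨g₁, t₁⟩ := leafC_spec (σ := σ) (d := .t) (e := get .L (var .u)) (v := v) (by decide) hcnt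
      (by simp [Expr.val, h3])
    simp only [visitC, Cmd.ev, Expr.val, h2, le_refl, if_true, visitLeafC]
    set σ₁ := (leafC (get .L (var .u)) .t).ev σ
    have hL : σ₁.a .L (σ₁.v .u) = v := by
      rw [g₁.var .u (by decide) (by decide), g₁.arr .L _ (Or.inl hu), h3]
    have hX : σ₁.v .x = x := (g₁.var .x (by decide) (by decide)).trans hx
    have hN : σ₁.v .n = n := (g₁.var .n (by decide) (by decide)).trans hn
    refine ⟨_, rfl, ?_, ?_⟩
    · refine Grow.mono (e := 1 + (0 + (0 + (0 + 0)))) (ws := [.t] ++ ([.f] ++ ([.e] ++ ([.d] ++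
        [.f, .e]))))
        (g₁.trans ((Grow.setV _ (by decide) 0).trans ((Grow.setV _ (by decide) 0).trans
        ((Grow.setV _ (by decide) 0).trans ?_)))) (by omega) (by decide)
      exact Grow.ite ((Grow.setV _ (y := .f) (by decide) _).mono (ws' := [.f, .e]) le_rfl (by decide))
        ((Grow.setV _ (y := .e) (by decide) _).mono (ws' := [.f, .e]) le_rfl (by decide))
    · simp only [Store.setV_v, Store.setV_a, Store.setV_inp, reduceCtorEq, if_false, hL,
        hX, hN, g₁.inp, ← hadj]
      cases hv : adj v
      · simp only [Bool.false_eq_true, if_false]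
        constructor <;> simp [Cotree.ins, hv, OEnc]
        exact ⟨t₁.1, t₁.2⟩
      · simp only [if_true]
        constructor <;> simp [Cotree.ins, hv, OEnc]
        exact ⟨t₁.1, t₁.2⟩
  | node o a b =>
    obtain ⟨h1, h2, h3, h4, h5, h6⟩ := ht
    obtain ⟨ha, hb⟩ := hch o a b rfl
    have hk : ¬ σ.a .K (σ.v .u) ≤ 0 := by rw [h2]; cases o <;> simp [opCode]
    simp only [visitC, Cmd.ev, Expr.val, hk, if_false]
    obtain ⟨g₁, lo₁, la, lb, lfa, lea, lda, lfb, leb, ldb⟩ := loadC_spec σ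
    set σ₁ := loadC.ev σ
    have hLa : Enc σ₁ lo' a (σ₁.v .a) := by rw [la]; exact h5.grow g₁ (by omega)
    have hLb : Enc σ₁ lo' b (σ₁.v .b) := by rw [lb]; exact h6.grow g₁ (by omega)
    obtain ⟨g₂, m₂⟩ := adjustC_spec (σ := σ₁) (a := .a) (o := .o) (f := .fa) (e := .ea) (d := .da)
      (x := x) (O := o) (by decide) (by decide) (by decide) (by decide) (by decide) (by decide) hlo
      (hcnt.trans g₁.le) ((g₁.var .x (by decide) (by decide)).trans hx) (lo₁.trans h2) hLa
      (by rw [lfa, lea, lda]; exact ha.grow g₁)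
    set σ₂ := (adjustC .a .o .fa .ea .da).ev σ₁
    have g12 := g₁.trans g₂
    have b₂ : σ₂.v .b = σ₁.v .b := g₂.var _ (by decide) (by decide)
    have o₂ : σ₂.v .o = opCode o := (g₂.var _ (by decide) (by decide)).trans (lo₁.trans h2)
    obtain ⟨g₃, m₃⟩ := adjustC_spec (σ := σ₂) (a := .b) (o := .o) (f := .fb) (e := .eb) (d := .db)
      (x := x) (O := o) (by decide) (by decide) (by decide) (by decide) (by decide) (by decide) hlo
      (hcnt.trans g12.le) ((g12.var .x (by decide) (by decide)).trans hx) o₂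
      (by rw [b₂]; exact hLb.grow g₂ (by rw [lb]; have := g₁.le; omega))
      (by rw [g₂.var .fb (by decide) (by decide), g₂.var .eb (by decide) (by decide),
            g₂.var .db (by decide) (by decide), lfb, leb, ldb]; exact hb.grow g12)
    set σ₃ := (adjustC .b .o .fb .eb .db).ev σ₂
    have g13 := g12.trans g₃
    obtain ⟨g₄, m₄⟩ := combineC_spec (σ := σ₃) hlo (hcnt.trans g13.le)
      ((g₃.var _ (by decide) (by decide)).trans o₂)
      (by rw [g₃.var .fa (by decide) (by decide), g₃.var .ea (by decide) (by decide),
            g₃.var .da (by decide) (by decide)]; exact m₂.grow g₃) m₃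
    -- The bound `11` on new nodes is `3 + 3` for the two adjustments and `5` for the combination.
    exact ⟨_, rfl, (g13.trans g₄).mono le_rfl (by decide), m₄⟩

theorem InsEnc.congr {σ τ : Store} {lo : ℕ} {r : Cotree.Ins (Fin n)} {f e d : ℕ}
    (h : InsEnc σ lo r f e d) (hc : σ.v .cnt ≤ τ.v .cnt)
    (hst : ∀ A, Arr.IsHeap A → ∀ i < σ.v .cnt, τ.a A i = σ.a A i) :
    InsEnc τ lo r f e d := by
  have key : ∀ {t : Option (Cotree (Fin n))} {u : ℕ}, OEnc σ lo t u → OEnc τ lo t u := by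
    intro t u h
    cases t with
    | none => exact h
    | some t => exact ⟨h.1.congr fun A hA i hi => hst A hA i (by have := h.2; omega),
        h.2.trans_le hc⟩
  exact ⟨key h.f, key h.e, key h.d⟩

theorem not_isHeap_and_isRes {A : Arr} (h : Arr.IsRes A) : ¬ Arr.IsHeap A := by
  rcases h with rfl | rfl | rfl <;> simp [Arr.IsHeap]

/-- A visit of node `u` stores the result for the subtree at `u`. -/
theorem visitC_spec {σ : Store} {lo lo' : ℕ} {x : Fin n} {adj : Fin n → Bool}
    {t : Cotree (Fin n)} (hlo : 1 ≤ lo) (hcnt : lo ≤ σ.v .cnt) (hx : σ.v .x = x)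
    (hn : σ.v .n = n) (hadj : ∀ v : Fin n, adj v = true ↔ 1 ≤ σ.inp (x * n + v))
    (hu : σ.v .u < σ.v .cnt) (ht : Enc σ lo' t (σ.v .u))
    (hch : ∀ o a b, t = .node o a b →
      InsEnc σ lo (Cotree.ins x adj a) (σ.a .F (σ.a .L (σ.v .u))) (σ.a .E (σ.a .L (σ.v .u)))
        (σ.a .D (σ.a .L (σ.v .u))) ∧
      InsEnc σ lo (Cotree.ins x adj b) (σ.a .F (σ.a .R (σ.v .u))) (σ.a .E (σ.a .R (σ.v .u)))
        (σ.a .D (σ.a .R (σ.v .u)))) :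
    σ.v .cnt ≤ (visitC.ev σ).v .cnt ∧ (visitC.ev σ).v .cnt ≤ σ.v .cnt + 11 ∧
    (∀ A i, (i < σ.v .cnt ∨ ¬ Arr.IsHeap A) → (Arr.IsRes A → i ≠ σ.v .u) →
      (visitC.ev σ).a A i = σ.a A i) ∧
    (∀ y, y ∉ visitVars → y ≠ .cnt → (visitC.ev σ).v y = σ.v y) ∧
    (visitC.ev σ).inp = σ.inp ∧
    InsEnc (visitC.ev σ) lo (Cotree.ins x adj t) ((visitC.ev σ).a .F (σ.v .u))
      ((visitC.ev σ).a .E (σ.v .u)) ((visitC.ev σ).a .D (σ.v .u)) := by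
  obtain ⟨τ, hev, g, m⟩ := visitC_spec_aux hlo hcnt hx hn hadj hu ht hch
  have hτu : τ.v .u = σ.v .u := g.var _ (by decide) (by decide)
  have hev' : visitC.ev σ = ((τ.setA .F (σ.v .u) (τ.v .f)).setA .E (σ.v .u) (τ.v .e)).setA .D
      (σ.v .u) (τ.v .d) := by
    rw [hev]; simp [saveC, Cmd.ev, Expr.val, hτu]
  rw [hev']
  refine ⟨g.le, g.le_add, fun A i hi hA => ?_, g.var, g.inp, ?_⟩
  · simp only [Store.setA_a]
    simp only [Arr.IsRes] at hA
    rw [if_neg (by tauto), if_neg (by tauto), if_neg (by tauto)]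
    exact g.arr A i hi
  · have := m.congr (τ := ((τ.setA .F (σ.v .u) (τ.v .f)).setA .E (σ.v .u) (τ.v .e)).setA .D
      (σ.v .u) (τ.v .d)) le_rfl (fun A hA i _ => by
        simp only [Store.setA_a]
        simp only [Arr.IsHeap] at hA
        rw [if_neg, if_neg, if_neg] <;> rcases hA with rfl | rfl | rfl <;> simp)
    simpa using this

/-! ### Loops over the nodes -/

/-- An induction principle for sweeps over the nodes in increasing order, which is a bottom-up order
as children have smaller numbers. The end `hi` is frozen in `cnt0`, so nodes created during the
sweep are not visited. -/
theorem forMarkedC_spec {c : Cmd} {σ : Store} {I : ℕ → Store → Prop} {lo hi : ℕ}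
    (hst : σ.v .st = lo) (hle : lo ≤ hi) (hnb : hi - lo ≤ σ.v .nb)
    (h0 : I lo (σ.setV .u lo)) (hI : ∀ w τ, I w τ → τ.v .u = w ∧ τ.v .cnt0 = hi)
    (hj : ∀ w τ j, I w τ → I w (τ.setV .j j))
    (hskip : ∀ w τ, lo ≤ w → w < hi → I w τ → τ.a .M w = 0 → I (w + 1) (τ.setV .u (w + 1)))
    (hstep : ∀ w τ, lo ≤ w → w < hi → I w τ → 1 ≤ τ.a .M w →
      (c.ev τ).v .u = w ∧ I (w + 1) ((c.ev τ).setV .u (w + 1))) :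
    I hi ((forMarkedC c).ev σ) := by
  have hstepC : ∀ τ : Store, (stepC c).ev τ = if τ.v .cnt0 ≤ τ.v .u then τ else
      if 1 ≤ τ.a .M (τ.v .u) then (c.ev τ).setV .u ((c.ev τ).v .u + 1)
      else τ.setV .u (τ.v .u + 1) := by
    intro τ
    simp only [stepC, Cmd.ev, Expr.val]
    congr 1
    by_cases h : 1 ≤ τ.a .M (τ.v .u) <;> simp [h]
  have hev : (forMarkedC c).ev σ = iter (fun j τ => (stepC c).ev (τ.setV .j j)) (σ.v .nb)
      (σ.setV .u lo) := by
    simp [forMarkedC, Cmd.ev, Expr.val, hst]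
  rw [hev]
  -- The loop runs `nb` times whatever the number of nodes is; once `hi` has been reached, the
  -- remaining rounds do nothing, hence the minimum in the invariant.
  have hfin : hi = min (lo + σ.v .nb) hi := by omega
  conv_lhs => rw [hfin]
  refine iter_induction (fun j τ => I (min (lo + j) hi) τ) (by simpa [hle] using h0)
    fun j hjm τ hτ => ?_
  have hτ' := hj _ _ j hτ
  obtain ⟨e1, e2⟩ := hI _ _ hτ'
  simp only [hstepC]
  by_cases hlt : lo + j < hi
  · have hm : min (lo + j) hi = lo + j := by omega
    have hm' : min (lo + (j + 1)) hi = lo + j + 1 := by omega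
    rw [hm] at hτ' e1
    rw [if_neg (by omega), hm', e1]
    split_ifs with hM
    · obtain ⟨u1, u2⟩ := hstep _ _ (by omega) hlt hτ' hM
      rw [u1]
      exact u2
    · exact hskip _ _ (by omega) hlt hτ' (by omega)
  · rw [if_pos (by omega)]
    have hm : min (lo + (j + 1)) hi = min (lo + j) hi := by omega
    rw [hm]
    exact hτ'

/-- The nodes of the cotree that is stored at `u`. -/
def nodes (σ : Store) : Cotree (Fin n) → ℕ → Finset ℕ
  | .leaf _, u => {u}
  | .node _ a b, u => insert u (nodes σ a (σ.a .L u) ∪ nodes σ b (σ.a .R u))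

/-- Only an inequality, as the encoding does not exclude that subtrees share nodes. -/
theorem card_nodes_le (σ : Store) (t : Cotree (Fin n)) (u : ℕ) : (nodes σ t u).card ≤ t.size := by
  induction t generalizing u with
  | leaf v => simp [nodes, Cotree.size]
  | node o a b iha ihb =>
    have h1 := iha (σ.a .L u)
    have h2 := ihb (σ.a .R u)
    have h3 := Finset.card_insert_le u (nodes σ a (σ.a .L u) ∪ nodes σ b (σ.a .R u))
    have h4 := Finset.card_union_le (nodes σ a (σ.a .L u)) (nodes σ b (σ.a .R u))
    simp only [nodes, Cotree.size]
    omega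

theorem self_mem_nodes (σ : Store) (t : Cotree (Fin n)) (u : ℕ) : u ∈ nodes σ t u := by
  cases t <;> simp [nodes]

theorem exists_enc_of_mem_nodes {σ : Store} {lo : ℕ} {t : Cotree (Fin n)} {u w : ℕ}
    (h : Enc σ lo t u) (hw : w ∈ nodes σ t u) :
    w ≤ u ∧ ∃ t' : Cotree (Fin n), Enc σ lo t' w ∧ nodes σ t' w ⊆ nodes σ t u := by
  induction t generalizing u with
  | leaf v =>
    obtain rfl : w = u := by simpa [nodes] using hw
    exact ⟨le_rfl, _, h, Finset.Subset.refl _⟩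
  | node o a b iha ihb =>
    have h' := h
    obtain ⟨h1, h2, h3, h4, h5, h6⟩ := h'
    simp only [nodes, Finset.mem_insert, Finset.mem_union] at hw
    rcases hw with rfl | hw | hw
    · exact ⟨le_rfl, _, h, Finset.Subset.refl _⟩
    · obtain ⟨hle, t', ht', hs⟩ := iha h5 hw
      exact ⟨by omega, t', ht', hs.trans (Finset.subset_union_left.trans (Finset.subset_insert _ _))⟩
    · obtain ⟨hle, t', ht', hs⟩ := ihb h6 hw
      exact ⟨by omega, t', ht', hs.trans (Finset.subset_union_right.trans (Finset.subset_insert _ _))⟩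

theorem children_mem_nodes {σ : Store} {lo : ℕ} {t : Cotree (Fin n)} {u w : ℕ}
    (h : Enc σ lo t u) (hw : w ∈ nodes σ t u) (hk : 1 ≤ σ.a .K w) :
    (σ.a .L w < w ∧ σ.a .L w ∈ nodes σ t u) ∧ (σ.a .R w < w ∧ σ.a .R w ∈ nodes σ t u) := by
  obtain ⟨-, t', ht', hs⟩ := exists_enc_of_mem_nodes h hw
  cases t' with
  | leaf v => have := ht'.2.1; omega
  | node o a b =>
    obtain ⟨h1, h2, h3, h4, h5, h6⟩ := ht'
    refine ⟨⟨h3, hs ?_⟩, h4, hs ?_⟩ <;> simp only [nodes, Finset.mem_insert, Finset.mem_union]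
    · exact Or.inr (Or.inl (self_mem_nodes _ _ _))
    · exact Or.inr (Or.inr (self_mem_nodes _ _ _))

/-- The set of marked nodes from `lo` on is closed under children and contained in `S`. -/
structure Marked (σ : Store) (lo hi root : ℕ) (S : Finset ℕ) : Prop where
  root : 1 ≤ σ.a .M root
  closed : ∀ w, lo ≤ w → w < hi → 1 ≤ σ.a .M w → 1 ≤ σ.a .K w →
    1 ≤ σ.a .M (σ.a .L w) ∧ 1 ≤ σ.a .M (σ.a .R w)
  sub : ∀ w, lo ≤ w → 1 ≤ σ.a .M w → w ∈ S

/-- Only `M` and some variables have been changed. -/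
structure OnlyMarks (σ τ : Store) : Prop where
  arr : ∀ A, A ≠ .M → τ.a A = σ.a A
  var : ∀ y, y ∉ [Var.u, .j, .cnt0] → τ.v y = σ.v y
  inp : τ.inp = σ.inp

/-- The nodes of an optional cotree. -/
def onodes (σ : Store) : Option (Cotree (Fin n)) → ℕ → Finset ℕ
  | none, _ => ∅
  | some t, u => nodes σ t u

/-- A descending sweep visits parents before children and so marks what is reachable from the root.
Marks are needed because the segment of the current cotree also contains discarded nodes: visiting
these too would let the segments grow by a constant factor per insertion. -/
theorem markC_spec {σ : Store} {lo : ℕ} {t : Option (Cotree (Fin n))} (hlo : 1 ≤ lo)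
    (hst : σ.v .st = lo) (hnb : σ.v .cnt - lo ≤ σ.v .nb)
    (ht : OEnc σ lo t (σ.v .root)) (hM : ∀ w, lo ≤ w → σ.a .M w = 0) :
    OnlyMarks σ (markC.ev σ) ∧ (markC.ev σ).v .cnt0 = σ.v .cnt ∧
      Marked (markC.ev σ) lo (σ.v .cnt) (σ.v .root) (onodes σ t (σ.v .root)) := by
  have hmem : ∀ w ∈ onodes σ t (σ.v .root), 1 ≤ σ.a .K w →
      (σ.a .L w < w ∧ σ.a .L w ∈ onodes σ t (σ.v .root)) ∧
      (σ.a .R w < w ∧ σ.a .R w ∈ onodes σ t (σ.v .root)) := by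
    intro w hw hk
    cases t with
    | none => simp [onodes] at hw
    | some t => exact children_mem_nodes ht.1 hw hk
  set S := onodes σ t (σ.v .root) with hS
  let σ₁ := (σ.setV .cnt0 (σ.v .cnt)).setA .M (σ.v .root) 1
  -- After `j` rounds, the top `j` nodes of the segment have passed their marks on to their
  -- children.
  let J : ℕ → Store → Prop := fun j τ => OnlyMarks σ τ ∧ τ.v .cnt0 = σ.v .cnt ∧
    1 ≤ τ.a .M (σ.v .root) ∧
    (∀ w, lo ≤ w → w < σ.v .cnt → σ.v .cnt - j ≤ w → 1 ≤ τ.a .M w → 1 ≤ σ.a .K w →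
      1 ≤ τ.a .M (σ.a .L w) ∧ 1 ≤ τ.a .M (σ.a .R w)) ∧
    (∀ w, lo ≤ w → 1 ≤ τ.a .M w → w ∈ S)
  have hJ0 : J 0 σ₁ := by
    refine ⟨⟨fun A hA => ?_, fun y hy => ?_, rfl⟩, by simp [σ₁], by simp [σ₁],
      fun w _ h1 h2 => by omega, fun w hw h1 => ?_⟩
    · funext i
      simp [σ₁, hA]
    · simp only [List.mem_cons, List.not_mem_nil, or_false, not_or] at hy
      simp [σ₁, hy]
    · have hw' : w = σ.v .root := by
        by_contra hne
        simp [σ₁, hne, hM w hw] at h1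
      cases t with
      | none =>
        have : σ.v .root = 0 := ht
        omega
      | some t => rw [hw', hS]; exact self_mem_nodes _ _ _
  have hJ : J (σ.v .nb) (markC.ev σ) := by
    have hnb' : σ₁.v .nb = σ.v .nb := by simp [σ₁]
    simp only [markC, Cmd.ev, Expr.val]
    rw [show ((σ.setV .cnt0 (σ.v .cnt)).setA .M ((σ.setV .cnt0 (σ.v .cnt)).v .root) 1) = σ₁ by
      simp [σ₁], hnb']
    refine iter_induction J hJ0 fun j _ τ hτ => ?_
    obtain ⟨hom, hc, hr, hcl, hsub⟩ := hτ
    have hst' : τ.v .st = lo := (hom.var .st (by decide)).trans hst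
    have hK : τ.a .K = σ.a .K := hom.arr _ (by decide)
    have hL : τ.a .L = σ.a .L := hom.arr _ (by decide)
    have hR : τ.a .R = σ.a .R := hom.arr _ (by decide)
    -- Truncation makes `u = 0` in the surplus rounds, which lies below `lo` and is skipped.
    set u := σ.v .cnt - 1 - j with hu
    have hom' : OnlyMarks σ ((τ.setV .j j).setV .u u) := by
      refine ⟨hom.arr, fun y hy => ?_, hom.inp⟩
      have hy' := hy
      simp only [List.mem_cons, List.not_mem_nil, or_false, not_or] at hy'
      simp only [Store.setV_v, hy', if_false]
      exact hom.var y hy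
    simp only [Store.setV_v, Store.setV_a, reduceCtorEq, if_false, if_true, hc, hst', hK, hL, hR,
      Store.setA_v, ← hu, Store.setA_a, false_and]
    have hskip : (lo ≤ u → 1 ≤ τ.a .M u → 1 ≤ σ.a .K u → False) →
        J (j + 1) ((τ.setV .j j).setV .u u) := by
      intro hno
      refine ⟨hom', by simp [hc], by simpa using hr, fun w h1 h2 h3 h4 h5 => ?_, by simpa using hsub⟩
      by_cases hw : σ.v .cnt - j ≤ w
      · exact hcl w h1 h2 hw h4 h5
      · obtain rfl : w = u := by omega
        exact absurd h5 (fun h5 => hno h1 h4 h5)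
    split_ifs with c1 c2 c3
    · obtain ⟨⟨l1, l2⟩, r1, r2⟩ := hmem u (hsub u c1 c2) c3
      refine ⟨⟨fun A hA => ?_, hom'.var, hom'.inp⟩, by simp [hc], ?_, ?_, ?_⟩
      · funext i
        simp only [Store.setA_a, hA, false_and, if_false]
        exact congrFun (hom'.arr A hA) i
      · simp only [Store.setA_a, Store.setV_a]
        split_ifs <;> first | exact le_rfl | exact hr
      · have hmono : ∀ i, 1 ≤ τ.a .M i →
            1 ≤ ((((τ.setV .j j).setV .u u).setA .M (σ.a .L u) 1).setA .M (σ.a .R u) 1).a .M i := by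
          intro i hi
          simp only [Store.setA_a, Store.setV_a]
          split_ifs <;> first | exact le_rfl | exact hi
        intro w h1 h2 h3 h4 h5
        by_cases hw : u < w
        · have hMw : ((((τ.setV .j j).setV .u u).setA .M (σ.a .L u) 1).setA .M (σ.a .R u) 1).a .M w =
              τ.a .M w := by
            simp only [Store.setA_a, Store.setV_a]
            rw [if_neg (by omega), if_neg (by omega)]
          rw [hMw] at h4
          have := hcl w h1 h2 (by omega) h4 h5
          exact ⟨hmono _ this.1, hmono _ this.2⟩
        · obtain rfl : w = u := by omega
          simp only [Store.setA_a, Store.setV_a, true_and, if_true]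
          split_ifs <;> simp
      · intro w h1 h2
        simp only [Store.setA_a, Store.setV_a, true_and] at h2
        split_ifs at h2 with e1 e2
        · exact e1 ▸ r2
        · exact e2 ▸ l2
        · exact hsub w h1 h2
    · exact hskip fun _ _ h => c3 h
    · exact hskip fun _ h _ => c2 h
    · exact hskip fun h _ _ => c1 h
  obtain ⟨hom, hc, hr, hcl, hsub⟩ := hJ
  refine ⟨hom, hc, hr, fun w h1 h2 h3 h4 => ?_, hsub⟩
  rw [hom.arr .K (by decide)] at h4
  rw [hom.arr .L (by decide), hom.arr .R (by decide)]
  exact hcl w h1 h2 (by omega) h3 h4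

/-- What has been achieved when the nodes from `lo` to `w` have been visited, starting in `σ`. -/
structure Visited (σ : Store) (lo : ℕ) (x : Fin n) (adj : Fin n → Bool) (w : ℕ) (τ : Store) :
    Prop where
  u : τ.v .u = w
  var : ∀ y, y ∉ visitVars → y ∉ [Var.u, .j, .cnt] → τ.v y = σ.v y
  inp : τ.inp = σ.inp
  arr : ∀ A i, (i < σ.v .cnt ∨ ¬ Arr.IsHeap A) → ¬ Arr.IsRes A → τ.a A i = σ.a A i
  cnt_le : σ.v .cnt ≤ τ.v .cnt
  le_cnt : τ.v .cnt ≤ σ.v .cnt + 11 * ((Finset.Ico lo w).filter (1 ≤ σ.a .M ·)).card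
  res : ∀ v, lo ≤ v → v < w → 1 ≤ σ.a .M v → ∀ t : Cotree (Fin n), Enc σ lo t v →
    InsEnc τ (σ.v .cnt) (Cotree.ins x adj t) (τ.a .F v) (τ.a .E v) (τ.a .D v)

theorem not_isRes_of_isHeap {A : Arr} (h : Arr.IsHeap A) : ¬ Arr.IsRes A :=
  fun h' => not_isHeap_and_isRes h' h

theorem Visited.enc {σ : Store} {lo : ℕ} {x : Fin n} {adj : Fin n → Bool} {w : ℕ} {τ : Store}
    (h : Visited σ lo x adj w τ) {t : Cotree (Fin n)} {v : ℕ} (ht : Enc σ lo t v)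
    (hv : v < σ.v .cnt) : Enc τ lo t v :=
  ht.congr fun A hA i hi => h.arr A i (Or.inl (by omega)) (not_isRes_of_isHeap hA)

theorem filter_Ico_succ {lo w : ℕ} (hw : lo ≤ w) (p : ℕ → Prop) [DecidablePred p] :
    ((Finset.Ico lo (w + 1)).filter p).card =
      ((Finset.Ico lo w).filter p).card + if p w then 1 else 0 := by
  rw [← Finset.insert_Ico_right_eq_Ico_add_one hw, Finset.filter_insert]
  split_ifs
  · rw [Finset.card_insert_of_notMem (by simp)]
  · rfl

/-- Marks are closed under children, and children come first in the sweep, so their results are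
available at each visit. The results consist of nodes from the old `cnt` on, and only marked nodes
contribute new ones. -/
theorem forMarkedC_visitC_spec {σ : Store} {lo r : ℕ} {x : Fin n} {adj : Fin n → Bool}
    {S : Finset ℕ} (hlo : 1 ≤ lo) (hle : lo ≤ σ.v .cnt) (hst : σ.v .st = lo)
    (hcnt0 : σ.v .cnt0 = σ.v .cnt) (hnb : σ.v .cnt - lo ≤ σ.v .nb)
    (hx : σ.v .x = x) (hn : σ.v .n = n)
    (hadj : ∀ v : Fin n, adj v = true ↔ 1 ≤ σ.inp (x * n + v))
    (hm : Marked σ lo (σ.v .cnt) r S) (hS : ∀ w ∈ S, ∃ t : Cotree (Fin n), Enc σ lo t w) :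
    Visited σ lo x adj (σ.v .cnt) ((forMarkedC visitC).ev σ) := by
  refine forMarkedC_spec (I := Visited σ lo x adj) hst hle hnb ?_ ?_ ?_ ?_ ?_
  · refine ⟨by simp, fun y _ hy => ?_, rfl, fun _ _ _ _ => rfl, by simp, by simp,
      fun v h1 h2 => by omega⟩
    simp only [List.mem_cons, List.not_mem_nil, or_false, not_or] at hy
    simp [hy]
  · intro w τ h
    exact ⟨h.u, (h.var .cnt0 (by decide) (by decide)).trans hcnt0⟩
  · intro w τ j h
    refine ⟨by simpa using h.u, fun y h1 h2 => ?_, h.inp, h.arr, by simpa using h.cnt_le,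
      by simpa using h.le_cnt, fun v h1 h2 h3 t ht => ?_⟩
    · have h2' := h2
      simp only [List.mem_cons, List.not_mem_nil, or_false, not_or] at h2'
      simpa [h2'] using h.var y h1 h2
    · exact (h.res v h1 h2 h3 t ht).congr (by simp) fun _ _ _ _ => rfl
  · intro w τ h1 h2 h h3
    have hMw : σ.a .M w = 0 := by
      rw [← h3, h.arr .M w (Or.inr (by simp [Arr.IsHeap])) (by simp [Arr.IsRes])]
    refine ⟨by simp, fun y h1 h2 => ?_, h.inp, h.arr, by simpa using h.cnt_le, ?_,
      fun v h1 h4 h5 t ht => ?_⟩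
    · have h2' := h2
      simp only [List.mem_cons, List.not_mem_nil, or_false, not_or] at h2'
      simpa [h2'] using h.var y h1 h2
    · rw [filter_Ico_succ h1, if_neg (by omega)]
      simpa using h.le_cnt
    · have : v ≠ w := by rintro rfl; omega
      exact (h.res v h1 (by omega) h5 t ht).congr (by simp) fun _ _ _ _ => rfl
  · intro w τ h1 h2 h h3
    have hMeq : τ.a .M = σ.a .M := by
      funext i
      exact h.arr .M i (Or.inr (by simp [Arr.IsHeap])) (by simp [Arr.IsRes])
    have hMw : 1 ≤ σ.a .M w := by rwa [hMeq] at h3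
    have hu := h.u
    have hcl := h.cnt_le
    -- Stated for every cotree encoded at `w`, as the invariant requires; one such cotree, supplied
    -- by `hS`, suffices for the clauses that do not mention it.
    have hspec := fun (t : Cotree (Fin n)) (ht : Enc σ lo t w) =>
      visitC_spec (σ := τ) (lo := σ.v .cnt) (lo' := lo) (x := x) (adj := adj) (t := t) (by omega) hcl
        ((h.var .x (by decide) (by decide)).trans hx) ((h.var .n (by decide) (by decide)).trans hn)
        (by rw [h.inp]; exact hadj) (by omega) (by rw [hu]; exact h.enc ht h2) (by
          rintro o a b rfl
          obtain ⟨k1, k2, k3, k4, k5, k6⟩ := ht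
          rw [hu, h.arr .L w (Or.inl h2) (by simp [Arr.IsRes]),
            h.arr .R w (Or.inl h2) (by simp [Arr.IsRes])]
          have hc := hm.closed w h1 h2 hMw (by rw [k2]; cases o <;> simp [opCode])
          exact ⟨h.res _ k5.le k3 hc.1 a k5, h.res _ k6.le k4 hc.2 b k6⟩)
    obtain ⟨t₀, ht₀⟩ := hS w (hm.sub w h1 hMw)
    obtain ⟨s1, s2, s3, s4, s5, -⟩ := hspec t₀ ht₀
    refine ⟨(s4 .u (by decide) (by decide)).trans hu, by simp, fun y g1 g2 => ?_, s5.trans h.inp,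
      fun A i g1 g2 => ?_, ?_, ?_, fun v g1 g2 g3 t ht => ?_⟩
    · have g2' := g2
      simp only [List.mem_cons, List.not_mem_nil, or_false, not_or] at g2'
      simp only [Store.setV_v, g2', if_false]
      rw [s4 y g1 g2'.2.2, h.var y g1 g2]
    · rw [← h.arr A i g1 g2]
      exact s3 A i (g1.imp_left fun g => by omega) fun g => absurd g g2
    · simp only [Store.setV_v, reduceCtorEq, if_false]
      omega
    · simp only [Store.setV_v, reduceCtorEq, if_false]
      rw [filter_Ico_succ h1, if_pos hMw]
      have := h.le_cnt
      omega
    · by_cases hvw : v = w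
      · subst hvw
        obtain ⟨-, -, -, -, -, q⟩ := hspec t ht
        rw [hu] at q
        exact q.congr (by simp) fun _ _ _ _ => rfl
      · have q := h.res v g1 (by omega) g3 t ht
        have e : ∀ A, Arr.IsRes A → (visitC.ev τ).a A v = τ.a A v := fun A hA =>
          s3 A v (Or.inr (not_isHeap_and_isRes hA)) fun _ => by omega
        simp only [Store.setV_a]
        rw [e .F (by simp [Arr.IsRes]), e .E (by simp [Arr.IsRes]), e .D (by simp [Arr.IsRes])]
        exact q.congr (by simpa using s1) fun A hA i hi => by
          simp only [Store.setV_a]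
          exact s3 A i (Or.inl hi) fun g => absurd hA (not_isHeap_and_isRes g)

theorem finishC_spec {σ : Store} {lo lo' : ℕ} {x : Fin n} {adj : Fin n → Bool}
    {t : Option (Cotree (Fin n))} (hlo : 1 ≤ lo) (hlo' : 1 ≤ lo') (hcnt : lo ≤ σ.v .cnt)
    (hx : σ.v .x = x) (ht : OEnc σ lo' t (σ.v .root))
    (hr : ∀ t', t = some t' → InsEnc σ lo (Cotree.ins x adj t') (σ.a .F (σ.v .root))
      (σ.a .E (σ.v .root)) (σ.a .D (σ.v .root))) :
    Grow 3 (.root :: visitVars) σ (finishC.ev σ) ∧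
      OEnc (finishC.ev σ) lo (Cotree.insert x adj t) ((finishC.ev σ).v .root) := by
  have hz := ht.eq_zero_iff hlo'
  cases t with
  | none =>
    have h0 : σ.v .root = 0 := ht
    obtain ⟨g, m⟩ := leafC_spec (σ := σ) (d := .root) (e := var .x) (v := x) (by decide) hcnt
      (by simp [Expr.val, hx])
    have hev : finishC.ev σ = (leafC (var .x) .root).ev σ := by
      simp [finishC, Cmd.ev, Expr.val, h0]
    rw [hev]
    exact ⟨g.mono (by omega) (by decide), m⟩
  | some t =>
    have h0 : σ.v .root ≠ 0 := by simpa using hz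
    obtain ⟨mf, me, md⟩ := hr t rfl
    set σ₁ := ((σ.setV .f (σ.a .F (σ.v .root))).setV .e (σ.a .E (σ.v .root))).setV .d
      (σ.a .D (σ.v .root)) with hσ₁
    have g₁ : Grow 0 [.f, .e, .d] σ σ₁ :=
      ((Grow.setV σ (y := .f) (by decide) _).trans (Grow.setV _ (y := .e) (by decide) _)).trans
        (Grow.setV _ (y := .d) (by decide) _)
    have vf : σ₁.v .f = σ.a .F (σ.v .root) := by simp [hσ₁]
    have ve : σ₁.v .e = σ.a .E (σ.v .root) := by simp [hσ₁]
    have vd : σ₁.v .d = σ.a .D (σ.v .root) := by simp [hσ₁]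
    have zd := md.eq_zero_iff hlo
    simp only [Cotree.insert]
    by_cases hd : σ.a .D (σ.v .root) = 0
    · have hev : finishC.ev σ = (attachC .o .f .e .root).ev ((opC .root .o).ev σ₁) := by
        simp [finishC, Cmd.ev, Expr.val, h0, hd, hσ₁]
      rw [hev, if_neg (by simp [zd.1 hd])]
      have hroot : Enc σ₁ lo' t (σ₁.v .root) := by
        rw [g₁.var .root (by decide) (by decide)]
        exact Enc.grow g₁ ht.1 ht.2
      obtain ⟨g₂, o₂⟩ := opC_spec (a := .root) (r := .o) (by decide) (by decide) hroot
      set σ₂ := (opC .root .o).ev σ₁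
      have g12 := g₁.trans g₂
      obtain ⟨g₃, m₃⟩ := attachC_spec (σ := σ₂) (o := .o) (f := .f) (e := .e) (d := .root) (x := x)
        (P := (Cotree.ins x adj t).P) (lo := lo) (by decide) (by decide) (by decide) (by decide) hlo
        (hcnt.trans g12.le) ((g12.var .x (by decide) (by decide)).trans hx) o₂
        (by rw [g₂.var .f (by decide) (by decide), vf]; exact mf.grow g12)
        (by rw [g₂.var .e (by decide) (by decide), ve]; exact me.grow g12)
      exact ⟨(g12.trans g₃).mono le_rfl (by decide), m₃⟩
    · have hev : finishC.ev σ = σ₁.setV .root (σ₁.v .d) := by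
        simp [finishC, Cmd.ev, Expr.val, h0, hd, hσ₁]
      rw [hev, if_pos (Option.isSome_iff_ne_none.2 (mt zd.2 hd))]
      have g₂ := g₁.trans (Grow.setV σ₁ (y := .root) (by decide) (σ₁.v .d))
      refine ⟨g₂.mono (by omega) (by decide), ?_⟩
      have := md.grow g₂
      simpa [vd] using this

/-- The state when the vertices below `x` have been inserted. -/
structure Built (G : SimpleGraph (Fin n)) (x : ℕ) (σ : Store) : Prop where
  nEq : σ.v .n = n
  nb : σ.v .nb = 25 * n + 25
  adj : ∀ u v : Fin n, 1 ≤ σ.inp (u * n + v) ↔ G.Adj u v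
  st_pos : 1 ≤ σ.v .st
  st_le : σ.v .st ≤ σ.v .cnt
  -- At most `2 * x` nodes are visited, each creating at most `11` nodes, and the new root costs at
  -- most `3` more. For `x ≤ n` this is below the loop bound `nb`.
  le : σ.v .cnt ≤ σ.v .st + (22 * x + 3)
  tree : ∃ t : Option (Cotree (Fin n)), Cotree.ORep G t ∧
    Cotree.overts t = Finset.univ.filter (fun v : Fin n => (v : ℕ) < x) ∧
    OEnc σ (σ.v .st) t (σ.v .root)
  M : ∀ w, σ.v .st ≤ w → σ.a .M w = 0
  sz : ∀ i, σ.a .sz i = 0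
  T : ∀ i, σ.a .T i = 0

theorem card_filter_lt {x : ℕ} (hx : x ≤ n) :
    (Finset.univ.filter (fun v : Fin n => (v : ℕ) < x)).card = x := by
  have h := Fintype.card_fin_lt_of_le hx
  rwa [Fintype.card_subtype] at h

theorem filter_lt_succ (x : Fin n) : Finset.univ.filter (fun v : Fin n => (v : ℕ) < x + 1) =
    insert x (Finset.univ.filter (fun v : Fin n => (v : ℕ) < x)) := by
  ext v
  simp only [Finset.mem_filter, Finset.mem_univ, true_and, Finset.mem_insert, Fin.ext_iff]
  omega

theorem card_onodes_le {G : SimpleGraph (Fin n)} {x : ℕ} (hx : x ≤ n)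
    {t : Option (Cotree (Fin n))} (ht : Cotree.ORep G t)
    (hv : Cotree.overts t = Finset.univ.filter (fun v : Fin n => (v : ℕ) < x)) (σ : Store) (u : ℕ) :
    (onodes σ t u).card ≤ 2 * x := by
  have hc := card_filter_lt hx
  rw [← hv] at hc
  cases t with
  | none => simp [onodes]
  | some t =>
    have h1 := card_nodes_le σ t u
    have h2 := Cotree.Rep.size_add_one ht
    simp only [onodes, Cotree.overts] at *
    omega

theorem onodes_congr {σ τ : Store} {t : Option (Cotree (Fin n))} {u : ℕ}
    (h : ∀ A, Arr.IsHeap A → τ.a A = σ.a A) : onodes τ t u = onodes σ t u := by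
  cases t with
  | none => rfl
  | some t =>
    simp only [onodes]
    induction t generalizing u with
    | leaf v => rfl
    | node o a b iha ihb =>
      simp only [nodes, h .L (by simp [Arr.IsHeap]), h .R (by simp [Arr.IsHeap]), iha, ihb]

theorem OEnc.congr {σ τ : Store} {lo : ℕ} {t : Option (Cotree (Fin n))} {u : ℕ}
    (h : OEnc σ lo t u) (hc : σ.v .cnt ≤ τ.v .cnt)
    (hst : ∀ A, Arr.IsHeap A → ∀ i < σ.v .cnt, τ.a A i = σ.a A i) : OEnc τ lo t u := by
  cases t with
  | none => exact h
  | some t => exact ⟨h.1.congr fun A hA i hi => hst A hA i (by have := h.2; omega),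
      h.2.trans_le hc⟩

theorem OEnc.exists_enc {σ : Store} {lo : ℕ} {t : Option (Cotree (Fin n))} {u : ℕ}
    (h : OEnc σ lo t u) : ∀ w ∈ onodes σ t u, ∃ t' : Cotree (Fin n), Enc σ lo t' w := by
  intro w hw
  cases t with
  | none => simp [onodes] at hw
  | some t =>
    obtain ⟨-, t', ht', -⟩ := exists_enc_of_mem_nodes h.1 hw
    exact ⟨t', ht'⟩

theorem OnlyMarks.oenc {σ τ : Store} (h : OnlyMarks σ τ) {lo : ℕ} {t : Option (Cotree (Fin n))}
    {u : ℕ} (ht : OEnc σ lo t u) : OEnc τ lo t u :=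
  ht.congr (h.var .cnt (by decide)).ge fun A hA _ _ => by
    rw [h.arr A (by rintro rfl; simp [Arr.IsHeap] at hA)]

theorem OnlyMarks.onodes {σ τ : Store} (h : OnlyMarks σ τ) (t : Option (Cotree (Fin n)))
    (u : ℕ) : onodes τ t u = onodes σ t u :=
  onodes_congr fun A hA => h.arr A (by rintro rfl; simp [Arr.IsHeap] at hA)

/-- The new cotree is built entirely from nodes behind the old one, so moving `st` to the old `cnt`
abandons the old segment, and the new segment has no marks yet. -/
theorem insertC_spec {G : SimpleGraph (Fin n)} (hG : IsCograph G) {σ : Store} (x : Fin n)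
    (h : Built G x σ) : Built G (x + 1) (insertC.ev (σ.setV .x x)) := by
  classical
  obtain ⟨t, trep, tv, tenc⟩ := h.tree
  set σ₀ := σ.setV .x x with hσ₀
  have henc₀ : OEnc σ₀ (σ₀.v .st) t (σ₀.v .root) := by
    simpa [hσ₀] using tenc.congr (τ := σ₀) (by simp [hσ₀]) fun _ _ _ _ => rfl
  have c0 : σ₀.v .cnt = σ.v .cnt := by simp [hσ₀]
  have s0 : σ₀.v .st = σ.v .st := by simp [hσ₀]
  have nb0 : σ₀.v .nb = 25 * n + 25 := by simpa [hσ₀] using h.nb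
  have hxn := x.2
  have hle := h.le
  have hsc := h.st_le
  have hsp := h.st_pos
  obtain ⟨om, oc, mk⟩ := markC_spec (σ := σ₀) (lo := σ.v .st) (t := t) h.st_pos s0
    (by rw [nb0, c0]; omega) (by rw [← s0]; exact henc₀) (by simpa [hσ₀] using h.M)
  set σ₁ := markC.ev σ₀
  have c1 : σ₁.v .cnt = σ.v .cnt := (om.var .cnt (by decide)).trans c0
  have r1 : σ₁.v .root = σ₀.v .root := om.var .root (by decide)
  have henc₁ : OEnc σ₁ (σ.v .st) t (σ₁.v .root) := by rw [r1, ← s0]; exact om.oenc henc₀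
  have x1 : σ₁.v .x = x := (om.var .x (by decide)).trans (by simp [hσ₀])
  set adj : Fin n → Bool := fun v => decide (G.Adj x v) with hadj
  have hv := forMarkedC_visitC_spec (σ := σ₁) (lo := σ.v .st) (r := σ₀.v .root) (x := x)
    (adj := adj) (S := onodes σ₁ t (σ₁.v .root)) h.st_pos (by omega)
    ((om.var .st (by decide)).trans s0)
    (by rw [oc, c1, c0]) (by rw [c1, om.var .nb (by decide), nb0]; omega) x1
    ((om.var .n (by decide)).trans (by simpa [hσ₀] using h.nEq))
    (fun v => by
      rw [om.inp, show σ₀.inp = σ.inp from rfl]; simpa [hadj] using (h.adj x v).symm)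
    (by rw [om.onodes, r1, c1, ← c0]; exact mk) henc₁.exists_enc
  set σ₂ := (forMarkedC visitC).ev σ₁
  -- Marked nodes belong to the current cotree on `x` vertices, so there are at most `2 * x`,
  -- however long the segment is.
  have hcard : ((Finset.Ico (σ.v .st) (σ₁.v .cnt)).filter (1 ≤ σ₁.a .M ·)).card ≤ 2 * x := by
    refine (Finset.card_le_card fun w hw => ?_).trans
      (card_onodes_le (by omega) trep tv σ₀ (σ₀.v .root))
    rw [Finset.mem_filter, Finset.mem_Ico] at hw
    exact mk.sub w hw.1.1 hw.2
  have hcl := hv.cnt_le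
  have hlc := hv.le_cnt
  have r2 : σ₂.v .root = σ₁.v .root := hv.var .root (by decide) (by decide)
  have henc₂ : OEnc σ₂ (σ.v .st) t (σ₂.v .root) := by
    rw [r2]
    exact henc₁.congr hcl fun A hA i hi => hv.arr A i (Or.inl hi) (not_isRes_of_isHeap hA)
  obtain ⟨g₃, m₃⟩ := finishC_spec (σ := σ₂) (lo := σ.v .cnt) (lo' := σ.v .st) (x := x) (adj := adj)
    (t := t) (by omega) h.st_pos (by omega) ((hv.var .x (by decide) (by decide)).trans x1) henc₂
    (by
      rintro t' rfl
      rw [r2, ← c1]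
      refine hv.res _ henc₁.1.le henc₁.2 ?_ t' henc₁.1
      rw [r1]; exact mk.root)
  set σ₃ := finishC.ev σ₂ with hσ₃
  have hcnt0 : σ₃.v .cnt0 = σ.v .cnt := by
    rw [g₃.var .cnt0 (by decide) (by decide), hv.var .cnt0 (by decide) (by decide), oc, c0]
  have hev : insertC.ev σ₀ = σ₃.setV .st (σ.v .cnt) := by
    rw [← hcnt0]; rfl
  have hw : insertC.wf = true := by decide
  have e1 := g₃.le
  have e2 := g₃.le_add
  have harr : ∀ A, ¬ Arr.IsHeap A → ¬ Arr.IsRes A → A ≠ .M → ∀ i,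
      (σ₃.setV .st (σ.v .cnt)).a A i = σ.a A i := by
    intro A h1 h2 h3 i
    rw [Store.setV_a, g₃.arr A i (Or.inr h1), hv.arr A i (Or.inr h1) h2, om.arr A h3]
    rfl
  have pn := insertC.ev_param hw σ₀ (y := .n) (by decide)
  have pnb := insertC.ev_param hw σ₀ (y := .nb) (by decide)
  rw [hev] at pn pnb ⊢
  obtain ⟨q1, q2⟩ := Cotree.insert_spec hG (x := x) (adj := adj) (t := t) (by simp [hadj]) trep
    (by simp [tv])
  refine ⟨pn.trans (by simpa [hσ₀] using h.nEq), pnb.trans nb0, ?_, ?_, ?_, ?_, ?_, ?_, ?_, ?_⟩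
  · intro u v
    rw [Store.setV_inp, g₃.inp, hv.inp, om.inp]
    exact h.adj u v
  · simp; omega
  · simp; omega
  · simp only [Store.setV_v, reduceCtorEq, if_false, if_true]
    omega
  · refine ⟨_, q1, by rw [q2, tv, filter_lt_succ], ?_⟩
    simp only [Store.setV_v, reduceCtorEq, if_false, if_true]
    exact m₃.congr (by simp) fun _ _ _ _ => rfl
  · intro w hw
    simp only [Store.setV_v, if_true] at hw
    rw [Store.setV_a, g₃.arr .M w (Or.inr (by simp [Arr.IsHeap])),
      hv.arr .M w (Or.inr (by simp [Arr.IsHeap])) (by simp [Arr.IsRes])]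
    -- A mark in the new segment would be at a node of the old cotree, but all of those lie below
    -- the new `st`.
    by_contra hne
    have hmem := mk.sub w (by omega) (by omega)
    cases t with
    | none => simp [onodes] at hmem
    | some t =>
      have h1 := (exists_enc_of_mem_nodes henc₀.1 hmem).1
      have h2 := henc₀.2
      omega
  · intro i
    rw [harr .sz (by simp [Arr.IsHeap]) (by simp [Arr.IsRes]) (by simp) i]
    exact h.sz i
  · intro i
    rw [harr .T (by simp [Arr.IsHeap]) (by simp [Arr.IsRes]) (by simp) i]
    exact h.T i

/-- The construction of the cotree is correct. -/
theorem buildC_spec {G : SimpleGraph (Fin n)} (hG : IsCograph G) {σ : Store} (hn : σ.v .n = n)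
    (hnb : σ.v .nb = 25 * n + 25) (hadj : ∀ u v : Fin n, 1 ≤ σ.inp (u * n + v) ↔ G.Adj u v)
    (hroot : σ.v .root = 0) (ha : ∀ A i, σ.a A i = 0) : Built G n (buildC.ev σ) := by
  simp only [buildC, Cmd.ev, Expr.val, Store.setV_v, reduceCtorEq, if_false, hn]
  refine iter_induction (fun x τ => Built G x τ) ?_ fun j hj τ hτ => insertC_spec hG ⟨j, hj⟩ hτ
  refine ⟨by simp [hn], by simp [hnb], hadj, by simp, by simp, by simp, ⟨none, trivial, ?_, ?_⟩,
    fun w _ => ha _ _, ha _, ha _⟩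
  · ext v; simp [Cotree.overts]
  · simp [OEnc, hroot]

open StarCover

/-! ## The dynamic program on the cotree -/

/-- The minimum of two numbers. -/
def minE (a b : Expr) : Expr := sub a (sub a b)

@[simp] theorem minE_val (σ : Store) (a b : Expr) :
    (minE a b).val σ = min (a.val σ) (b.val σ) := by
  simp only [minE, Expr.val]
  omega

/-- The table entry for node `w` and `c` centers. -/
def cellE (w : Var) (c : Expr) : Expr := add (mul (var w) (var .k1)) c

/-- The bound on the number of leaves at a join, with `ca` centers in the subtree at `a`. -/
def joinBoundE (a ca cb b : Var) : Expr :=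
  add (add (get .T (cellE a (var ca))) (mul (var .s) (var cb))) (sub (get .sz (var b)) (var cb))

/-- The best number of leaves at a join. -/
def joinE : Expr :=
  -- The cap by `n` does not change any achievable value. It is there because `minE` is truncated
  -- subtraction from its first argument, which makes the expression flat although it contains sums
  -- and products.
  minE (var .n) <| minE
    (minE (sub (add (get .sz (var .a)) (get .sz (var .b))) (add (var .ca) (var .cb)))
      (mul (var .s) (add (var .ca) (var .cb))))
    (minE (joinBoundE .a .ca .cb .b) (joinBoundE .b .cb .ca .a))

/-- The best number of leaves at a union. -/
def unionE : Expr :=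
  minE (var .n) (add (get .T (cellE .a (var .ca))) (get .T (cellE .b (var .cb))))

/-- Updates the table at node `u` for the `t`-th way to distribute the centers to the children. -/
def pairC : Cmd :=
  set .ca (div (var .t) (var .k1)) ;; set .cb (sub (var .t) (mul (var .ca) (var .k1))) ;;
  branch (var .ca) (get .sz (var .a)) (branch (var .cb) (get .sz (var .b))
    (branch (add (var .ca) (var .cb)) (var .k)
      (branch (var .o) (lit 1) (set .va unionE) (set .va joinE) ;;
        branch (get .T (cellE .u (add (var .ca) (var .cb)))) (var .va)
          (put .T (cellE .u (add (var .ca) (var .cb))) (var .va)) skip) skip) skip) skip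

/-- Computes the row of the table for node `u`. -/
def rowC : Cmd :=
  branch (get .K (var .u)) (lit 0) (put .sz (var .u) (lit 1)) <|
    set .o (get .K (var .u)) ;; set .a (get .L (var .u)) ;; set .b (get .R (var .u)) ;;
    put .sz (var .u) (minE (var .n) (add (get .sz (var .a)) (get .sz (var .b)))) ;;
    loop .t .kk pairC

/-- The variables that are used in the computation of a row. -/
def rowVars : List Var := [.t, .a, .b, .o, .ca, .cb, .va]

/-- Division by `k1` with remainder turns the single counter `t` into the pair `(c₁, c₂)`;
infeasible pairs are discarded before the entry for `c₁ + c₂` is raised. -/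
theorem pairC_spec {σ : Store} {O : Bool} (ho : σ.v .o = opCode O) {c₁ c₂ n₁ n₂ V : ℕ}
    (hc₁ : σ.v .t / σ.v .k1 = c₁) (hc₂ : σ.v .t - c₁ * σ.v .k1 = c₂)
    (h₁ : σ.a .sz (σ.v .a) = n₁) (h₂ : σ.a .sz (σ.v .b) = n₂)
    (hV : nodeVal (σ.v .s) O n₁ n₂ c₁ c₂ (σ.a .T (σ.v .a * σ.v .k1 + c₁))
      (σ.a .T (σ.v .b * σ.v .k1 + c₂)) = V) :
    (∀ y, y ∉ [Var.ca, .cb, .va] → (pairC.ev σ).v y = σ.v y) ∧ (pairC.ev σ).inp = σ.inp ∧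
    (∀ A, A ≠ .T → (pairC.ev σ).a A = σ.a A) ∧
    ∀ i, (pairC.ev σ).a .T i =
      if c₁ ≤ n₁ ∧ c₂ ≤ n₂ ∧ c₁ + c₂ ≤ σ.v .k ∧ i = σ.v .u * σ.v .k1 + (c₁ + c₂) then
        max (σ.a .T i) (min (σ.v .n) V) else σ.a .T i := by
  set σ₂ := (σ.setV .ca c₁).setV .cb c₂ with hσ₂
  set i₀ := σ.v .u * σ.v .k1 + (c₁ + c₂) with hi₀
  set W := min (σ.v .n) V with hW
  have hval : (branch (var .o) (lit 1) (set .va unionE) (set .va joinE)).ev σ₂ =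
      σ₂.setV .va W := by
    cases O
    · simp [Cmd.ev, Expr.val, ho, opCode, hσ₂, unionE, cellE, hW, ← hV, nodeVal]
    · simp [Cmd.ev, Expr.val, ho, opCode, hσ₂, joinE, joinBoundE, cellE, hW, ← hV, nodeVal, h₁, h₂]
  have hput : (branch (get .T (cellE .u (add (var .ca) (var .cb)))) (var .va)
      (put .T (cellE .u (add (var .ca) (var .cb))) (var .va)) skip).ev (σ₂.setV .va W) =
      if σ.a .T i₀ ≤ W then (σ₂.setV .va W).setA .T i₀ W else σ₂.setV .va W := by
    simp [Cmd.ev, Expr.val, hσ₂, cellE, hi₀]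
  have hev : pairC.ev σ = if c₁ ≤ n₁ then (if c₂ ≤ n₂ then (if c₁ + c₂ ≤ σ.v .k then
      (if σ.a .T i₀ ≤ W then (σ₂.setV .va W).setA .T i₀ W else σ₂.setV .va W) else σ₂) else σ₂)
      else σ₂ := by
    rw [← hput, ← hval]
    simp [pairC, Cmd.ev, Expr.val, hσ₂, hc₁, hc₂, h₁, h₂]
  have hvar : ∀ y, y ∉ [Var.ca, .cb, .va] → σ₂.v y = σ.v y ∧ (σ₂.setV .va W).v y = σ.v y := by
    intro y hy
    simp only [List.mem_cons, List.not_mem_nil, or_false, not_or] at hy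
    simp [hσ₂, hy]
  rw [hev]
  refine ⟨fun y hy => ?_, ?_, fun A hA => ?_, fun i => ?_⟩
  · split_ifs <;> first | exact (hvar y hy).1 | exact (hvar y hy).2
  · split_ifs <;> rfl
  · split_ifs
    · funext i; simp [hA, hσ₂]
    all_goals rfl
  · have hσi : ∀ j, σ₂.a .T j = σ.a .T j := fun _ => rfl
    by_cases a1 : c₁ ≤ n₁ <;> by_cases a2 : c₂ ≤ n₂ <;> by_cases a3 : c₁ + c₂ ≤ σ.v .k <;>
      simp only [a1, a2, a3, if_true, if_false, true_and, false_and, hσi]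
    by_cases a4 : σ.a .T i₀ ≤ W <;> by_cases a5 : i = i₀ <;>
      simp only [a4, a5, if_true, if_false, Store.setA_a, Store.setV_a, hσi, and_self, and_false] <;>
      omega

/-- The row of node `v` is correct for the cotree `t`. -/
def IsRow (G : SimpleGraph (Fin n)) (s k : ℕ) (τ : Store) (t : Cotree (Fin n)) (v : ℕ) : Prop :=
  τ.a .sz v = t.verts.card ∧
    ∀ c ≤ k, c ≤ t.verts.card → IsBest G s t.verts c (τ.a .T (v * (k + 1) + c))

/-- The parameters are set. -/
structure Params (n s k : ℕ) (σ : Store) : Prop where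
  n_eq : σ.v .n = n
  s_eq : σ.v .s = s
  k_eq : σ.v .k = k
  k1_eq : σ.v .k1 = k + 1
  kk_eq : σ.v .kk = (k + 1) * (k + 1)

/-- Entries stay achievable by `Covers.node`, and at the end they dominate every pair. By
`Covers.exists_of_node` and the monotonicity of `nodeVal`, this makes them optimal. At a leaf the
untouched zeros are already right. -/
theorem rowC_spec {G : SimpleGraph (Fin n)} {s k lo : ℕ} {σ : Store} (hp : Params n s k σ)
    {t : Cotree (Fin n)} (ht : Enc σ lo t (σ.v .u)) (hrep : t.Rep G)
    (hT : ∀ i, σ.v .u * (k + 1) ≤ i → σ.a .T i = 0)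
    (hch : ∀ o a b, t = .node o a b →
      IsRow G s k σ a (σ.a .L (σ.v .u)) ∧ IsRow G s k σ b (σ.a .R (σ.v .u))) :
    (∀ y, y ∉ rowVars → (rowC.ev σ).v y = σ.v y) ∧ (rowC.ev σ).inp = σ.inp ∧
    (∀ A, A ≠ .T → A ≠ .sz → (rowC.ev σ).a A = σ.a A) ∧
    (∀ v, v ≠ σ.v .u → (rowC.ev σ).a .sz v = σ.a .sz v) ∧
    (∀ i, i < σ.v .u * (k + 1) ∨ (σ.v .u + 1) * (k + 1) ≤ i →
      (rowC.ev σ).a .T i = σ.a .T i) ∧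
    IsRow G s k (rowC.ev σ) t (σ.v .u) := by
  set u := σ.v .u with hu
  cases t with
  | leaf v =>
    have hev : rowC.ev σ = σ.setA .sz u 1 := by simp [rowC, Cmd.ev, Expr.val, ht.2.1, ← hu]
    rw [hev]
    refine ⟨fun _ _ => rfl, rfl, fun A _ hA => ?_, fun v hv => by simp [hv], fun i _ => by simp,
      by simp [Cotree.verts], fun c _ hc => ?_⟩
    · funext i; simp [hA]
    · have : (σ.setA .sz u 1).a .T (u * (k + 1) + c) = 0 := by simp [hT]
      rw [this]
      exact isBest_singleton (by simpa [Cotree.verts] using hc)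
  | node o t₁ t₂ =>
    obtain ⟨-, hK, hL, hR, -, -⟩ := ht
    obtain ⟨hr₁, hr₂⟩ := hch o t₁ t₂ rfl
    obtain ⟨rep₁, rep₂, hpair⟩ := hrep
    set a := σ.a .L u with ha
    set b := σ.a .R u with hb
    set n₁ := t₁.verts.card with hn₁
    set n₂ := t₂.verts.card with hn₂
    have hdisj : Disjoint t₁.verts t₂.verts :=
      Finset.disjoint_left.2 fun x h1 h2 => (hpair x h1 x h2).1 rfl
    have hcard : (Cotree.node o t₁ t₂).verts.card = n₁ + n₂ := Finset.card_union_of_disjoint hdisj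
    have hle : ∀ U : Finset (Fin n), U.card ≤ n := fun U => by
      simpa using Finset.card_le_univ U
    have hlen : n₁ + n₂ ≤ n := hcard ▸ hle _
    set σ₁ := (((σ.setV .o (opCode o)).setV .a a).setV .b b).setA .sz u (n₁ + n₂) with hσ₁
    have hev : rowC.ev σ = iter (fun j τ => pairC.ev (τ.setV .t j)) ((k + 1) * (k + 1)) σ₁ := by
      have hk0 : ¬ opCode o ≤ 0 := by cases o <;> simp [opCode]
      have hmin : min n (n₁ + n₂) = n₁ + n₂ := by omega
      simp only [rowC, Cmd.ev, Expr.val, ← hu, hK, hk0, if_false, minE_val, Store.setV_v,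
        Store.setV_a, reduceCtorEq, if_true, Store.setA_v, hp.n_eq, hp.kk_eq, ← ha, ← hb, hr₁.1, hr₂.1,
        ← hn₁, ← hn₂, hmin, hσ₁]
    set U := (Cotree.node o t₁ t₂).verts with hU
    have hUeq : U = t₁.verts ∪ t₂.verts := rfl
    let val : ℕ → ℕ → ℕ := fun c₁ c₂ => nodeVal s o n₁ n₂ c₁ c₂ (σ.a .T (a * (k + 1) + c₁))
      (σ.a .T (b * (k + 1) + c₂))
    have hval : ∀ c₁ c₂, c₁ ≤ k → c₂ ≤ k → c₁ ≤ n₁ → c₂ ≤ n₂ →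
        Covers G s U (c₁ + c₂) (val c₁ c₂) := fun c₁ c₂ k₁ k₂ e₁ e₂ =>
      Covers.node hpair (hr₁.2 c₁ k₁ e₁).1 (hr₂.2 c₂ k₂ e₂).1
    -- Two-sided invariant: each entry is achievable, and it is at least the value of every feasible
    -- pair with index below `j`.
    let J : ℕ → Store → Prop := fun j τ =>
      (∀ y, y ∉ [Var.t, .ca, .cb, .va] → τ.v y = σ₁.v y) ∧ τ.inp = σ.inp ∧
      (∀ A, A ≠ .T → τ.a A = σ₁.a A) ∧
      (∀ i, i < u * (k + 1) ∨ (u + 1) * (k + 1) ≤ i → τ.a .T i = σ.a .T i) ∧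
      (∀ c ≤ k, c ≤ n₁ + n₂ → Covers G s U c (τ.a .T (u * (k + 1) + c))) ∧
      ∀ c₁ c₂, c₁ * (k + 1) + c₂ < j → c₂ ≤ k → c₁ ≤ n₁ → c₂ ≤ n₂ → c₁ + c₂ ≤ k →
        val c₁ c₂ ≤ τ.a .T (u * (k + 1) + (c₁ + c₂))
    have hJ : J ((k + 1) * (k + 1)) (rowC.ev σ) := by
      rw [hev]
      refine iter_induction J ⟨fun _ _ => rfl, rfl, fun _ _ => rfl, fun i _ => by simp [hσ₁],
        fun c _ hc => ?_, fun _ _ h => by omega⟩ fun j hj τ hτ => ?_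
      · have : σ₁.a .T (u * (k + 1) + c) = 0 := by simp [hσ₁, hT]
        rw [this]
        exact covers_zero (by rw [hcard]; exact hc)
      obtain ⟨j1, j2, j3, j4, j5, j6⟩ := hτ
      set τ' := τ.setV .t j with hτ'
      have hv : ∀ y, y ∉ [Var.t, .ca, .cb, .va] → τ'.v y = σ₁.v y := by
        intro y hy
        have hyt : y ≠ .t := by rintro rfl; simp at hy
        simpa [hτ', hyt] using j1 y hy
      have vk1 : τ'.v .k1 = k + 1 := (hv .k1 (by decide)).trans (by simp [hσ₁, hp.k1_eq])
      have vs : τ'.v .s = s := (hv .s (by decide)).trans (by simp [hσ₁, hp.s_eq])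
      have vk : τ'.v .k = k := (hv .k (by decide)).trans (by simp [hσ₁, hp.k_eq])
      have vn : τ'.v .n = n := (hv .n (by decide)).trans (by simp [hσ₁, hp.n_eq])
      have va : τ'.v .a = a := (hv .a (by decide)).trans (by simp [hσ₁])
      have vb : τ'.v .b = b := (hv .b (by decide)).trans (by simp [hσ₁])
      have vo : τ'.v .o = opCode o := (hv .o (by decide)).trans (by simp [hσ₁])
      have vu : τ'.v .u = u := (hv .u (by decide)).trans (by simp [hσ₁, ← hu])
      have vt : τ'.v .t = j := by simp [hτ']
      obtain ⟨d₁, hd₁⟩ : ∃ d, d = j / (k + 1) := ⟨_, rfl⟩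
      obtain ⟨d₂, hd₂⟩ : ∃ d, d = j - d₁ * (k + 1) := ⟨_, rfl⟩
      have hdm : d₁ * (k + 1) + d₂ = j := by
        have := Nat.div_mul_le_self j (k + 1)
        rw [← hd₁] at this
        omega
      have hd₂k : d₂ ≤ k := by
        have h1 := Nat.lt_succ_iff.1 (Nat.mod_lt j (Nat.succ_pos k))
        have h2 := Nat.div_add_mod' j (k + 1)
        rw [← hd₁] at h2
        have : j % (k + 1) ≤ k := h1
        omega
      have sza : τ'.a .sz a = n₁ := by
        rw [hτ', Store.setV_a, j3 .sz (by decide)]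
        simpa [hσ₁, hL.ne] using hr₁.1
      have szb : τ'.a .sz b = n₂ := by
        rw [hτ', Store.setV_a, j3 .sz (by decide)]
        simpa [hσ₁, hR.ne] using hr₂.1
      -- Rows are disjoint blocks of length `k + 1`, so writing row `u` leaves the rows of the
      -- children alone.
      have child : ∀ w c, w < u → c ≤ k → τ'.a .T (w * (k + 1) + c) = σ.a .T (w * (k + 1) + c) := by
        intro w c hw hc
        refine j4 _ (Or.inl ?_)
        have := Nat.mul_le_mul_right (k + 1) (Nat.succ_le_of_lt hw)
        rw [Nat.succ_mul] at this
        omega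
      have spec := pairC_spec (σ := τ') vo (c₁ := d₁) (c₂ := d₂) (by rw [vt, vk1, hd₁])
        (by rw [vt, vk1, hd₂]) (by rw [va, sza]) (by rw [vb, szb]) rfl
      rw [va, vb, vk1, vs, vk, vu, vn] at spec
      obtain ⟨s1, s2, s3, s4⟩ := spec
      have hcell : d₁ + d₂ ≤ k → nodeVal s o n₁ n₂ d₁ d₂ (τ'.a .T (a * (k + 1) + d₁))
          (τ'.a .T (b * (k + 1) + d₂)) = val d₁ d₂ := fun h => by
        rw [child a d₁ hL (by omega), child b d₂ hR (by omega)]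
      have hτT : τ'.a = τ.a := rfl
      have hmono : ∀ i, τ.a .T i ≤ (pairC.ev τ').a .T i := fun i => by
        rw [s4 i, hτT]
        split_ifs
        · exact le_max_left _ _
        · exact le_rfl
      refine ⟨fun y hy => ?_, s2.trans j2, fun A hA => (s3 A hA).trans (j3 A hA), fun i hi => ?_,
        fun c hc hc' => ?_, fun c₁ c₂ hlt hk₂ e₁ e₂ hk => ?_⟩
      · rw [s1 y fun h => hy (List.mem_cons_of_mem _ h), hv y hy]
      · rw [s4 i, if_neg, hτT, j4 i hi]
        rintro ⟨-, -, h1, h2⟩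
        rw [Nat.succ_mul] at hi
        omega
      · rw [s4, hτT]
        split_ifs with hif
        · obtain ⟨e1, e2, e3, e4⟩ := hif
          obtain rfl : c = d₁ + d₂ := by omega
          rw [hτT] at hcell
          rw [hcell e3]
          rcases le_total (τ.a .T (u * (k + 1) + (d₁ + d₂))) (min n (val d₁ d₂)) with hm | hm
          · rw [max_eq_right hm]
            exact (hval d₁ d₂ (by omega) (by omega) e1 e2).mono (min_le_right _ _)
          · rw [max_eq_left hm]
            exact j5 _ hc hc'
        · exact j5 c hc hc'
      · by_cases hlt' : c₁ * (k + 1) + c₂ < j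
        · exact (j6 c₁ c₂ hlt' hk₂ e₁ e₂ hk).trans (hmono _)
        · have hjeq : c₁ * (k + 1) + c₂ = j := by omega
          have hd : c₁ = d₁ := by
            rw [hd₁, ← hjeq, add_comm, Nat.add_mul_div_right _ _ (Nat.succ_pos k),
              Nat.div_eq_of_lt (by omega), zero_add]
          subst hd
          obtain rfl : c₂ = d₂ := by omega
          rw [s4, if_pos ⟨e₁, e₂, hk, rfl⟩, hcell hk]
          refine le_trans ?_ (le_max_right _ _)
          have h1 := (hval c₁ c₂ (by omega) (by omega) e₁ e₂).add_le
          have h2 := hle U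
          -- The cap is inactive: the value is a number of leaves that can be covered in `U`, hence
          -- at most `n`.
          rw [min_eq_right (by omega)]
    obtain ⟨j1, j2, j3, j4, j5, j6⟩ := hJ
    refine ⟨fun y hy => ?_, j2, fun A hA hA' => ?_, fun v hv => ?_, j4, ?_, fun c hc hc' => ?_⟩
    · simp only [rowVars, List.mem_cons, List.not_mem_nil, or_false, not_or] at hy
      rw [j1 y (by simp [hy])]
      simp [hσ₁, hy]
    · rw [j3 A hA]
      funext i
      simp [hσ₁, hA']
    · rw [j3 .sz (by decide)]
      simp [hσ₁, hv]
    · rw [j3 .sz (by decide), hcard]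
      simp [hσ₁]
    · rw [hcard] at hc'
      refine ⟨j5 c hc hc', fun l hl => ?_⟩
      obtain ⟨c₁, c₂, l₁, l₂, rfl, hC₁, hC₂, hll⟩ := Covers.exists_of_node hpair hl
      have b1 := hC₁.add_le
      have b2 := hC₂.add_le
      refine hll.trans ((nodeVal_mono ((hr₁.2 c₁ (by omega) (by omega)).2 _ hC₁)
        ((hr₂.2 c₂ (by omega) (by omega)).2 _ hC₂)).trans
        (j6 c₁ c₂ ?_ (by omega) (by omega) (by omega) hc))
      have := Nat.mul_le_mul_right (k + 1) (show c₁ ≤ k by omega)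
      rw [Nat.succ_mul]
      omega

/-! ### Filling the table and reading off the answer -/

theorem exists_rep_of_mem_nodes {G : SimpleGraph (Fin n)} {σ : Store} {lo : ℕ}
    {t : Cotree (Fin n)} {u w : ℕ} (h : Enc σ lo t u) (hrep : t.Rep G) (hw : w ∈ nodes σ t u) :
    ∃ t' : Cotree (Fin n), Enc σ lo t' w ∧ t'.Rep G := by
  induction t generalizing u with
  | leaf v =>
    obtain rfl : w = u := by simpa [nodes] using hw
    exact ⟨_, h, hrep⟩
  | node o a b iha ihb =>
    have h' := h
    obtain ⟨-, -, -, -, h5, h6⟩ := h'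
    simp only [nodes, Finset.mem_insert, Finset.mem_union] at hw
    rcases hw with rfl | hw | hw
    · exact ⟨_, h, hrep⟩
    · exact iha h5 hrep.1 hw
    · exact ihb h6 hrep.2.1 hw

/-- The rows of the marked nodes from `lo` to `w` have been computed, starting in `σ`. -/
structure Filled (G : SimpleGraph (Fin n)) (s k lo : ℕ) (σ : Store) (w : ℕ) (τ : Store) :
    Prop where
  u : τ.v .u = w
  var : ∀ y, y ∉ rowVars → y ∉ [Var.u, .j] → τ.v y = σ.v y
  arr : ∀ A, A ≠ .T → A ≠ .sz → τ.a A = σ.a A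
  zero : ∀ i, w * (k + 1) ≤ i → τ.a .T i = 0
  row : ∀ v, lo ≤ v → v < w → 1 ≤ σ.a .M v → ∀ t : Cotree (Fin n), Enc σ lo t v → t.Rep G →
    IsRow G s k τ t v

theorem Enc.congr_arr {σ τ : Store} {lo : ℕ} {t : Cotree (Fin n)} {u : ℕ} (h : Enc σ lo t u)
    (ha : ∀ A, A ≠ .T → A ≠ .sz → τ.a A = σ.a A) : Enc τ lo t u :=
  h.congr fun A hA i _ => by
    rw [ha A (by rintro rfl; simp [Arr.IsHeap] at hA) (by rintro rfl; simp [Arr.IsHeap] at hA)]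

theorem IsRow.congr {G : SimpleGraph (Fin n)} {s k v : ℕ} {σ τ : Store} {t : Cotree (Fin n)}
    (h : IsRow G s k σ t v) (hsz : τ.a .sz v = σ.a .sz v)
    (hT : ∀ c ≤ k, τ.a .T (v * (k + 1) + c) = σ.a .T (v * (k + 1) + c)) : IsRow G s k τ t v :=
  ⟨hsz.trans h.1, fun c hc hc' => by rw [hT c hc]; exact h.2 c hc hc'⟩

/-- The same bottom-up sweep as for an insertion. The invariant keeps all later rows zero, from
which the next row starts its maximization. -/
theorem forMarkedC_rowC_spec {G : SimpleGraph (Fin n)} {s k : ℕ} {σ : Store} {lo hi r : ℕ}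
    {S : Finset ℕ} (hp : Params n s k σ) (hle : lo ≤ hi) (hst : σ.v .st = lo)
    (hcnt0 : σ.v .cnt0 = hi) (hnb : hi - lo ≤ σ.v .nb)
    (hm : Marked σ lo hi r S)
    (hS : ∀ w ∈ S, ∃ t : Cotree (Fin n), Enc σ lo t w ∧ t.Rep G) (hT : ∀ i, σ.a .T i = 0) :
    Filled G s k lo σ hi ((forMarkedC rowC).ev σ) := by
  have hsetV : ∀ {w w' : ℕ} {τ : Store} {y : Var} {z : ℕ}, y = .u ∨ y = .j →
      Filled G s k lo σ w τ → (τ.setV y z).v .u = w' →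
      (∀ i, w' * (k + 1) ≤ i → τ.a .T i = 0) →
      (∀ v, lo ≤ v → v < w' → 1 ≤ σ.a .M v → ∀ t : Cotree (Fin n), Enc σ lo t v → t.Rep G →
        IsRow G s k τ t v) → Filled G s k lo σ w' (τ.setV y z) := by
    intro w w' τ y z hy h h1 h2 h3
    refine ⟨h1, fun x hx hx' => ?_, h.arr, h2, h3⟩
    have : x ≠ y := by rintro rfl; rcases hy with rfl | rfl <;> simp at hx'
    simpa [this] using h.var x hx hx'
  refine forMarkedC_spec (I := Filled G s k lo σ) hst hle hnb ?_ ?_ ?_ ?_ ?_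
  · refine ⟨by simp, fun y _ hy => ?_, fun _ _ _ => rfl, fun i _ => hT i,
      fun v h1 h2 => by omega⟩
    simp only [List.mem_cons, List.not_mem_nil, or_false, not_or] at hy
    simp [hy]
  · exact fun w τ h => ⟨h.u, (h.var .cnt0 (by decide) (by decide)).trans hcnt0⟩
  · exact fun w τ j h => hsetV (Or.inr rfl) h (by simpa using h.u) h.zero h.row
  · intro w τ h1 h2 h h3
    refine hsetV (Or.inl rfl) h (by simp) (fun i hi => h.zero i ?_) fun v g1 g2 g3 => ?_
    · rw [Nat.succ_mul] at hi; omega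
    · have hM : σ.a .M w = 0 := by rw [← h3, h.arr .M (by decide) (by decide)]
      have : v ≠ w := by rintro rfl; omega
      exact h.row v g1 (by omega) g3
  · intro w τ h1 h2 h h3
    have hMw : 1 ≤ σ.a .M w := by rwa [h.arr .M (by decide) (by decide)] at h3
    have hu := h.u
    have hpτ : Params n s k τ :=
      ⟨(h.var _ (by decide) (by decide)).trans hp.n_eq, (h.var _ (by decide) (by decide)).trans hp.s_eq,
        (h.var _ (by decide) (by decide)).trans hp.k_eq,
        (h.var _ (by decide) (by decide)).trans hp.k1_eq,
        (h.var _ (by decide) (by decide)).trans hp.kk_eq⟩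
    have hspec := fun (t : Cotree (Fin n)) (ht : Enc σ lo t w) (hrep : t.Rep G) =>
      rowC_spec hpτ (lo := lo) (t := t) (by rw [hu]; exact ht.congr_arr h.arr) hrep
        (by rw [hu]; exact h.zero) (by
          rintro o a b rfl
          obtain ⟨k1, k2, k3, k4, k5, k6⟩ := ht
          rw [hu, h.arr .L (by decide) (by decide), h.arr .R (by decide) (by decide)]
          have hc := hm.closed w h1 h2 hMw (by rw [k2]; cases o <;> simp [opCode])
          exact ⟨h.row _ k5.le k3 hc.1 a k5 hrep.1, h.row _ k6.le k4 hc.2 b k6 hrep.2.1⟩)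
    obtain ⟨t₀, ht₀, hrep₀⟩ := hS w (hm.sub w h1 hMw)
    obtain ⟨s1, s2, s3, s4, s5, -⟩ := hspec t₀ ht₀ hrep₀
    rw [hu] at s4 s5
    refine ⟨(s1 .u (by decide)).trans hu, by simp, fun y g1 g2 => ?_,
      fun A g1 g2 => (s3 A g1 g2).trans (h.arr A g1 g2), fun i hi => ?_, fun v g1 g2 g3 t ht hrep => ?_⟩
    · have g2' := g2
      simp only [List.mem_cons, List.not_mem_nil, or_false, not_or] at g2'
      simp only [Store.setV_v, g2', if_false]
      rw [s1 y g1, h.var y g1 g2]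
    · rw [Store.setV_a, s5 i (Or.inr hi)]
      rw [Nat.succ_mul] at hi
      exact h.zero i (by omega)
    · by_cases hvw : v = w
      · subst hvw
        have := (hspec t ht hrep).2.2.2.2.2
        rw [hu] at this
        exact this
      · refine (h.row v g1 (by omega) g3 t ht hrep).congr (s4 v hvw) fun c hc => s5 _ (Or.inl ?_)
        have := Nat.mul_le_mul_right (k + 1) (show v + 1 ≤ w by omega)
        rw [Nat.succ_mul] at this
        omega

/-- Sets `ans` to `1` if all vertices can be covered. -/
def answerC : Cmd :=
  set .ans (lit 0) ;; (branch (var .n) (lit 0) (set .ans (lit 1)) <|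
    branch (mul (var .k) (add (var .s) (lit 1))) (var .n)
      (branch (mul (var .s) (var .k)) (get .T (cellE .root (var .k))) (set .ans (lit 1)) skip) skip)

/-- The main program. -/
def mainC : Cmd := buildC ;; markC ;; forMarkedC rowC ;; answerC

theorem numStars_le (n s : ℕ) : numStars n s ≤ n := by
  unfold numStars
  rw [Nat.ceilDiv_eq_add_pred_div, Nat.div_le_iff_le_mul_add_pred (Nat.succ_pos s)]
  rw [Nat.succ_mul]
  omega

theorem le_numStars_mul (n s : ℕ) : n ≤ numStars n s * (s + 1) := by
  have h := le_smul_ceilDiv (a := s + 1) (b := n) (by omega)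
  rw [smul_eq_mul, mul_comm] at h
  exact h

/-- The main program is correct. -/
theorem mainC_spec {G : SimpleGraph (Fin n)} (hG : IsCograph G) {s : ℕ} {σ : Store}
    (hp : Params n s (numStars n s) σ) (hnb : σ.v .nb = 25 * n + 25)
    (hadj : ∀ u v : Fin n, 1 ≤ σ.inp (u * n + v) ↔ G.Adj u v) (hroot : σ.v .root = 0)
    (ha : ∀ A i, σ.a A i = 0) :
    1 ≤ (mainC.ev σ).v .ans ↔ HasStarPartition G s := by
  classical
  set k := numStars n s with hk
  have hB := buildC_spec hG hp.n_eq hnb hadj hroot ha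
  have hsub : ∀ (c : Cmd), c.wf = true → ∀ {τ : Store}, Params n s k τ → Params n s k (c.ev τ) :=
    fun c hc τ h => ⟨(c.ev_param hc τ (by decide)).trans h.n_eq,
      (c.ev_param hc τ (by decide)).trans h.s_eq, (c.ev_param hc τ (by decide)).trans h.k_eq,
      (c.ev_param hc τ (by decide)).trans h.k1_eq, (c.ev_param hc τ (by decide)).trans h.kk_eq⟩
  have hp₁ := hsub buildC (by decide) hp
  set σ₁ := buildC.ev σ
  obtain ⟨t, trep, tv, tenc⟩ := hB.tree
  have hle := hB.le
  have hsp := hB.st_pos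
  have hsc := hB.st_le
  obtain ⟨om, oc, mk⟩ := markC_spec (σ := σ₁) (lo := σ₁.v .st) (t := t) hB.st_pos rfl
    (by rw [hB.nb]; omega) tenc hB.M
  have hp₂ := hsub markC (by decide) hp₁
  set σ₂ := markC.ev σ₁
  have hS : ∀ w ∈ onodes σ₁ t (σ₁.v .root),
      ∃ t : Cotree (Fin n), Enc σ₂ (σ₁.v .st) t w ∧ t.Rep G := by
    intro w hw
    cases t with
    | none => simp [onodes] at hw
    | some t =>
      obtain ⟨t', h1, h2⟩ := exists_rep_of_mem_nodes tenc.1 trep hw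
      exact ⟨t', h1.congr fun A hA _ _ => by
        rw [om.arr A (by rintro rfl; simp [Arr.IsHeap] at hA)], h2⟩
  have hF := forMarkedC_rowC_spec (σ := σ₂) (lo := σ₁.v .st) hp₂ hsc (om.var .st (by decide)) oc
    (by rw [om.var .nb (by decide), hB.nb]; omega) mk hS
    (by rw [om.arr .T (by decide)]; exact hB.T)
  have hp₃ := hsub (forMarkedC rowC) (by decide) hp₂
  have hev : mainC.ev σ = answerC.ev ((forMarkedC rowC).ev σ₂) := rfl
  rw [hev]
  set σ₃ := (forMarkedC rowC).ev σ₂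
  have hroot₃ : σ₃.v .root = σ₁.v .root :=
    (hF.var .root (by decide) (by decide)).trans (om.var .root (by decide))
  set T := σ₃.a .T (σ₁.v .root * (k + 1) + k) with hT
  have hval : (answerC.ev σ₃).v .ans =
      if n ≤ 0 then 1 else if k * (s + 1) ≤ n then if s * k ≤ T then 1 else 0 else 0 := by
    simp only [answerC, Cmd.ev, Expr.val, cellE, Store.setV_v, Store.setV_a, reduceCtorEq, if_false,
      hp₃.n_eq, hp₃.s_eq, hp₃.k_eq, hp₃.k1_eq, hroot₃]
    split_ifs <;> simp_all
  rw [hval, hasStarPartition_iff, Fintype.card_fin, ← hk]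
  have hkn := le_numStars_mul n s
  rw [← hk] at hkn
  have htu : Cotree.overts t = Finset.univ := by
    rw [tv]; exact Finset.filter_true_of_mem fun v _ => v.2
  -- Without vertices there is no root whose entry could be read; then `k = 0` and the empty family
  -- is a partition.
  by_cases hn : n ≤ 0
  · have hn0 : n = 0 := by omega
    have hk0 : k = 0 := by have := numStars_le n s; omega
    simp only [hn, if_true, le_refl, true_iff, hk0, mul_zero]
    exact ⟨by omega, covers_zero (by simp)⟩
  · cases t with
    | none =>
      have := congrArg Finset.card htu
      simp only [Cotree.overts, Finset.card_empty, Finset.card_univ, Fintype.card_fin] at this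
      omega
    | some t =>
      have hrow := hF.row _ tenc.1.le tenc.2 mk.root t (tenc.1.congr fun A hA _ _ => by
        rw [om.arr A (by rintro rfl; simp [Arr.IsHeap] at hA)]) trep
      have hbest := hrow.2 k le_rfl
      simp only [Cotree.overts] at htu
      rw [htu, Finset.card_univ, Fintype.card_fin] at hbest
      obtain ⟨b1, b2⟩ := hbest (numStars_le n s)
      rw [← hT] at b1 b2
      rw [if_neg hn]
      constructor
      · intro h
        split_ifs at h with h1 h2
        · exact ⟨by omega, b1.mono h2⟩
        all_goals omega
      · rintro ⟨h1, h2⟩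
        rw [if_pos h1.ge, if_pos (b2 _ h2)]

/-! ## The running time -/

/-- With the loops unfolded, the cost is a combination of `1`, `n`, `nb`, `n * nb` and `nb * kk`
with constant coefficients; the numerical constant is merely generous. -/
theorem exists_costB_le : ∃ C : ℕ, ∀ (p : Var → ℕ) (Y : ℕ), 1 ≤ Y → p .n ≤ Y → p .nb ≤ 50 * Y →
    p .n * p .nb ≤ 50 * Y → p .nb * p .kk ≤ 200 * Y → mainC.costB p ≤ C * Y := by
  -- This command contains no loop, so its cost bound does not depend on the parameters and can be
  -- treated as an unknown constant.
  have e₁ : ∀ p, visitC.costB p = visitC.costB 0 := fun _ => rfl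
  have e₂ : ∀ p, finishC.costB p = finishC.costB 0 := fun _ => rfl
  have e₃ : ∀ p, pairC.costB p = pairC.costB 0 := fun _ => rfl
  generalize visitC.costB 0 = v at e₁
  generalize finishC.costB 0 = f at e₂
  generalize pairC.costB 0 = q at e₃
  refine ⟨1000000 + 1000 * v + 1000 * f + 1000 * q, fun p Y h1 h2 h3 h4 h5 => ?_⟩
  simp only [mainC, buildC, insertC, markC, forMarkedC, stepC, rowC, answerC, cellE, minE,
    Cmd.costB, Expr.len, e₁, e₂, e₃]
  have g1 := Nat.mul_le_mul_left f h2
  have g2 := Nat.mul_le_mul_left v h4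
  have g3 := Nat.mul_le_mul_left q h5
  nlinarith

/-- The last bound uses `k ≤ n` in `n * k² ≤ k * n²`, and `k + 1 ≤ 2 * k` for nonempty graphs. -/
theorem parameters_le {n k : ℕ} (hk : k ≤ n) (hn : 1 ≤ n → 1 ≤ k) :
    n ≤ k * n ^ 2 + 1 ∧ 25 * n + 25 ≤ 50 * (k * n ^ 2 + 1) ∧
      n * (25 * n + 25) ≤ 50 * (k * n ^ 2 + 1) ∧
      (25 * n + 25) * ((k + 1) * (k + 1)) ≤ 200 * (k * n ^ 2 + 1) := by
  rcases Nat.eq_zero_or_pos n with rfl | h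
  · obtain rfl : k = 0 := by omega
    simp
  · have hk1 := hn h
    have e1 : n * n ≤ k * n ^ 2 := by rw [sq]; exact Nat.le_mul_of_pos_left _ hk1
    have e2 : n ≤ n * n := Nat.le_mul_of_pos_left _ h
    have e3 : n * (k * k) ≤ k * n ^ 2 := by
      calc n * (k * k) = k * (n * k) := by ring
        _ ≤ k * (n * n) := by gcongr
        _ = k * n ^ 2 := by ring
    have e4 : (25 * n + 25) * ((k + 1) * (k + 1)) ≤ 50 * n * ((2 * k) * (2 * k)) := by
      gcongr <;> omega
    have e5 : 50 * n * ((2 * k) * (2 * k)) = 200 * (n * (k * k)) := by ring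
    have e6 : n * (25 * n + 25) = 25 * (n * n) + 25 * n := by ring
    omega

/-! ## The program -/

/-- Computes the parameters. -/
def prologue : List Instr :=
  [.const 102 1, .add 103 1 102, .add 104 0 1, .div 2 104 103, .add 3 2 102, .mul 4 3 3,
    .const 105 25, .mul 5 0 105, .add 5 5 105, .mul baseReg 0 0]

/-- The program for Star Partition on cographs. -/
def program : Program :=
  prologue ++ (mainC.code 10 0 ++
    [.const 102 1, .jle 102 Var.ans.code (mainC.len + 13), .reject, .accept])

theorem codeAt_self (P : Program) : CodeAt P 0 P := fun i _ => by rw [zero_add]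

theorem numStars_eq (n s : ℕ) : numStars n s = (n + s) / (s + 1) := by
  rw [numStars, Nat.ceilDiv_eq_add_pred_div]
  rfl

/-- Parameters occupy the registers `0` to `5`, so `n` and `s` are already in place. The other
variables must be `0` because the construction starts from an empty root. -/
theorem prologue_reach {P : Program} {B : ℕ} {γ : Config} {n s : ℕ} (hP : CodeAt P 0 prologue)
    (hpc : γ.pc = 0) (h0 : γ.reg 0 = n) (h1 : γ.reg 1 = s) (hr : ∀ r, 2 ≤ r → γ.reg r = 0)
    (hγ : γ.BoundedBy B) (hB : 25 * (n + s + 1) ^ 2 ≤ B) :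
    ∃ γ', Reach P B γ 10 γ' ∧ γ'.pc = 10 ∧ γ'.mem = γ.mem ∧ γ'.reg 0 = n ∧ γ'.reg 1 = s ∧
      γ'.reg 2 = numStars n s ∧ γ'.reg 3 = numStars n s + 1 ∧
      γ'.reg 4 = (numStars n s + 1) * (numStars n s + 1) ∧ γ'.reg 5 = 25 * n + 25 ∧
      γ'.reg baseReg = n * n ∧ γ'.reg zeroReg = 0 ∧ ∀ r, 6 ≤ r → r < 98 → γ'.reg r = 0 := by
  have hk := numStars_le n s
  set k := numStars n s with hkdef
  have hk' : (n + s) / (s + 1) = k := (numStars_eq n s).symm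
  have b1 : 25 * (n + s + 1) ≤ B := by nlinarith
  have b2 : (k + 1) * (k + 1) ≤ B := by nlinarith
  have b3 : n * n ≤ B := by nlinarith
  rw [← hpc] at hP
  simp only [prologue, codeAt_cons] at hP
  obtain ⟨p0, p1, p2, p3, p4, p5, p6, p7, p8, p9, -⟩ := hP
  have r0 := Reach.regOp (d := 102) (w := 1) p0 rfl hγ (by omega)
  have r1 := Reach.regOp (d := 103) (w := s + 1) p1 (by simp [Instr.exec, h1]) r0.bounded (by omega)
  have r2 := Reach.regOp (d := 104) (w := n + s) p2 (by simp [Instr.exec, h0, h1]) r1.bounded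
    (by omega)
  have r3 := Reach.regOp (d := 2) (w := k) p3 (by simp [Instr.exec, hk']) r2.bounded (by omega)
  have r4 := Reach.regOp (d := 3) (w := k + 1) p4 (by simp [Instr.exec]) r3.bounded (by omega)
  have r5 := Reach.regOp (d := 4) (w := (k + 1) * (k + 1)) p5 (by simp [Instr.exec]) r4.bounded b2
  have r6 := Reach.regOp (d := 105) (w := 25) p6 rfl r5.bounded (by omega)
  have r7 := Reach.regOp (d := 5) (w := 25 * n) p7 (by simp [Instr.exec, h0, mul_comm]) r6.bounded
    (by omega)
  have r8 := Reach.regOp (d := 5) (w := 25 * n + 25) p8 (by simp [Instr.exec]) r7.bounded (by omega)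
  have r9 := Reach.regOp (d := baseReg) (w := n * n) p9 (by simp [Instr.exec, h0]) r8.bounded b3
  refine ⟨_, ((((((((r0.trans r1).trans r2).trans r3).trans r4).trans r5).trans r6).trans
    r7).trans r8).trans r9, by simp [hpc], rfl, ?_⟩
  simp only [baseReg, zeroReg]
  refine ⟨by simp [h0], by simp [h1], by simp, by simp, by simp, by simp, by simp,
    by simp [hr], fun r g1 g2 => ?_⟩
  simp only [Function.update_apply]
  repeat rw [if_neg (by omega)]
  exact hr r (by omega)

theorem Reach.mono {P : Program} {B B' : ℕ} {c c' : Config} {t : ℕ} (h : Reach P B c t c')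
    (hB : B ≤ B') : Reach P B' c t c' :=
  ⟨h.1, fun u hu => ⟨fun r => ((h.2 u hu).1 r).trans hB, fun a => ((h.2 u hu).2 a).trans hB⟩⟩

/-! ## The input -/

theorem starInput_mem_eq {n s : ℕ} (G : SimpleGraph (Fin n)) (u v : Fin n) :
    1 ≤ (starInput G s).mem (u * n + v) ↔ G.Adj u v := by
  simp only [starInput]
  split_ifs with h
  · obtain ⟨i, j, hij, he⟩ := h
    have hu := Nat.mul_add_mod' (u : ℕ) n v
    have hi := Nat.mul_add_mod' (i : ℕ) n j
    rw [he, hi, Nat.mod_eq_of_lt v.2, Nat.mod_eq_of_lt j.2] at hu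
    have hvj : j = v := Fin.ext hu
    subst hvj
    have : (u : ℕ) * n = i * n := by omega
    have hui : u = i := Fin.ext (Nat.eq_of_mul_eq_mul_right j.pos this)
    simpa [hui] using hij
  · exact iff_of_false (by omega) fun hadj => h ⟨u, v, hadj, rfl⟩

theorem starInput_mem_zero {n s : ℕ} (G : SimpleGraph (Fin n)) {a : ℕ} (ha : n * n ≤ a) :
    (starInput G s).mem a = 0 := by
  simp only [starInput]
  rw [if_neg]
  rintro ⟨i, j, -, rfl⟩
  have := Nat.mul_le_mul_right n (Nat.succ_le_of_lt i.2)
  rw [Nat.succ_mul] at this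
  have := j.2
  omega

theorem starInput_bounded {n s B : ℕ} (G : SimpleGraph (Fin n)) (hB : n + s + 1 ≤ B) :
    (starInput G s).BoundedBy B := by
  constructor
  · intro r
    simp only [starInput]
    split_ifs <;> omega
  · intro a
    simp only [starInput]
    split_ifs <;> omega

/-- The initial state is at most `M`, and a run of cubic length raises stored numbers to at most
`N`; the degree of the program turns this into a bound for the temporaries. The `12` extra steps are
the `10` of the prologue and the final comparison. -/
theorem program_decides {C : ℕ} (hC : ∀ (p : Var → ℕ) (Y : ℕ), 1 ≤ Y → p .n ≤ Y →
    p .nb ≤ 50 * Y → p .n * p .nb ≤ 50 * Y → p .nb * p .kk ≤ 200 * Y → mainC.costB p ≤ C * Y)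
    {n s B : ℕ} {G : SimpleGraph (Fin n)} (hG : IsCograph G)
    (hB : ((2 * C + 25) * (n + s + 1) ^ 3) ^ mainC.deg ≤ B) :
    DecidesWithin program (starInput G s) (C * (numStars n s * n ^ 2 + 1) + 12) B
      (HasStarPartition G s) := by
  classical
  set k := numStars n s with hk
  have hkn := numStars_le n s
  rw [← hk] at hkn
  have hX1 : 1 ≤ n + s + 1 := by omega
  set M := 25 * (n + s + 1) ^ 2 with hM
  set N := (2 * C + 25) * (n + s + 1) ^ 3 with hN
  have hM25 : 25 ≤ M := Nat.le_mul_of_pos_right _ (by positivity)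
  have hMX : 25 * (n + s + 1) ≤ M := Nat.mul_le_mul_left _ (Nat.le_self_pow (by omega) _)
  have hX23 : (n + s + 1) ^ 2 ≤ (n + s + 1) ^ 3 := Nat.pow_le_pow_right hX1 (by omega)
  have hMN' : M + C * (2 * (n + s + 1) ^ 3) ≤ N := by rw [hN, hM]; nlinarith
  have hNB : N ≤ B := (Nat.le_self_pow (by decide) N).trans hB
  have hMB : M ≤ B := by omega
  have hcode : CodeAt program 0 (prologue ++ (mainC.code 10 0 ++ [.const 102 1,
      .jle 102 Var.ans.code (mainC.len + 13), .reject, .accept])) := codeAt_self program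
  simp only [codeAt_append, codeAt_cons, Cmd.code_length] at hcode
  obtain ⟨hpro, hmain, hq1, hq2, hq3, hq4, -⟩ := hcode
  obtain ⟨γ, rpro, gpc, gmem, g0, g1, g2, g3, g4, g5, gb, gz, gr⟩ := prologue_reach (B := M)
    (n := n) (s := s) (γ := starInput G s) hpro rfl rfl rfl
    (fun r hr => by simp only [starInput]; rw [if_neg (by omega), if_neg (by omega)])
    (starInput_bounded G (by omega)) le_rfl
  -- The state is read off the machine; the whole memory may serve as the input array, as it is zero
  -- behind the matrix.
  let σ : Store := ⟨fun x => γ.reg x.code, fun A i => γ.mem (n * n + (i * 9 + A.code)), γ.mem⟩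
  have hrel : Rel (n * n) σ γ := ⟨fun _ => rfl, gz, gb, fun _ _ => rfl,
    fun i hi => by simpa only [σ, gmem] using starInput_mem_zero G hi, fun _ _ => rfl⟩
  have hσM : σ.Bd M := ⟨fun _ => rpro.bounded.1 _, fun _ _ => rpro.bounded.2 _,
    fun _ => rpro.bounded.2 _⟩
  have hp : Params n s k σ := ⟨g0, g1, g2, g3, g4⟩
  have hcost : mainC.cost σ ≤ C * (k * n ^ 2 + 1) := by
    obtain ⟨h1, h2, h3, h4⟩ := parameters_le hkn fun hn => by
      by_contra h0
      have := le_numStars_mul n s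
      rw [← hk, show k = 0 by omega] at this
      omega
    have hnb : σ.v .nb = 25 * n + 25 := g5
    refine (mainC.cost_le (by decide) σ σ.v fun _ _ => rfl).trans (hC _ _ (by omega) ?_ ?_ ?_ ?_)
    · rw [hp.n_eq]; exact h1
    · rw [hnb]; exact h2
    · rw [hp.n_eq, hnb]; exact h3
    · rw [hnb, hp.kk_eq]; exact h4
  have hY : k * n ^ 2 + 1 ≤ 2 * (n + s + 1) ^ 3 := by
    have h1 : k * n ^ 2 ≤ (n + s + 1) * (n + s + 1) ^ 2 :=
      Nat.mul_le_mul (by omega) (Nat.pow_le_pow_left (by omega) 2)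
    have h2 := Nat.one_le_pow 3 _ hX1
    have h3 : (n + s + 1) * (n + s + 1) ^ 2 = (n + s + 1) ^ 3 := by ring
    omega
  obtain ⟨γ₂, rmain, g2pc, hrel₂, -⟩ := Cmd.code_reach (P := program) (B := B) (N := N)
    (base := n * n) (by omega) (by nlinarith) mainC (by decide) hB hNB (σ := σ) (γ := γ) (M := M)
    (d := 0) (by omega) hσM
    ((Nat.add_le_add_left (hcost.trans (Nat.mul_le_mul_left C hY)) M).trans hMN')
    (by rw [gpc]; simpa [prologue] using hmain) hrel (Reach.mono rpro hMB).bounded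
  have hans := mainC_spec hG hp g5 (fun u v => by
    simpa only [σ, gmem] using starInput_mem_eq G u v) (gr _ (by decide) (by decide))
    (fun A i => by simpa only [σ, gmem] using starInput_mem_zero G (Nat.le_add_right _ _))
  have hpc2 : γ₂.pc = mainC.len + 10 := by rw [g2pc, gpc, add_comm]
  have hlen : prologue.length = 10 := rfl
  simp only [hlen, zero_add] at hq1 hq2 hq3 hq4
  have r1 := Reach.regOp (P := program) (B := B) (c := γ₂) (d := 102) (w := 1)
    (by rw [hpc2, add_comm]; exact hq1) rfl rmain.bounded (by omega)
  have r2 := Reach.one (P := program) (B := B) (i := .jle 102 Var.ans.code (mainC.len + 13))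
    (c := ⟨γ₂.pc + 1, Function.update γ₂.reg 102 1, γ₂.mem⟩)
    (by rw [hpc2, add_comm mainC.len]; exact hq2) r1.bounded r1.bounded
  have r := (((Reach.mono rpro hMB).trans rmain).trans r1).trans r2
  refine ⟨_, ?_, r.2, ?_⟩
  · omega
  · have hreg : Function.update γ₂.reg 102 1 Var.ans.code = (mainC.ev σ).v .ans := by
      rw [Function.update_of_ne (by decide)]
      exact hrel₂.var .ans
    rw [r.1]
    simp only [Instr.exec, Function.update_self, hreg, hans]
    by_cases hyes : HasStarPartition G s
    · left
      rw [if_pos hyes]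
      exact ⟨by rw [show mainC.len + 13 = 10 + mainC.len + 1 + 1 + 1 by omega]; exact hq4, hyes⟩
    · right
      rw [if_neg hyes, hpc2]
      exact ⟨by rw [show mainC.len + 10 + 1 + 1 = 10 + mainC.len + 1 + 1 by omega]; exact hq3, hyes⟩

end StarProg

end WordRAM

/-- Star Partition on cographs with `n` vertices is decided by a single random access machine with
words of `O(log (n + s))` bits in `O(k n²)` steps, where `k = ⌈n / (s + 1)⌉`. (The summand `1` only
matters for the graph without vertices, where `k n² = 0`.) -/
theorem theorem5 :
    ∃ (P : WordRAM.Program) (C : ℕ), ∀ (n s : ℕ) (G : SimpleGraph (Fin n)), IsCograph G →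
      WordRAM.DecidesWithin P (starInput G s)
        (C * (numStars n s * n ^ 2 + 1)) (C * (n + s + 1) ^ C) (HasStarPartition G s) := by
  obtain ⟨C, hC⟩ := WordRAM.StarProg.exists_costB_le
  -- One constant has to serve as factor and exponent: the `D`-th power of `(2 * C + 25) * (n + s +
  -- 1) ^ 3` has factor `A` and exponent `3 * D`, and `C + 12` covers the time.
  set D := WordRAM.StarProg.mainC.deg
  set A := (2 * C + 25) ^ D with hA
  refine ⟨WordRAM.StarProg.program, A + 3 * D + C + 12, fun n s G hG => ?_⟩
  obtain ⟨t, ht, hb, hd⟩ := WordRAM.StarProg.program_decides hC (s := s)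
    (B := (A + 3 * D + C + 12) * (n + s + 1) ^ (A + 3 * D + C + 12)) hG (by
      rw [mul_pow, ← pow_mul, ← hA]
      exact Nat.mul_le_mul (by omega) (Nat.pow_le_pow_right (by omega) (by omega)))
  refine ⟨t, ht.trans ?_, hb, hd⟩
  nlinarith [Nat.zero_le (A * (numStars n s * n ^ 2)), Nat.zero_le (D * (numStars n s * n ^ 2)),
    Nat.zero_le A, Nat.zero_le D]
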